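/- **Proposition 4.4 (Mapping non-equilibrium onto equilibrium).** Let $N\ge 1$, $s>0$, $\beta_L,\beta_R\in(0,1)$, $\rho_L=\frac{\beta_L}{1-\beta_L}$, $\rho_R=\frac{\beta_R}{1-\beta_R}$ and $\rho>0$. On real vectors $v=(v(m))_{m\in\mathbb N_0^N}$, with standard basis $|m\rangle$, let $S_\pm^{[i]},S_0^{[i]}$ ($1\le i\le N$) act by $$S_+^{[i]}|m\rangle=(m_i+2s)|m+\delta_i\rangle,\qquad S_-^{[i]}|m\rangle=m_i|m-\delta_i\rangle,\qquad S_0^{[i]}|m\rangle=(m_i+s)|m\rangle,$$ and put $S_a^{\rm tot}=\sum_{i=1}^N S_a^{[i]}$. Let $\varphi_s(k,n)=\frac1k\frac{\Gamma(n+1)\Gamma(n-k+2s)}{\Gamma(n-k+1)\Gamma(n+2s)}$ for $1\le k\le n$, $h_s(n)=\sum_{k=1}^n\varphi_s(k,n)$, and let $\psi=\Gamma'/\Gamma$. Let $$H=\mathcal B_1+\sum_{i=1}^{N-1}\mathcal H_{i,i+1}+\mathcal B_N ,$$ where $$\mathcal H_{i,i+1}|m\rangle=(h_s(m_i)+h_s(m_{i+1}))|m\rangle-\sum_{k=1}^{m_i}\varphi_s(k,m_i)|m-k\delta_i+k\delta_{i+1}\rangle-\sum_{k=1}^{m_{i+1}}\varphi_s(k,m_{i+1})|m+k\delta_i-k\delta_{i+1}\rangle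 ,$$ $$\mathcal B_i|m\rangle=\Big(h_s(m_i)+\sum_{k\ge1}\tfrac{\beta_i^k}{k}\Big)|m\rangle-\sum_{k=1}^{m_i}\varphi_s(k,m_i)|m-k\delta_i\rangle-\sum_{k\ge1}\tfrac{\beta_i^k}{k}|m+k\delta_i\rangle ,$$ with $\beta_L$ used in the left boundary term $\mathcal B_1$ and $\beta_R$ in the right boundary term $\mathcal B_N$ (for $N=1$ the two boundary terms, with these two parameters, act on the single site). Let $$H^{\rm eq}=\mathcal B^{\rm eq}_1+\sum_{i=1}^{N-1}\mathcal H_{i,i+1}+\mathcal B^{\rm eq}_N,\qquad \mathcal B_i^{\rm eq}=e^{-S_-^{[i]}}e^{\rho S_+^{[i]}}\big(\psi(S_0^{[i]}+s)-\psi(2s)\big)e^{-\rho S_+^{[i]}}e^{S_-^{[i]}},$$ $$Q_+=sS_+^{\rm tot}+\sum_{i=1}^N S_+^{[i]}\Big(S_0^{[i]}+2\sum_{j=i+1}^N S_0^{[j]}\Big),\qquad \mathcal W=\sum_{k=0}^\infty(\rho_L-\rho_R)^k\,\frac{Q_+^k}{k!}\,\frac{\Gamma(2(S_0^{\rm tot}+s))}{\Gamma(k+2(S_0^{\rm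 tot}+s))},$$ $$P=e^{-S_-^{\rm tot}}\,e^{\rho_R S_+^{\rm tot}}\,\mathcal W\,e^{-\rho S_+^{\rm tot}}\,e^{S_-^{\rm tot}} .$$ The operators are understood as follows. Let $\mathcal U$ be the space of vectors of exponential decay, i.e. those with $\sup_m|v(m)|\,r^{|m|}<\infty$ for some $r>1$, where $|m|=\sum_i m_i$. The operators $\mathcal H_{i,i+1}$, $\mathcal B_i$ act on $\mathcal U$ as infinite matrices; $\mathcal W$ and $e^{\pm cS_+}$ ($c\in\mathbb R$, total or at one site) act on all vectors by their series, and $e^{S_-}$ (total or at one site) acts on $\mathcal U$ by its series (all coordinatewise and absolutely convergent); $e^{-S_-}$ denotes the inverse of $e^{S_-}:\mathcal U\to\mathbb R^{\mathbb N_0^N}$; sums and compositions are taken on their natural domains. Then $H$ and $H^{\rm eq}$ are defined on all of $\mathcal U$; each of the operators $e^{S_-}$ (total or at one site) is defined on all of $\mathcal U$ and injective there; the domain of $P$ is dense in $\ell_2(\mathbb N_0^N)$ and $P$ is injective; and the equilibrium Hamiltonian is similar to the non-equilibrium one through $P$: $$H^{\rm eq}=P^{-1}\,H\,P ,$$ as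 an equality of operators on the domain of $P$ (in particular, the domain of $P^{-1}HP$ is the whole domain of $P$). -/

import Mathlib

open Finset

namespace OpenChain

noncomputable section

/-! ## Configurations and vectors

The chain has `N = n + 1 ≥ 1` sites, labelled by `Fin (n + 1)` from left to right. -/

/-- Configurations `m = (m_1, …, m_N)` of a chain with `N = n + 1` sites. -/
abbrev Config (n : ℕ) : Type := Fin (n + 1) → ℕ

/-- (Infinite) column vectors, i.e. families of coefficients in the standard basis `|m⟩`. -/
abbrev Vec (n : ℕ) : Type := Config n → ℝ

/-- The standard basis vector `|m⟩`. -/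
def ket {n : ℕ} (m : Config n) : Vec n := Pi.single m 1

/-- The total number of particles `|m|`. -/
def size {n : ℕ} (m : Config n) : ℕ := ∑ i, m i

/-- The space of vectors of exponential decay: `|v m| ≤ C r ^ (-|m|)` for some `r > 1`. -/
def decaying (n : ℕ) : Submodule ℝ (Vec n) where
  carrier := {v | ∃ r : ℝ, 1 < r ∧ ∃ C : ℝ, ∀ m, |v m| * r ^ size m ≤ C}
  zero_mem' := ⟨2, by norm_num, 0, fun m => by simp⟩
  add_mem' := by
    rintro v w ⟨r, hr, C, hC⟩ ⟨r', hr', C', hC'⟩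
    refine ⟨min r r', lt_min hr hr', C + C', fun m => ?_⟩
    have h0 : (0 : ℝ) ≤ min r r' := le_of_lt (lt_trans one_pos (lt_min hr hr'))
    have h1 : min r r' ^ size m ≤ r ^ size m := pow_le_pow_left₀ h0 (min_le_left _ _) _
    have h2 : min r r' ^ size m ≤ r' ^ size m := pow_le_pow_left₀ h0 (min_le_right _ _) _
    calc |(v + w) m| * min r r' ^ size m
        ≤ (|v m| + |w m|) * min r r' ^ size m :=
          mul_le_mul_of_nonneg_right (abs_add_le _ _) (pow_nonneg h0 _)
      _ = |v m| * min r r' ^ size m + |w m| * min r r' ^ size m := add_mul _ _ _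
      _ ≤ |v m| * r ^ size m + |w m| * r' ^ size m :=
          add_le_add (mul_le_mul_of_nonneg_left h1 (abs_nonneg _))
            (mul_le_mul_of_nonneg_left h2 (abs_nonneg _))
      _ ≤ C + C' := add_le_add (hC m) (hC' m)
  smul_mem' := by
    rintro c v ⟨r, hr, C, hC⟩
    refine ⟨r, hr, |c| * C, fun m => ?_⟩
    have h : |(c • v) m| * r ^ size m = |c| * (|v m| * r ^ size m) := by
      rw [Pi.smul_apply, smul_eq_mul, abs_mul, mul_assoc]
    rw [h]
    exact mul_le_mul_of_nonneg_left (hC m) (abs_nonneg c)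

/-! ## Partially defined operators -/

/-- The composition `g ∘ f` of partially defined operators on its natural domain
`{x ∈ dom f | f x ∈ dom g}`. -/
def after {E : Type*} [AddCommGroup E] [Module ℝ E] (g f : E →ₗ.[ℝ] E) : E →ₗ.[ℝ] E :=
  g.comp (f.domRestrict ((g.domain.comap f.toFun).map f.domain.subtype)) (by
    rintro ⟨x, hx⟩
    obtain ⟨⟨y, hy, hyx⟩, hxf⟩ := hx
    have hyx' : y = ⟨x, hxf⟩ := Subtype.ext hyx
    subst hyx'
    exact hy)

infixr:80 " ∘ₙ " => after

/-- An everywhere defined operator, regarded as a partially defined one. -/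
abbrev total {E : Type*} [AddCommGroup E] [Module ℝ E] (A : E →ₗ[ℝ] E) : E →ₗ.[ℝ] E :=
  A.toPMap ⊤

/-- The operator `v ↦ ∑ₖ Aₖ v`, defined on those `v` for which the series converges absolutely in
every coordinate. -/
def seriesOp {n : ℕ} (A : ℕ → Module.End ℝ (Vec n)) : Vec n →ₗ.[ℝ] Vec n where
  domain :=
    { carrier := {v | ∀ p, Summable fun k => A k v p}
      zero_mem' := fun p => by simp
      add_mem' := fun {v w} hv hw p => by simpa using (hv p).add (hw p)
      smul_mem' := fun c v hv p => by simpa using (hv p).mul_left c }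
  toFun :=
    { toFun := fun v p => ∑' k, A k v.1 p
      map_add' := fun v w => by
        funext p
        simpa using (v.2 p).tsum_add (w.2 p)
      map_smul' := fun c v => by
        funext p
        simpa using tsum_mul_left (a := c) (f := fun k => A k v.1 p) }

/-- The exponential `e^A = ∑ₖ Aᵏ / k!`. -/
def expOp {n : ℕ} (A : Module.End ℝ (Vec n)) : Vec n →ₗ.[ℝ] Vec n :=
  seriesOp fun k => ((k.factorial : ℝ)⁻¹) • A ^ k

/-- The operator given on the vectors of exponential decay by the infinite matrix whose `m`-th
column (the image of `|m⟩`) is `col m`, i.e. `(T v)(p) = ∑ₘ (col m)(p) v(m)`; its domain consists of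
the vectors of exponential decay for which all these sums converge absolutely. -/
def matrixOp {n : ℕ} (col : Config n → Vec n) : Vec n →ₗ.[ℝ] Vec n where
  domain :=
    { carrier := {v | v ∈ decaying n ∧ ∀ p, Summable fun m => col m p * v m}
      zero_mem' := ⟨zero_mem _, fun p => by simp⟩
      add_mem' := fun {v w} hv hw =>
        ⟨add_mem hv.1 hw.1, fun p => by simpa [mul_add] using (hv.2 p).add (hw.2 p)⟩
      smul_mem' := fun c v hv =>
        ⟨Submodule.smul_mem _ c hv.1, fun p => by
          simpa [mul_left_comm] using (hv.2 p).mul_left c⟩ }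
  toFun :=
    { toFun := fun v p => ∑' m, col m p * v.1 m
      map_add' := fun v w => by
        funext p
        simpa [mul_add] using (v.2.2 p).tsum_add (w.2.2 p)
      map_smul' := fun c v => by
        funext p
        simpa [mul_left_comm] using tsum_mul_left (a := c) (f := fun m => col m p * v.1 m) }

/-! ## The `sl(2)` generators -/

/-- The diagonal operator `|m⟩ ↦ f(m) |m⟩`. -/
def diagOp {n : ℕ} (f : Config n → ℝ) : Module.End ℝ (Vec n) where
  toFun v p := f p * v p
  map_add' v w := by funext p; simp [mul_add]
  map_smul' c v := by funext p; simp [mul_left_comm]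

/-- `S₀` at site `i`: `|m⟩ ↦ (m_i + s) |m⟩`. -/
def S0 {n : ℕ} (s : ℝ) (i : Fin (n + 1)) : Module.End ℝ (Vec n) := diagOp fun m => m i + s

/-- `S₊` at site `i`: `|m⟩ ↦ (m_i + 2 s) |m + δ_i⟩`. -/
def Splus {n : ℕ} (s : ℝ) (i : Fin (n + 1)) : Module.End ℝ (Vec n) where
  toFun v p :=
    if p i = 0 then 0 else (((p i - 1 : ℕ) : ℝ) + 2 * s) * v (Function.update p i (p i - 1))
  map_add' v w := by funext p; by_cases h : p i = 0 <;> simp [h, mul_add]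
  map_smul' c v := by funext p; by_cases h : p i = 0 <;> simp [h, mul_left_comm]

/-- `S₋` at site `i`: `|m⟩ ↦ m_i |m - δ_i⟩`. -/
def Sminus {n : ℕ} (i : Fin (n + 1)) : Module.End ℝ (Vec n) where
  toFun v p := ((p i : ℝ) + 1) * v (Function.update p i (p i + 1))
  map_add' v w := by funext p; simp [mul_add]
  map_smul' c v := by funext p; simp [mul_left_comm]

theorem diagOp_ket {n : ℕ} (f : Config n → ℝ) (m : Config n) :
    diagOp f (ket m) = f m • ket m := by
  funext p
  by_cases h : p = m
  · subst h; simp [diagOp]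
  · simp [diagOp, ket, h]

theorem Splus_ket {n : ℕ} (s : ℝ) (i : Fin (n + 1)) (m : Config n) :
    Splus s i (ket m) = ((m i : ℝ) + 2 * s) • ket (Function.update m i (m i + 1)) := by
  funext p
  by_cases h : p = Function.update m i (m i + 1)
  · subst h
    simp [Splus, ket]
  · have hR : ket (Function.update m i (m i + 1)) p = 0 := by simp [ket, h]
    by_cases h0 : p i = 0
    · simp [Splus, h0, hR]
    · have h2 : Function.update p i (p i - 1) ≠ m := by
        rintro rfl
        apply h
        have h3 : p i - 1 + 1 = p i := Nat.succ_pred_eq_of_ne_zero h0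
        simp [h3]
      have hL : ket m (Function.update p i (p i - 1)) = 0 := by simp [ket, h2]
      simp [Splus, h0, hR, hL]

theorem Sminus_ket {n : ℕ} (i : Fin (n + 1)) (m : Config n) :
    Sminus i (ket m) = (m i : ℝ) • ket (Function.update m i (m i - 1)) := by
  funext p
  by_cases h : Function.update p i (p i + 1) = m
  · subst h
    simp [Sminus, ket]
  · have hL : ket m (Function.update p i (p i + 1)) = 0 := by simp [ket, h]
    have hR : (m i : ℝ) * ket (Function.update m i (m i - 1)) p = 0 := by
      by_cases h0 : m i = 0
      · simp [h0]
      · have h2 : p ≠ Function.update m i (m i - 1) := by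
          rintro rfl
          apply h
          have h3 : m i - 1 + 1 = m i := Nat.succ_pred_eq_of_ne_zero h0
          simp [h3]
        simp [ket, h2]
    simp [Sminus, hL, hR]

/-- `S₊^tot`. -/
def SplusTot {n : ℕ} (s : ℝ) : Module.End ℝ (Vec n) := ∑ i, Splus s i

/-- `S₋^tot`. -/
def SminusTot {n : ℕ} : Module.End ℝ (Vec n) := ∑ i, Sminus i

/-- The eigenvalue of `S₀^tot` on `|m⟩`. -/
def spinTot {n : ℕ} (s : ℝ) (m : Config n) : ℝ := ∑ i, ((m i : ℝ) + s)

/-- `e^A` on the vectors of exponential decay (used for the operators `A = S₋` at one site and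
`A = S₋^tot`). -/
def expDec {n : ℕ} (A : Module.End ℝ (Vec n)) : Vec n →ₗ.[ℝ] Vec n :=
  (expOp A).domRestrict (decaying n)

/-- `e^{-A}`, the inverse of the operator `e^A` on the vectors of exponential decay. (The power
series of `e^{-S₋}` diverges on vectors such as `e^{ρ S₊} |0⟩` with `ρ ≥ 1`.) -/
def expDecInv {n : ℕ} (A : Module.End ℝ (Vec n)) : Vec n →ₗ.[ℝ] Vec n := (expDec A).inverse

/-! ## The Hamiltonian -/

/-- The jump rates `φ_s(k, n) = (1/k) Γ(n+1) Γ(n-k+2s) / (Γ(n-k+1) Γ(n+2s))` for `1 ≤ k ≤ n`. -/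
def rate (s : ℝ) (k n : ℕ) : ℝ :=
  if 1 ≤ k ∧ k ≤ n then
    1 / (k : ℝ) * (Real.Gamma ((n : ℝ) + 1) * Real.Gamma ((n : ℝ) - k + 2 * s)) /
      (Real.Gamma ((n : ℝ) - k + 1) * Real.Gamma ((n : ℝ) + 2 * s))
  else 0

/-- The shifted harmonic numbers `h_s(n) = ∑_{k=1}^n φ_s(k, n)`. -/
def harmonicNumber (s : ℝ) (n : ℕ) : ℝ := ∑ k ∈ Icc 1 n, rate s k n

/-- The digamma function `ψ = (log Γ)'` on the reals. -/
def psi (x : ℝ) : ℝ := logDeriv Real.Gamma x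

/-- The configuration `m + k δ_i`. -/
def put {n : ℕ} (m : Config n) (i : Fin (n + 1)) (k : ℕ) : Config n :=
  Function.update m i (m i + k)

/-- The configuration `m - k δ_i` (used for `k ≤ m_i` only). -/
def take {n : ℕ} (m : Config n) (i : Fin (n + 1)) (k : ℕ) : Config n :=
  Function.update m i (m i - k)

/-- The bulk Hamiltonian density `𝓗_{i,j}` (for neighbouring sites `i`, `j`). -/
def bulk {n : ℕ} (s : ℝ) (i j : Fin (n + 1)) : Vec n →ₗ.[ℝ] Vec n :=
  matrixOp fun m =>
    (harmonicNumber s (m i) + harmonicNumber s (m j)) • ket m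
      - ∑ k ∈ Icc 1 (m i), rate s k (m i) • ket (put (take m i k) j k)
      - ∑ k ∈ Icc 1 (m j), rate s k (m j) • ket (put (take m j k) i k)

/-- The boundary term `𝓑_i` with reservoir parameter `β`. -/
def boundary {n : ℕ} (s β : ℝ) (i : Fin (n + 1)) : Vec n →ₗ.[ℝ] Vec n :=
  matrixOp fun m =>
    (harmonicNumber s (m i) + ∑' k : ℕ, β ^ (k + 1) / ((k : ℝ) + 1)) • ket m
      - ∑ k ∈ Icc 1 (m i), rate s k (m i) • ket (take m i k)
      - fun p => ∑' k : ℕ, β ^ (k + 1) / ((k : ℝ) + 1) * ket (put m i (k + 1)) p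

/-- The non-equilibrium Hamiltonian `H = 𝓑_1 + ∑ 𝓗_{i,i+1} + 𝓑_N` with reservoir parameters
`β_L`, `β_R`. -/
def hamiltonian (n : ℕ) (s βL βR : ℝ) : Vec n →ₗ.[ℝ] Vec n :=
  boundary s βL 0 + ∑ i : Fin n, bulk s i.castSucc i.succ + boundary s βR (Fin.last n)

/-- The equilibrium boundary term
`𝓑_i^eq = e^{-S₋} e^{ρ S₊} (ψ(S₀ + s) - ψ(2s)) e^{-ρ S₊} e^{S₋}` (all generators at site `i`). -/
def boundaryEq {n : ℕ} (s ρ : ℝ) (i : Fin (n + 1)) : Vec n →ₗ.[ℝ] Vec n :=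
  expDecInv (Sminus i) ∘ₙ expOp (ρ • Splus s i) ∘ₙ
    total (diagOp fun m => psi (((m i : ℝ) + s) + s) - psi (2 * s)) ∘ₙ
      expOp (-(ρ • Splus s i)) ∘ₙ expDec (Sminus i)

/-- The equilibrium Hamiltonian `H^eq = 𝓑_1^eq + ∑ 𝓗_{i,i+1} + 𝓑_N^eq` with density `ρ`. -/
def hamiltonianEq (n : ℕ) (s ρ : ℝ) : Vec n →ₗ.[ℝ] Vec n :=
  boundaryEq s ρ 0 + ∑ i : Fin n, bulk s i.castSucc i.succ + boundaryEq s ρ (Fin.last n)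

/-! ## The transformation -/

/-- `Q₊ = s S₊^tot + ∑_i S₊^{[i]} (S₀^{[i]} + 2 ∑_{j>i} S₀^{[j]})`. -/
def Qplus {n : ℕ} (s : ℝ) : Module.End ℝ (Vec n) :=
  s • SplusTot s + ∑ i, Splus s i * (S0 s i + (2 : ℝ) • ∑ j ∈ Ioi i, S0 s j)

/-- The non-local transformation
`𝓦 = ∑ₖ Δᵏ (Q₊ᵏ / k!) Γ(2 (S₀^tot + s)) / Γ(k + 2 (S₀^tot + s))`, where `Δ = ρ_L - ρ_R`. -/
def nonlocalW {n : ℕ} (s Δ : ℝ) : Vec n →ₗ.[ℝ] Vec n :=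
  seriesOp fun k => (Δ ^ k / (k.factorial : ℝ)) •
    (Qplus s ^ k * diagOp fun m =>
      Real.Gamma (2 * (spinTot s m + s)) / Real.Gamma ((k : ℝ) + 2 * (spinTot s m + s)))

/-- `P = e^{-S₋^tot} e^{ρ_R S₊^tot} 𝓦 e^{-ρ S₊^tot} e^{S₋^tot}`, with its natural domain. -/
def mapP (n : ℕ) (s ρL ρR ρ : ℝ) : Vec n →ₗ.[ℝ] Vec n :=
  expDecInv SminusTot ∘ₙ expOp (ρR • SplusTot s) ∘ₙ nonlocalW s (ρL - ρR) ∘ₙ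
    expOp (-(ρ • SplusTot s)) ∘ₙ expDec SminusTot

end

end OpenChain

open OpenChain

namespace OpenChain

noncomputable section

/-! ## Graded operators on formal vectors -/

/-! Everything is moved to the other side of `e^{S₋^tot}`. On vectors of exponential decay this
operator is the binomial transform `lowered univ`, v ↦ (j ↦ Σ_m ∏ C(m_i, j_i) v(m)), and in that
picture the Hamiltonian becomes triangular in the particle number. Triangular operators act on all
formal vectors, because each coordinate is a finite sum; so the algebra needs no convergence
(`Raises`, `gradedSum`), and analysis enters only through the transform.

Write E_i for |m⟩ ↦ |m + δ_i⟩. The bulk commutes with `S₋^tot` and so is unchanged (`lowered_bulk`).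
A boundary term with parameter β becomes h_s(m_i) + log(1 - ρ E_i) with ρ = β/(1-β)
(`lowered_boundary`), and this equals e^{ρS₊} h_s e^{-ρS₊} at site i (`boundaryForm_eq_conj`). Two
consequences follow. The equilibrium boundary term is an ordinary boundary term with β = ρ/(1+ρ)
(`boundaryEq_eq`). And, as the bulk also commutes with `S₊^tot`, conjugation by e^{cS₊^tot} adds c
to both densities, so the right one can be made zero (`exp_mul_hamiltonianForm`).

Let D be the triangular form with both densities zero. What remains is the relation (D + log(1 -
ΔE_0)) 𝓦 = 𝓦 D with Δ = ρ_L - ρ_R. The commutator of a bulk density with Q₊ is a difference S₊^{[i]}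
- S₊^{[i+1]}; it telescopes along the chain and cancels against the right boundary, which leaves [D,
Q₊] = E_0 · 2(S₀^tot + s) (`diagonalHamiltonian_mul_Qplus`). With [Q₊, E_0] = E_0²(2(S₀^tot + s) +
1), induction on the power of Q₊ produces the coefficients of the logarithm, precisely for the Gamma
normalisation in 𝓦 (`exchange_relation`). All factors together give `hamiltonianForm_mul_mapForm`.

The binomial transform is injective on decaying vectors: a power series of radius larger than one
whose Taylor coefficients at 1 all vanish is zero (`lowered_eq_zero`). Hence v is in the domain of P
iff v decays and its transformed image lies in the range of the transform. Since H and H^eq preserve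
decay, the intertwining relation shows that H^eq v lies again in the domain of P, and the operator
identity holds on the whole domain.

For density, the domain is shown to contain the products of negative binomial vectors with density ρ
and shapes b_i + 2s. Their transforms are finite combinations of vectors e^{ρS₊}|a⟩ moved by shifts,
so it must be seen that e^{ρ_R S₊} 𝓦|m⟩ is a binomial transform. The coefficients of 𝓦|m⟩ contain
the moments of an ordered Dirichlet law, so this vector is an average of products e^{θ_i
S₊^{[i]}}|m⟩ with each θ_i between ρ_R and ρ_L (`exists_mixture`), and the same average of negative
binomial vectors is a decaying preimage. Finally, varying the shapes multiplies one positive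
decaying weight by polynomials, and injectivity of the transform shows that only zero is orthogonal
to all of these. -/

/-- `T` raises the number of particles by `k`. -/
def Raises {n : ℕ} (k : ℕ) (T : Module.End ℝ (Vec n)) : Prop :=
  ∀ v p, (∀ q, size q + k = size p → v q = 0) → T v p = 0

section Graded

variable {n : ℕ} {k l : ℕ} {S T : Module.End ℝ (Vec n)}

/-- Locality: coordinate p of the image depends only on the level with k fewer particles. This is
what lets infinite formal sums be replaced by their truncations. -/
theorem Raises.congr (hT : Raises k T) {v w : Vec n} {p : Config n}
    (h : ∀ q, size q + k = size p → v q = w q) : T v p = T w p := by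
  have := hT (v - w) p fun q hq => by simp [h q hq]
  rw [map_sub, Pi.sub_apply] at this
  linarith

theorem Raises.eq_zero (hT : Raises k T) (v : Vec n) {p : Config n} (h : size p < k) :
    T v p = 0 :=
  hT v p fun q hq => by omega

theorem Raises.zero : Raises k (0 : Module.End ℝ (Vec n)) := fun _ _ _ => rfl

theorem Raises.one : Raises 0 (1 : Module.End ℝ (Vec n)) := fun _ p h => h p rfl

theorem Raises.mul (hS : Raises k S) (hT : Raises l T) : Raises (k + l) (S * T) :=
  fun v p h => hS _ p fun q hq => hT _ q fun q' hq' => h q' (by omega)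

theorem Raises.add (hS : Raises k S) (hT : Raises k T) : Raises k (S + T) := fun v p h => by
  rw [LinearMap.add_apply, Pi.add_apply, hS v p h, hT v p h, add_zero]

theorem Raises.smul (c : ℝ) (hT : Raises k T) : Raises k (c • T) := fun v p h => by
  rw [LinearMap.smul_apply, Pi.smul_apply, hT v p h, smul_zero]

theorem Raises.neg (hT : Raises k T) : Raises k (-T) := fun v p h => by
  rw [LinearMap.neg_apply, Pi.neg_apply, hT v p h, neg_zero]

theorem Raises.sum {ι : Type*} {s : Finset ι} {f : ι → Module.End ℝ (Vec n)}
    (h : ∀ i ∈ s, Raises k (f i)) : Raises k (∑ i ∈ s, f i) :=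
  Finset.sum_induction f (Raises k) (fun _ _ => Raises.add) Raises.zero h

theorem Raises.pow (hT : Raises 1 T) (k : ℕ) : Raises k (T ^ k) := by
  induction k with
  | zero => exact Raises.one
  | succ k ih => rw [pow_succ]; exact ih.mul hT

theorem raises_diagOp (f : Config n → ℝ) : Raises 0 (diagOp f) := fun v p h => by
  simp [diagOp, h p rfl]

/-- The formal series `∑ₖ Aₖ` of operators, where `Aₖ` is meant to raise the particle number
by `k`. -/
def gradedSum (A : ℕ → Module.End ℝ (Vec n)) : Module.End ℝ (Vec n) where
  toFun v p := ∑ k ∈ range (size p + 1), A k v p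
  map_add' v w := by funext p; simp [Finset.sum_add_distrib]
  map_smul' c v := by funext p; simp [Finset.mul_sum]

theorem gradedSum_apply (A : ℕ → Module.End ℝ (Vec n)) (v : Vec n) (p : Config n) :
    gradedSum A v p = ∑ k ∈ range (size p + 1), A k v p := rfl

/-- A Cauchy product. At p the operator A k only sees the level size p - k, where the inner sum is
cut off at exactly size p - k, so the double sum runs over the triangle k + l ≤ size p. -/
theorem gradedSum_mul {A B : ℕ → Module.End ℝ (Vec n)} (hA : ∀ k, Raises k (A k)) :
    gradedSum A * gradedSum B =
      gradedSum fun m => ∑ k ∈ range (m + 1), A k * B (m - k) := by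
  refine LinearMap.ext fun v => funext fun p => ?_
  rw [Module.End.mul_apply, gradedSum_apply, gradedSum_apply]
  have h1 : ∀ m ∈ range (size p + 1), (∑ k ∈ range (m + 1), A k * B (m - k)) v p =
      ∑ k ∈ range (m + 1), A k (B (m - k) v) p := fun m _ => by
    rw [LinearMap.sum_apply, Finset.sum_apply]
    rfl
  rw [Finset.sum_congr rfl h1, Finset.sum_range_diag_flip _ fun k l => A k (B l v) p]
  refine Finset.sum_congr rfl fun k hk => ?_
  have hk' := Finset.mem_range.1 hk
  rw [← Finset.sum_apply, ← map_sum]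
  refine (hA k).congr fun q hq => ?_
  rw [gradedSum_apply, Finset.sum_apply]
  rw [show size p + 1 - k = size q + 1 by omega]

theorem gradedSum_comm {A : ℕ → Module.End ℝ (Vec n)} {T T' : Module.End ℝ (Vec n)}
    (hT : Raises 0 T) (h : ∀ k, T * A k = A k * T') :
    T * gradedSum A = gradedSum A * T' := by
  refine LinearMap.ext fun v => funext fun p => ?_
  simp only [Module.End.mul_apply, gradedSum_apply]
  rw [hT.congr (w := ∑ k ∈ range (size p + 1), A k v)]
  · rw [map_sum, Finset.sum_apply]
    exact Finset.sum_congr rfl fun k _ => congrFun (LinearMap.congr_fun (h k) v) p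
  · intro q hq
    rw [gradedSum_apply, Finset.sum_apply, ← hq, add_zero]

/-- The operator is unitriangular: the leading term is the identity and all others read strictly
lower levels, so the kernel vanishes level by level. -/
theorem gradedSum_injective {A : ℕ → Module.End ℝ (Vec n)} (h0 : A 0 = 1)
    (hA : ∀ k, Raises k (A k)) : Function.Injective (gradedSum A) := by
  rw [← LinearMap.ker_eq_bot, LinearMap.ker_eq_bot']
  intro v hv
  have key : ∀ d, ∀ p, size p = d → v p = 0 := by
    intro d
    induction d using Nat.strong_induction_on with
    | _ d ih =>
      intro p hp
      have h := congrFun hv p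
      rw [gradedSum_apply, Finset.sum_range_succ', h0, Finset.sum_eq_zero] at h
      · simpa using h
      · intro k _
        exact hA (k + 1) v p fun q hq => ih (size q) (by omega) q rfl
  exact funext fun p => key _ p rfl

/-- Terms with k > size p vanish at p, so the series is finite in each coordinate and the cutoff in
`gradedSum` loses nothing. -/
theorem hasSum_gradedSum {A : ℕ → Module.End ℝ (Vec n)} (hA : ∀ k, Raises k (A k)) (v : Vec n)
    (p : Config n) : HasSum (fun k => A k v p) (gradedSum A v p) := by
  refine hasSum_sum_of_ne_finset_zero (s := range (size p + 1)) fun k hk => ?_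
  exact (hA k).eq_zero v (by simpa [Nat.lt_succ_iff] using hk)

theorem seriesOp_eq_total {A : ℕ → Module.End ℝ (Vec n)} (hA : ∀ k, Raises k (A k)) :
    seriesOp A = total (gradedSum A) := by
  have hd : (seriesOp A).domain = ⊤ :=
    eq_top_iff.2 fun v _ p => (hasSum_gradedSum hA v p).summable
  refine LinearPMap.ext (by rw [hd]; rfl) fun v h1 h2 => ?_
  exact funext fun p => (hasSum_gradedSum hA v p).tsum_eq

/-! ## Exponentials of operators which raise the particle number by one -/

/-- The formal exponential of an operator which raises the particle number by one. -/
def gradedExp (X : Module.End ℝ (Vec n)) : Module.End ℝ (Vec n) :=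
  gradedSum fun k => ((k.factorial : ℝ)⁻¹) • X ^ k

variable {X Y : Module.End ℝ (Vec n)}

theorem Raises.exp_coeff (hX : Raises 1 X) (k : ℕ) :
    Raises k (((k.factorial : ℝ)⁻¹) • X ^ k) := (hX.pow k).smul _

theorem expOp_eq_total (hX : Raises 1 X) : expOp X = total (gradedExp X) :=
  seriesOp_eq_total hX.exp_coeff

theorem gradedExp_zero : gradedExp (0 : Module.End ℝ (Vec n)) = 1 := by
  refine LinearMap.ext fun v => funext fun p => ?_
  rw [gradedExp, gradedSum_apply, Finset.sum_range_succ']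
  simp

/-- The binomial theorem for commuting operators. Only the left factor has to be graded, since the
grading serves to truncate the inner sum in `gradedSum_mul`. -/
theorem gradedExp_add (hX : Raises 1 X) (h : Commute X Y) :
    gradedExp X * gradedExp Y = gradedExp (X + Y) := by
  rw [gradedExp, gradedExp, gradedSum_mul hX.exp_coeff, gradedExp]
  congr 1
  funext m
  rw [h.add_pow, Finset.smul_sum]
  refine Finset.sum_congr rfl fun k hk => ?_
  have hk' : k ≤ m := Nat.lt_succ_iff.1 (Finset.mem_range.1 hk)
  rw [smul_mul_smul_comm, ← nsmul_eq_mul', ← Nat.cast_smul_eq_nsmul ℝ, smul_smul]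
  congr 1
  rw [← Nat.choose_mul_factorial_mul_factorial hk']
  have h1 : ((m.choose k : ℕ) : ℝ) ≠ 0 := by exact_mod_cast (Nat.choose_pos hk').ne'
  have h2 : ((k.factorial : ℕ) : ℝ) ≠ 0 := by exact_mod_cast k.factorial_ne_zero
  have h3 : (((m - k).factorial : ℕ) : ℝ) ≠ 0 := by exact_mod_cast (m - k).factorial_ne_zero
  push_cast
  field_simp

theorem gradedExp_neg_mul (hX : Raises 1 X) : gradedExp (-X) * gradedExp X = 1 := by
  rw [gradedExp_add hX.neg (Commute.neg_left (Commute.refl X)), neg_add_cancel, gradedExp_zero]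

theorem gradedExp_mul_neg (hX : Raises 1 X) : gradedExp X * gradedExp (-X) = 1 := by
  rw [gradedExp_add hX (Commute.neg_right (Commute.refl X)), add_neg_cancel, gradedExp_zero]

theorem gradedExp_comm (hT : Raises 0 T) (h : Commute T X) :
    T * gradedExp X = gradedExp X * T :=
  gradedSum_comm hT (fun k => by
    rw [mul_smul_comm, smul_mul_assoc, (h.pow_right k).eq])

end Graded

/-! ## Row-finite operators -/

section Kets

variable {n : ℕ}

theorem hasSum_ket (v : Vec n) : HasSum (fun m => v m • ket m) v := by
  rw [Pi.hasSum]
  intro p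
  have := hasSum_single (f := fun m : Config n => (v m • ket m) p) p fun m hm => by
    simp [ket, hm.symm]
  simpa [ket] using this

theorem hasSum_apply_ket {T : Module.End ℝ (Vec n)} (hT : Continuous T) (v : Vec n) :
    HasSum (fun m => v m • T (ket m)) (T v) := by
  have := (hasSum_ket v).map T.toAddMonoidHom hT
  simpa [Function.comp_def] using this

/-- In the product topology every vector is the sum of its coordinates times basis vectors, and
operators with finite rows are continuous. Commutation relations on all formal vectors can thus be
checked on basis vectors. -/
theorem ext_ket {S T : Module.End ℝ (Vec n)} (hS : Continuous S) (hT : Continuous T)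
    (h : ∀ m, S (ket m) = T (ket m)) : S = T := by
  refine LinearMap.ext fun v => (hasSum_apply_ket hS v).unique ?_
  simpa only [h] using hasSum_apply_ket hT v

theorem continuous_mul' {S T : Module.End ℝ (Vec n)} (hS : Continuous S) (hT : Continuous T) :
    Continuous (S * T) := hS.comp hT

theorem continuous_pow' {T : Module.End ℝ (Vec n)} (hT : Continuous T) (k : ℕ) :
    Continuous (T ^ k) := by
  induction k with
  | zero => exact continuous_id
  | succ k ih => rw [pow_succ]; exact continuous_mul' ih hT

theorem continuous_add' {S T : Module.End ℝ (Vec n)} (hS : Continuous S) (hT : Continuous T) :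
    Continuous (S + T) := Continuous.add (f := S) (g := T) hS hT

theorem continuous_sub' {S T : Module.End ℝ (Vec n)} (hS : Continuous S) (hT : Continuous T) :
    Continuous (S - T) := Continuous.sub (f := S) (g := T) hS hT

theorem continuous_smul' (c : ℝ) {T : Module.End ℝ (Vec n)} (hT : Continuous T) :
    Continuous (c • T) := Continuous.const_smul (g := T) hT c

theorem continuous_sum' {ι : Type*} {s : Finset ι} {f : ι → Module.End ℝ (Vec n)}
    (h : ∀ i ∈ s, Continuous (f i)) : Continuous (∑ i ∈ s, f i : Module.End ℝ (Vec n)) :=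
  Finset.sum_induction f (fun T => Continuous T) (fun _ _ => continuous_add')
    continuous_zero h

theorem continuous_diagOp (f : Config n → ℝ) : Continuous (diagOp f) :=
  continuous_pi fun p => continuous_const.mul (continuous_apply p)

theorem continuous_Sminus (i : Fin (n + 1)) : Continuous (Sminus i) :=
  continuous_pi fun _ => continuous_const.mul (continuous_apply _)

theorem continuous_Splus (s : ℝ) (i : Fin (n + 1)) : Continuous (Splus s i) := by
  refine continuous_pi fun p => ?_
  by_cases h : p i = 0
  · simpa [Splus, h] using continuous_const
  · simpa [Splus, h] using (continuous_apply _).const_mul _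

/-- The finitely many configurations with at most `M` particles at each site. -/
def box (n M : ℕ) : Finset (Config n) := Fintype.piFinset fun _ => range (M + 1)

theorem le_size (m : Config n) (i : Fin (n + 1)) : m i ≤ size m :=
  Finset.single_le_sum (f := m) (fun _ _ => Nat.zero_le _) (Finset.mem_univ i)

theorem mem_box_of_size_le {M : ℕ} {m : Config n} (h : size m ≤ M) : m ∈ box n M := by
  simp only [box, Fintype.mem_piFinset, Finset.mem_range]
  intro i
  have := le_size m i
  omega

/-- The operator with the given columns, when these do not lower the number of particles. -/
def opOfCol (col : Config n → Vec n) : Module.End ℝ (Vec n) where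
  toFun v p := ∑ m ∈ box n (size p), col m p * v m
  map_add' v w := by funext p; simp [mul_add, Finset.sum_add_distrib]
  map_smul' c v := by funext p; simp [mul_left_comm, Finset.mul_sum]

theorem continuous_opOfCol (col : Config n → Vec n) : Continuous (opOfCol col) :=
  continuous_pi fun _ => continuous_finsetSum _ fun m _ => (continuous_apply m).const_mul _

theorem opOfCol_ket {col : Config n → Vec n} (h : ∀ m p, size p < size m → col m p = 0)
    (m : Config n) : opOfCol col (ket m) = col m := by
  funext p
  change ∑ q ∈ box n (size p), col q p * ket m q = _
  by_cases hm : m ∈ box n (size p)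
  · rw [Finset.sum_eq_single_of_mem m hm]
    · simp [ket]
    · intro q _ hq
      simp [ket, hq]
  · rw [Finset.sum_eq_zero]
    · refine (h m p ?_).symm
      by_contra h'
      exact hm (mem_box_of_size_le (not_lt.1 h'))
    · intro q hq
      have : q ≠ m := fun h => hm (h ▸ hq)
      simp [ket, this]

theorem raises_opOfCol {col : Config n → Vec n} {k : ℕ}
    (h : ∀ m p, size m + k ≠ size p → col m p = 0) : Raises k (opOfCol col) := by
  intro v p hv
  refine Finset.sum_eq_zero fun m _ => ?_
  by_cases hm : size m + k = size p
  · rw [hv m hm, mul_zero]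
  · rw [h m p hm, zero_mul]

theorem Raises.apply_eq_sum {k : ℕ} {T : Module.End ℝ (Vec n)} (hT : Raises k T) (v : Vec n)
    (p : Config n) {M : ℕ} (hM : size p ≤ M) :
    T v p = ∑ q ∈ box n M, v q * T (ket q) p := by
  rw [hT.congr (w := ∑ q ∈ box n M, v q • ket q)]
  · simp [Finset.sum_apply]
  · intro q hq
    rw [Finset.sum_apply, Finset.sum_eq_single_of_mem q (mem_box_of_size_le (by omega))]
    · simp [ket]
    · intro q' _ hq'
      simp [ket, hq'.symm]

theorem gradedSum_apply_eq_sum {A : ℕ → Module.End ℝ (Vec n)} (hA : ∀ k, Raises k (A k))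
    (v : Vec n) (p : Config n) :
    gradedSum A v p = ∑ q ∈ box n (size p), v q * gradedSum A (ket q) p := by
  simp only [gradedSum_apply, Finset.mul_sum]
  rw [Finset.sum_comm]
  exact Finset.sum_congr rfl fun k _ => (hA k).apply_eq_sum v p le_rfl

end Kets

end

noncomputable section

/-! ## Rising factorials and the jump rates -/

/-- The rising factorial `a (a + 1) ⋯ (a + k - 1)`. -/
def rising (a : ℝ) (k : ℕ) : ℝ := ∏ i ∈ range k, (a + i)

@[simp]
theorem rising_zero (a : ℝ) : rising a 0 = 1 := by simp [rising]

theorem rising_succ (a : ℝ) (k : ℕ) : rising a (k + 1) = rising a k * (a + k) := by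
  simp [rising, Finset.prod_range_succ]

theorem rising_succ' (a : ℝ) (k : ℕ) : rising a (k + 1) = a * rising (a + 1) k := by
  rw [rising, Finset.prod_range_succ', mul_comm, rising]
  congr 1
  · simp
  · refine Finset.prod_congr rfl fun i _ => ?_
    push_cast
    ring

theorem rising_add (a : ℝ) (k l : ℕ) : rising a (k + l) = rising a k * rising (a + k) l := by
  induction l with
  | zero => simp
  | succ l ih =>
    rw [← add_assoc, rising_succ, ih, rising_succ]
    push_cast
    ring

theorem rising_pos {a : ℝ} (ha : 0 < a) (k : ℕ) : 0 < rising a k :=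
  Finset.prod_pos fun i _ => by positivity

theorem rising_one (k : ℕ) : rising 1 k = k.factorial := by
  induction k with
  | zero => simp
  | succ k ih =>
    rw [rising_succ, ih, Nat.factorial_succ]
    push_cast
    ring

theorem rising_natCast (r k : ℕ) :
    rising ((r : ℝ) + 1) k = ((r + k).factorial : ℝ) / (r.factorial : ℝ) := by
  have h := rising_add 1 r k
  rw [rising_one, rising_one, add_comm (1 : ℝ)] at h
  rw [h, mul_div_cancel_left₀]
  exact_mod_cast r.factorial_ne_zero

theorem Gamma_add_natCast {a : ℝ} (ha : 0 < a) (k : ℕ) :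
    Real.Gamma (a + k) = rising a k * Real.Gamma a := by
  induction k with
  | zero => simp
  | succ k ih =>
    have h : a + (k : ℝ) ≠ 0 := by positivity
    push_cast
    rw [← add_assoc, Real.Gamma_add_one h, ih, rising_succ]
    ring

variable {s : ℝ}

/-- With n = k + r the Gamma quotients become rational functions, so that the identities between
rates below are algebraic. -/
theorem rate_add (hs : 0 < s) {k : ℕ} (hk : 1 ≤ k) (r : ℕ) :
    rate s k (k + r) = rising (r + 1) k / (k * rising (2 * s + r) k) := by
  have hk0 : (k : ℝ) ≠ 0 := by positivity
  rw [rate, if_pos ⟨hk, Nat.le_add_right k r⟩]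
  have h1 : (((k + r : ℕ) : ℝ) + 1) = ((r : ℝ) + 1) + k := by push_cast; ring
  have h2 : ((k + r : ℕ) : ℝ) - k + 2 * s = 2 * s + r := by push_cast; ring
  have h3 : ((k + r : ℕ) : ℝ) - k + 1 = r + 1 := by push_cast; ring
  have h4 : ((k + r : ℕ) : ℝ) + 2 * s = (2 * s + r) + k := by push_cast; ring
  rw [h1, h2, h3, h4, Gamma_add_natCast (a := (r : ℝ) + 1) (by positivity),
    Gamma_add_natCast (a := 2 * s + r) (by positivity)]
  have h5 : Real.Gamma ((r : ℝ) + 1) ≠ 0 := (Real.Gamma_pos_of_pos (by positivity)).ne'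
  have h6 : Real.Gamma (2 * s + r) ≠ 0 := (Real.Gamma_pos_of_pos (by positivity)).ne'
  have h7 : rising (2 * s + r) k ≠ 0 := (rising_pos (by positivity) k).ne'
  field_simp

theorem rate_nonneg (hs : 0 < s) (k n : ℕ) : 0 ≤ rate s k n := by
  by_cases h : 1 ≤ k ∧ k ≤ n
  · obtain ⟨r, rfl⟩ := Nat.exists_eq_add_of_le h.2
    rw [rate_add hs h.1]
    have h1 := rising_pos (a := (r : ℝ) + 1) (by positivity) k
    have h2 := rising_pos (a := 2 * s + r) (by positivity) k
    positivity
  · rw [rate, if_neg h]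

theorem rate_one (hs : 0 < s) (n : ℕ) : rate s 1 (n + 1) = (n + 1) / (2 * s + n) := by
  rw [add_comm, rate_add hs le_rfl]
  simp [rising]

/-- The coefficient identity behind the commutation of hopping with `S₋`; summed over k it also
gives the recursion of the harmonic numbers. -/
theorem rate_lower (hs : 0 < s) {k : ℕ} (hk : 1 ≤ k) (r : ℕ) :
    (r + 1) * rate s k (k + 1 + r) + (k + 1) * rate s (k + 1) (k + 1 + r) =
      (k + 1 + r) * rate s k (k + r) := by
  have hk0 : (k : ℝ) ≠ 0 := by positivity
  have e1 : k + 1 + r = k + (r + 1) := by omega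
  rw [rate_add hs (by omega : 1 ≤ k + 1), rate_add hs hk, e1, rate_add hs hk]
  have h1 := rising_succ (2 * s + r) k
  have h2 := rising_succ' (2 * s + r) k
  have h3 := rising_succ ((r : ℝ) + 1) k
  have h4 := rising_succ' ((r : ℝ) + 1) k
  push_cast
  rw [← add_assoc (2 * s)]
  have hP : 0 < rising (2 * s + r) k := rising_pos (by positivity) k
  have hQ : 0 < rising (2 * s + r + 1) k := rising_pos (by positivity) k
  have ha : 0 < 2 * s + (r : ℝ) := by positivity
  have hb : 0 < (r : ℝ) + 1 := by positivity
  -- The two factorisations of a rising factorial of length k + 1 relate base a + 1 to base a, so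
  -- that all rising factorials share one common factor.
  have e2 : rising (2 * s + r + 1) k = rising (2 * s + r) k * (2 * s + r + k) / (2 * s + r) := by
    rw [eq_div_iff ha.ne', ← h1, h2]; ring
  have e3 : rising ((r : ℝ) + 1 + 1) k = rising ((r : ℝ) + 1) k * (r + 1 + k) / (r + 1) := by
    rw [eq_div_iff hb.ne', ← h3, h4]; ring
  rw [h1, h3, e2, e3]
  have hc : (2 * s + r + k : ℝ) ≠ 0 := by positivity
  have hd : (k : ℝ) + 1 ≠ 0 := by positivity
  field_simp
  ring

/-- The coefficient identity behind the commutator of hopping with `S₊`. -/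
theorem rate_raise (hs : 0 < s) {k : ℕ} (hk : 1 ≤ k) (r : ℕ) :
    (2 * s + r) * rate s (k + 1) (k + 1 + r) + k * rate s k (k + 1 + r) =
      (2 * s + k + 1 + r) * rate s (k + 1) (k + 2 + r) := by
  have hk0 : (k : ℝ) ≠ 0 := by positivity
  have e1 : k + 2 + r = (k + 1) + (r + 1) := by omega
  have e1' : k + 1 + r = k + (r + 1) := by omega
  rw [e1, rate_add hs (by omega : 1 ≤ k + 1), rate_add hs (by omega : 1 ≤ k + 1), e1',
    rate_add hs hk]
  have h1 := rising_succ (2 * s + r) k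
  have h2 := rising_succ' (2 * s + r) k
  have h3 := rising_succ ((r : ℝ) + 1) k
  have h4 := rising_succ' ((r : ℝ) + 1) k
  have h5 := rising_succ (2 * s + r + 1) k
  have h6 := rising_succ ((r : ℝ) + 1 + 1) k
  push_cast
  rw [← add_assoc (2 * s)]
  have hP : 0 < rising (2 * s + r) k := rising_pos (by positivity) k
  have hQ : 0 < rising (2 * s + r + 1) k := rising_pos (by positivity) k
  have ha : 0 < 2 * s + (r : ℝ) := by positivity
  have hb : 0 < (r : ℝ) + 1 := by positivity
  have e2 : rising (2 * s + r + 1) k = rising (2 * s + r) k * (2 * s + r + k) / (2 * s + r) := by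
    rw [eq_div_iff ha.ne', ← h1, h2]; ring
  have e3 : rising ((r : ℝ) + 1 + 1) k = rising ((r : ℝ) + 1) k * (r + 1 + k) / (r + 1) := by
    rw [eq_div_iff hb.ne', ← h3, h4]; ring
  rw [h5, h6, h1, h3, e2, e3]
  have hc : (2 * s + r + k : ℝ) ≠ 0 := by positivity
  have hd : (k : ℝ) + 1 ≠ 0 := by positivity
  have he : (2 * s + r + 1 + k : ℝ) ≠ 0 := by positivity
  field_simp
  ring

/-- The diagonal raising relation used for the two-site quadratic charge. -/
theorem rate_raise_diag (hs : 0 < s) {k : ℕ} (hk : 1 ≤ k) (r : ℕ) :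
    (r + 1) * ((2 * s + k + r) * rate s k (k + 1 + r)) =
      (k + 1 + r) * ((2 * s + r) * rate s k (k + r)) := by
  have hk0 : (k : ℝ) ≠ 0 := by positivity
  have e1 : k + 1 + r = k + (r + 1) := by omega
  rw [rate_add hs hk, e1, rate_add hs hk]
  have h1 := rising_succ (2 * s + r) k
  have h2 := rising_succ' (2 * s + r) k
  have h3 := rising_succ ((r : ℝ) + 1) k
  have h4 := rising_succ' ((r : ℝ) + 1) k
  push_cast
  rw [← add_assoc (2 * s)]
  have hP : 0 < rising (2 * s + r) k := rising_pos (by positivity) k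
  have ha : 0 < 2 * s + (r : ℝ) := by positivity
  have hb : 0 < (r : ℝ) + 1 := by positivity
  have e2 : rising (2 * s + r + 1) k = rising (2 * s + r) k * (2 * s + r + k) / (2 * s + r) := by
    rw [eq_div_iff ha.ne', ← h1, h2]; ring
  have e3 : rising ((r : ℝ) + 1 + 1) k = rising ((r : ℝ) + 1) k * (r + 1 + k) / (r + 1) := by
    rw [eq_div_iff hb.ne', ← h3, h4]; ring
  rw [e2, e3]
  have hc : (2 * s + r + k : ℝ) ≠ 0 := by positivity
  field_simp
  ring

/-! ### Harmonic numbers -/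

theorem harmonicNumber_eq_range (s : ℝ) (n : ℕ) :
    harmonicNumber s n = ∑ k ∈ range n, rate s (k + 1) n := by
  rw [harmonicNumber, Finset.range_eq_Ico, Finset.sum_Ico_add' (fun k => rate s k n) 0 n 1]
  rfl

/-- Sum `rate_lower` over k. The weights n - k and k + 1 of each rate add up to n + 1, and the
reindexing leaves over the single term φ_s(1, n+1) = (n+1)/(2s+n). -/
theorem harmonicNumber_succ (hs : 0 < s) (n : ℕ) :
    harmonicNumber s (n + 1) = harmonicNumber s n + 1 / (2 * s + n) := by
  rw [harmonicNumber_eq_range, harmonicNumber_eq_range]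
  have h1 : ∑ k ∈ range n, (((n : ℝ) - k) * rate s (k + 1) (n + 1) +
      (k + 2) * rate s (k + 2) (n + 1)) = (n + 1) * ∑ k ∈ range n, rate s (k + 1) n := by
    rw [Finset.mul_sum]
    refine Finset.sum_congr rfl fun k hk => ?_
    obtain ⟨r, rfl⟩ := Nat.exists_eq_add_of_lt (Finset.mem_range.1 hk)
    have h := rate_lower hs (Nat.le_add_left 1 k) r
    have e1 : k + r + 1 + 1 = k + 1 + 1 + r := by ring
    have e2 : k + r + 1 = k + 1 + r := by ring
    rw [e1, e2]
    push_cast at h ⊢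
    linear_combination h
  have h2 : ∑ k ∈ range n, ((k : ℝ) + 2) * rate s (k + 2) (n + 1) =
      ∑ k ∈ range (n + 1), ((k : ℝ) + 1) * rate s (k + 1) (n + 1) - rate s 1 (n + 1) := by
    rw [Finset.sum_range_succ', Nat.cast_zero, zero_add, one_mul, add_sub_cancel_right]
    refine Finset.sum_congr rfl fun k _ => ?_
    push_cast
    ring
  have h3 : ∑ k ∈ range n, ((n : ℝ) - k) * rate s (k + 1) (n + 1) =
      ∑ k ∈ range (n + 1), ((n : ℝ) - k) * rate s (k + 1) (n + 1) := by
    rw [Finset.sum_range_succ, sub_self, zero_mul, add_zero]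
  rw [Finset.sum_add_distrib, h2, h3, ← add_sub_assoc, ← Finset.sum_add_distrib, rate_one hs] at h1
  have h4 : ∑ k ∈ range (n + 1), (((n : ℝ) - k) * rate s (k + 1) (n + 1) +
      (k + 1) * rate s (k + 1) (n + 1)) = (n + 1) * ∑ k ∈ range (n + 1), rate s (k + 1) (n + 1) := by
    rw [Finset.mul_sum]
    exact Finset.sum_congr rfl fun k _ => by ring
  rw [h4] at h1
  have h5 : (n : ℝ) + 1 ≠ 0 := by positivity
  have h6 : 2 * s + (n : ℝ) ≠ 0 := by positivity
  refine mul_left_cancel₀ h5 ?_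
  linear_combination h1 + (by field_simp : ((n : ℝ) + 1) / (2 * s + n) = (n + 1) * (1 / (2 * s + n)))

theorem harmonicNumber_zero (s : ℝ) : harmonicNumber s 0 = 0 := by simp [harmonicNumber]

theorem harmonicNumber_eq (hs : 0 < s) (n : ℕ) :
    harmonicNumber s n = ∑ i ∈ range n, 1 / (2 * s + i) := by
  induction n with
  | zero => simp [harmonicNumber_zero]
  | succ n ih => rw [harmonicNumber_succ hs, ih, Finset.sum_range_succ]

theorem harmonicNumber_nonneg (hs : 0 < s) (n : ℕ) : 0 ≤ harmonicNumber s n :=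
  Finset.sum_nonneg fun k _ => rate_nonneg hs k n

theorem harmonicNumber_le (hs : 0 < s) (n : ℕ) : harmonicNumber s n ≤ n * (1 / (2 * s)) := by
  rw [harmonicNumber_eq hs]
  calc ∑ i ∈ range n, 1 / (2 * s + i) ≤ ∑ i ∈ range n, 1 / (2 * s) :=
        Finset.sum_le_sum fun i _ => one_div_le_one_div_of_le (by positivity) (by simp)
    _ = _ := by simp

/-- Replacing s by s + j/2 moves the start of the harmonic sum from 2s to 2s + j. -/
theorem harmonicNumber_add (hs : 0 < s) (j r : ℕ) :
    harmonicNumber s (j + r) = harmonicNumber s j + harmonicNumber (s + j / 2) r := by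
  rw [harmonicNumber_eq hs, harmonicNumber_eq hs, harmonicNumber_eq (by positivity),
    Finset.sum_range_add]
  congr 1
  refine Finset.sum_congr rfl fun i _ => ?_
  push_cast
  congr 1
  ring

/-! ### The digamma function -/

theorem psi_add_one {x : ℝ} (hx : 0 < x) : psi (x + 1) = psi x + 1 / x := by
  have hG : DifferentiableAt ℝ Real.Gamma x :=
    Real.differentiableAt_Gamma fun m => by
      have : (0 : ℝ) ≤ m := m.cast_nonneg
      linarith
  have h1 : (fun y => Real.Gamma (y + 1)) =ᶠ[nhds x] fun y => y * Real.Gamma y := by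
    filter_upwards [lt_mem_nhds hx] with y hy using Real.Gamma_add_one hy.ne'
  have h2 : logDeriv (fun y => Real.Gamma (y + 1)) x = logDeriv Real.Gamma (x + 1) := by
    rw [logDeriv_apply, logDeriv_apply, deriv_comp_add_const]
  have h3 : logDeriv (fun y => Real.Gamma (y + 1)) x = logDeriv (fun y => y * Real.Gamma y) x := by
    rw [logDeriv_apply, logDeriv_apply, h1.deriv_eq, h1.eq_of_nhds]
  rw [psi, ← h2, h3, logDeriv_mul (f := fun y => y) x hx.ne' (Real.Gamma_pos_of_pos hx).ne'
    differentiableAt_id hG]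
  simp [logDeriv_apply, psi, add_comm]

/-- Both sides vanish at m = 0 and increase by 1/(2s + m). -/
theorem psi_sub_psi (hs : 0 < s) (m : ℕ) :
    psi (((m : ℝ) + s) + s) - psi (2 * s) = harmonicNumber s m := by
  induction m with
  | zero => simp [harmonicNumber_zero, two_mul]
  | succ m ih =>
    rw [harmonicNumber_succ hs, ← ih]
    have : (((m + 1 : ℕ) : ℝ) + s) + s = (((m : ℝ) + s) + s) + 1 := by push_cast; ring
    rw [this, psi_add_one (by positivity)]
    have : ((m : ℝ) + s) + s = 2 * s + m := by ring
    rw [this]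
    ring

end

noncomputable section

/-! ## Particle hopping between two sites -/

theorem rate_eq_zero (s : ℝ) {k n : ℕ} (h : n < k) : rate s k n = 0 := by
  rw [rate, if_neg (by omega)]

variable {s : ℝ}

/-- Extends `rate_raise` to the edge n = k, where the rate for k + 1 out of n is zero by its default
value. -/
theorem rate_raise_of_le (hs : 0 < s) {k n : ℕ} (hk : 1 ≤ k) (hn : k ≤ n) :
    (n - (k + 1) + 2 * s) * rate s (k + 1) n + k * rate s k n =
      (n + 2 * s) * rate s (k + 1) (n + 1) := by
  rcases Nat.eq_or_lt_of_le hn with rfl | hlt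
  · rw [rate_eq_zero s (Nat.lt_succ_self k)]
    have h1 := rate_add hs hk 0
    have h2 := rate_add hs (Nat.le_add_left 1 k) 0
    rw [add_zero] at h1 h2
    rw [h1, h2, Nat.cast_zero, rising_succ, rising_succ]
    have h3 : rising (2 * s + 0) k ≠ 0 := (rising_pos (by positivity) k).ne'
    have h4 : (k : ℝ) ≠ 0 := by positivity
    have h5 : 2 * s + 0 + (k : ℝ) ≠ 0 := by positivity
    push_cast
    have h6 : (k : ℝ) + 1 ≠ 0 := by positivity
    field_simp
    ring
  · obtain ⟨r, rfl⟩ := Nat.exists_eq_add_of_le (Nat.succ_le_of_lt hlt)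
    have h := rate_raise hs hk r
    have e : k.succ + r + 1 = k + 2 + r := by omega
    rw [e, Nat.succ_eq_add_one]
    push_cast
    linear_combination h

theorem rate_raise_diag_of_le (hs : 0 < s) {k n : ℕ} (hk : 1 ≤ k) (hn : k ≤ n + 1) :
    (n + 1 - k) * ((n + 2 * s) * rate s k (n + 1)) =
      (n + 1) * ((n - k + 2 * s) * rate s k n) := by
  rcases Nat.eq_or_lt_of_le hn with rfl | hlt
  · rw [rate_eq_zero s (Nat.lt_succ_self n)]
    push_cast
    ring
  · obtain ⟨r, rfl⟩ := Nat.exists_eq_add_of_le (Nat.lt_succ_iff.1 hlt)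
    have h := rate_raise_diag hs hk r
    have e : k + r + 1 = k + 1 + r := by omega
    rw [e]
    push_cast
    linear_combination h

theorem mul_rate_one (hs : 0 < s) (n : ℕ) : (n - 1 + 2 * s) * rate s 1 n = n := by
  cases n with
  | zero => simp [rate]
  | succ n =>
    rw [rate_one hs]
    have : 2 * s + (n : ℝ) ≠ 0 := by positivity
    push_cast
    field_simp
    ring

theorem mul_harmonicNumber_succ_sub (hs : 0 < s) (n : ℕ) :
    (n + 2 * s) * (harmonicNumber s (n + 1) - harmonicNumber s n) = 1 := by
  rw [harmonicNumber_succ hs, add_sub_cancel_left, add_comm]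
  field_simp

/-- The generator of particles jumping from the first to the second of two sites, in terms of
coordinates `K x y` of the vectors `|x, y⟩`. -/
def hopSum (s : ℝ) (K : ℕ → ℕ → ℝ) (x y : ℕ) : ℝ :=
  harmonicNumber s x * K x y - ∑ k ∈ range x, rate s (k + 1) x * K (x - (k + 1)) (y + (k + 1))

/-- One hopping direction already commutes with `S₋` summed over its two sites. The coefficients of
K (n - (k+1)) (y + (k+1)) match by `rate_lower`, those of K n y by `harmonicNumber_succ`. The
truncated differences x - 1 and y - 1 are harmless, being multiplied by x and y. -/
theorem hopSum_lower (hs : 0 < s) (K : ℕ → ℕ → ℝ) (x y : ℕ) :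
    hopSum s (fun x y => x * K (x - 1) y + y * K x (y - 1)) x y =
      x * hopSum s K (x - 1) y + y * hopSum s K x (y - 1) := by
  cases x with
  | zero => simp [hopSum, harmonicNumber_zero]
  | succ n =>
    simp only [hopSum, Nat.add_sub_cancel]
    have h1 : ∑ k ∈ range (n + 1), rate s (k + 1) (n + 1) *
        (((n + 1 - (k + 1) : ℕ) : ℝ) * K (n + 1 - (k + 1) - 1) (y + (k + 1)) +
          ((y + (k + 1) : ℕ) : ℝ) * K (n + 1 - (k + 1)) (y + (k + 1) - 1)) =
        ∑ k ∈ range n, rate s (k + 1) (n + 1) * ((n - k) * K (n - (k + 1)) (y + (k + 1))) +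
        ∑ k ∈ range (n + 1), rate s (k + 1) (n + 1) * ((y + (k + 1)) * K (n - k) (y + k)) := by
      have : ∑ k ∈ range n, rate s (k + 1) (n + 1) * ((n - k) * K (n - (k + 1)) (y + (k + 1))) =
          ∑ k ∈ range (n + 1),
            rate s (k + 1) (n + 1) * ((n - k) * K (n - (k + 1)) (y + (k + 1))) := by
        rw [Finset.sum_range_succ, sub_self, zero_mul, mul_zero, add_zero]
      rw [this, ← Finset.sum_add_distrib]
      refine Finset.sum_congr rfl fun k hk => ?_
      have hk' : k ≤ n := Nat.lt_succ_iff.1 (Finset.mem_range.1 hk)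
      have e1 : n + 1 - (k + 1) - 1 = n - (k + 1) := by omega
      have e2 : n + 1 - (k + 1) = n - k := by omega
      have e3 : y + (k + 1) - 1 = y + k := by omega
      rw [e1, e2, e3, Nat.cast_sub hk']
      push_cast
      ring
    have h2 : (y : ℝ) * ∑ k ∈ range (n + 1), rate s (k + 1) (n + 1) *
        K (n + 1 - (k + 1)) (y - 1 + (k + 1)) =
        ∑ k ∈ range (n + 1), rate s (k + 1) (n + 1) * (y * K (n - k) (y + k)) := by
      rw [Finset.mul_sum]
      refine Finset.sum_congr rfl fun k _ => ?_
      cases y with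
      | zero => simp
      | succ y =>
        have e2 : n + 1 - (k + 1) = n - k := by omega
        have e3 : y + 1 - 1 + (k + 1) = y + 1 + k := by omega
        rw [e2, e3]
        ring
    have h3 : ∑ k ∈ range (n + 1), rate s (k + 1) (n + 1) * ((y + (k + 1)) * K (n - k) (y + k)) =
        ∑ k ∈ range (n + 1), rate s (k + 1) (n + 1) * (y * K (n - k) (y + k)) +
        (∑ k ∈ range n, (k + 2) * rate s (k + 2) (n + 1) * K (n - (k + 1)) (y + (k + 1)) +
          rate s 1 (n + 1) * K n y) := by
      have : ∑ k ∈ range n, (k + 2) * rate s (k + 2) (n + 1) * K (n - (k + 1)) (y + (k + 1)) +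
          rate s 1 (n + 1) * K n y = ∑ k ∈ range (n + 1),
            (k + 1) * rate s (k + 1) (n + 1) * K (n - k) (y + k) := by
        rw [Finset.sum_range_succ' _ n]
        simp only [Nat.cast_zero, zero_add, one_mul, Nat.sub_zero, add_zero]
        congr 1
        refine Finset.sum_congr rfl fun k _ => ?_
        push_cast
        ring
      rw [this, ← Finset.sum_add_distrib]
      exact Finset.sum_congr rfl fun k _ => by ring
    have h4 : ∑ k ∈ range n, rate s (k + 1) (n + 1) * ((n - k) * K (n - (k + 1)) (y + (k + 1))) +
        ∑ k ∈ range n, (k + 2) * rate s (k + 2) (n + 1) * K (n - (k + 1)) (y + (k + 1)) =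
        (n + 1) * ∑ k ∈ range n, rate s (k + 1) n * K (n - (k + 1)) (y + (k + 1)) := by
      rw [← Finset.sum_add_distrib, Finset.mul_sum]
      refine Finset.sum_congr rfl fun k hk => ?_
      obtain ⟨r, rfl⟩ := Nat.exists_eq_add_of_lt (Finset.mem_range.1 hk)
      have h := rate_lower hs (Nat.le_add_left 1 k) r
      have e1 : k + r + 1 + 1 = k + 1 + 1 + r := by ring
      have e2 : k + r + 1 = k + 1 + r := by ring
      rw [e1, e2]
      push_cast at h ⊢
      linear_combination K (k + 1 + r - (k + 1)) (y + (k + 1)) * h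
    have h5 : ((n : ℝ) + 1) * (harmonicNumber s (n + 1) - harmonicNumber s n) =
        rate s 1 (n + 1) := by
      rw [harmonicNumber_succ hs, rate_one hs]
      ring
    rw [h1, mul_sub (y : ℝ), h2, h3]
    push_cast
    linear_combination K n y * h5 - h4

/-- Unlike `S₋`, the raising operator does not commute with a single hopping direction. The defect K
x (y+1) - K (x+1) y is antisymmetric in the two sites, so it cancels once both directions are added.
-/
theorem hopSum_raise (hs : 0 < s) (K : ℕ → ℕ → ℝ) (x y : ℕ) :
    hopSum s (fun x y => (x + 2 * s) * K (x + 1) y + (y + 2 * s) * K x (y + 1)) x y =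
      (x + 2 * s) * hopSum s K (x + 1) y + (y + 2 * s) * hopSum s K x (y + 1) +
        K x (y + 1) - K (x + 1) y := by
  simp only [hopSum]
  -- Every vector that occurs, except |x+1, y⟩, lies in the family G after reindexing, so the claim
  -- is a comparison of the coefficients of G 0 and G (k + 1).
  set G : ℕ → ℝ := fun k => K (x - k) (y + 1 + k) with hG
  have h1 : ∑ k ∈ range x, rate s (k + 1) x *
      ((((x - (k + 1) : ℕ) : ℝ) + 2 * s) * K (x - (k + 1) + 1) (y + (k + 1)) +
        (((y + (k + 1) : ℕ) : ℝ) + 2 * s) * K (x - (k + 1)) (y + (k + 1) + 1)) =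
      (∑ k ∈ range x, (x - (k + 2) + 2 * s) * rate s (k + 2) x * G (k + 1) + x * G 0) +
      ∑ k ∈ range x, rate s (k + 1) x * ((y + (k + 1) + 2 * s) * G (k + 1)) := by
    have : ∑ k ∈ range x, (x - (k + 2) + 2 * s) * rate s (k + 2) x * G (k + 1) + x * G 0 =
        ∑ k ∈ range x, (x - (k + 1) + 2 * s) * rate s (k + 1) x * G k := by
      have e := Finset.sum_range_succ (fun k : ℕ =>
        ((x : ℝ) - (k + 1) + 2 * s) * rate s (k + 1) x * G k) x
      rw [rate_eq_zero s (Nat.lt_succ_self x), mul_zero, zero_mul, add_zero] at e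
      rw [← e, Finset.sum_range_succ']
      simp only [Nat.cast_zero, zero_add]
      rw [mul_rate_one hs x]
      congr 1
      exact Finset.sum_congr rfl fun k _ => by push_cast; ring
    rw [this, ← Finset.sum_add_distrib]
    refine Finset.sum_congr rfl fun k hk => ?_
    have hk' := Finset.mem_range.1 hk
    have e1 : x - (k + 1) + 1 = x - k := by omega
    have e2 : y + (k + 1) = y + 1 + k := by omega
    rw [e1, Nat.cast_sub hk', hG]
    simp only
    rw [show y + 1 + (k + 1) = y + (k + 1) + 1 by omega, e2]
    push_cast
    ring
  have h2 : ∑ k ∈ range (x + 1), rate s (k + 1) (x + 1) * K (x + 1 - (k + 1)) (y + (k + 1)) =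
      ∑ k ∈ range x, rate s (k + 2) (x + 1) * G (k + 1) + rate s 1 (x + 1) * G 0 := by
    rw [Finset.sum_range_succ']
    congr 1
    refine Finset.sum_congr rfl fun k _ => ?_
    rw [hG]
    simp only
    rw [show x + 1 - (k + 1 + 1) = x - (k + 1) by omega,
      show y + (k + 1 + 1) = y + 1 + (k + 1) by omega]
  have h3 : ∑ k ∈ range x, (x - (k + 2) + 2 * s) * rate s (k + 2) x * G (k + 1) +
      ∑ k ∈ range x, rate s (k + 1) x * ((y + (k + 1) + 2 * s) * G (k + 1)) =
      (x + 2 * s) * ∑ k ∈ range x, rate s (k + 2) (x + 1) * G (k + 1) +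
      (y + 2 * s) * ∑ k ∈ range x, rate s (k + 1) x * G (k + 1) := by
    rw [Finset.mul_sum, Finset.mul_sum, ← Finset.sum_add_distrib, ← Finset.sum_add_distrib]
    refine Finset.sum_congr rfl fun k hk => ?_
    have h := rate_raise_of_le hs (Nat.le_add_left 1 k) (Finset.mem_range.1 hk)
    push_cast at h
    linear_combination G (k + 1) * h
  have h4 : ((x : ℝ) + 2 * s) * rate s 1 (x + 1) = x + 1 := by
    have := mul_rate_one hs (x + 1)
    push_cast at this
    linear_combination this
  have h5 := mul_harmonicNumber_succ_sub hs x
  have h6 : ∑ k ∈ range x, rate s (k + 1) x * K (x - (k + 1)) (y + 1 + (k + 1)) =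
      ∑ k ∈ range x, rate s (k + 1) x * G (k + 1) := rfl
  have h7 : K x (y + 1) = G 0 := rfl
  rw [h1, h2, h6, h7]
  linear_combination -h3 + G 0 * h4 - K (x + 1) y * h5

/-- The commutator with the two-site part of `Q₊`: its coefficients are (x + 2s)(x + 2y + 4s) on the
left site and (y + 2s)² on the right. They are not functions of one site or of x + y alone, so
`rate_raise_diag_of_le` is needed besides `rate_raise_of_le`. -/
theorem hopSum_quadratic (hs : 0 < s) (K : ℕ → ℕ → ℝ) (x y : ℕ) :
    (x + 2 * s) * (x + 2 * y + 4 * s) * hopSum s K (x + 1) y +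
        (y + 2 * s) ^ 2 * hopSum s K x (y + 1) =
      hopSum s (fun x y => (x + 2 * s) * (x + 2 * y + 4 * s) * K (x + 1) y +
        (y + 2 * s) ^ 2 * K x (y + 1)) x y +
      (x + 2 * y + 4 * s) * K (x + 1) y - 2 * (y + 2 * s) * K x (y + 1) := by
  simp only [hopSum]
  set G : ℕ → ℝ := fun k => K (x - k) (y + 1 + k) with hG
  have h1 : ∑ k ∈ range x, rate s (k + 1) x *
      ((((x - (k + 1) : ℕ) : ℝ) + 2 * s) *
          (((x - (k + 1) : ℕ) : ℝ) + 2 * ((y + (k + 1) : ℕ) : ℝ) + 4 * s) *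
          K (x - (k + 1) + 1) (y + (k + 1)) +
        (((y + (k + 1) : ℕ) : ℝ) + 2 * s) ^ 2 * K (x - (k + 1)) (y + (k + 1) + 1)) =
      (∑ k ∈ range x, (x + (k + 2) + 2 * y + 4 * s) *
        ((x - (k + 2) + 2 * s) * rate s (k + 2) x) * G (k + 1) +
        (x + 1 + 2 * y + 4 * s) * x * G 0) +
      ∑ k ∈ range x, rate s (k + 1) x * ((y + (k + 1) + 2 * s) ^ 2 * G (k + 1)) := by
    have : ∑ k ∈ range x, (x + (k + 2) + 2 * y + 4 * s) *
        ((x - (k + 2) + 2 * s) * rate s (k + 2) x) * G (k + 1) +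
        (x + 1 + 2 * y + 4 * s) * x * G 0 =
        ∑ k ∈ range x, (x + (k + 1) + 2 * y + 4 * s) *
          ((x - (k + 1) + 2 * s) * rate s (k + 1) x) * G k := by
      have e := Finset.sum_range_succ (fun k : ℕ => ((x : ℝ) + (k + 1) + 2 * y + 4 * s) *
          (((x : ℝ) - (k + 1) + 2 * s) * rate s (k + 1) x) * G k) x
      rw [rate_eq_zero s (Nat.lt_succ_self x), mul_zero, mul_zero, zero_mul, add_zero] at e
      rw [← e, Finset.sum_range_succ']
      simp only [Nat.cast_zero, zero_add]
      rw [mul_rate_one hs x]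
      congr 1
      exact Finset.sum_congr rfl fun k _ => by push_cast; ring
    rw [this, ← Finset.sum_add_distrib]
    refine Finset.sum_congr rfl fun k hk => ?_
    have hk' := Finset.mem_range.1 hk
    have e1 : x - (k + 1) + 1 = x - k := by omega
    have e2 : y + (k + 1) = y + 1 + k := by omega
    rw [e1, Nat.cast_sub hk', hG]
    simp only
    rw [show y + 1 + (k + 1) = y + (k + 1) + 1 by omega, e2]
    push_cast
    ring
  have h2 : ∑ k ∈ range (x + 1), rate s (k + 1) (x + 1) * K (x + 1 - (k + 1)) (y + (k + 1)) =
      ∑ k ∈ range x, rate s (k + 2) (x + 1) * G (k + 1) + rate s 1 (x + 1) * G 0 := by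
    rw [Finset.sum_range_succ']
    congr 1
    refine Finset.sum_congr rfl fun k _ => ?_
    rw [hG]
    simp only
    rw [show x + 1 - (k + 1 + 1) = x - (k + 1) by omega,
      show y + (k + 1 + 1) = y + 1 + (k + 1) by omega]
  have h3 : ∑ k ∈ range x, (x + (k + 2) + 2 * y + 4 * s) *
        ((x - (k + 2) + 2 * s) * rate s (k + 2) x) * G (k + 1) +
      ∑ k ∈ range x, rate s (k + 1) x * ((y + (k + 1) + 2 * s) ^ 2 * G (k + 1)) =
      (x + 2 * s) * (x + 2 * y + 4 * s) * ∑ k ∈ range x, rate s (k + 2) (x + 1) * G (k + 1) +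
      (y + 2 * s) ^ 2 * ∑ k ∈ range x, rate s (k + 1) x * G (k + 1) := by
    rw [Finset.mul_sum, Finset.mul_sum, ← Finset.sum_add_distrib, ← Finset.sum_add_distrib]
    refine Finset.sum_congr rfl fun k hk => ?_
    have hk' := Finset.mem_range.1 hk
    have h := rate_raise_of_le hs (Nat.le_add_left 1 k) hk'
    have h' := rate_raise_diag_of_le hs (Nat.le_add_left 1 (k + 1)) (by omega : k + 1 + 1 ≤ x + 1)
    push_cast at h h'
    linear_combination G (k + 1) * (2 * y + 4 * s + k + 1) * h - G (k + 1) * h'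
  have h4 : ((x : ℝ) + 2 * s) * rate s 1 (x + 1) = x + 1 := by
    have := mul_rate_one hs (x + 1)
    push_cast at this
    linear_combination this
  have h5 := mul_harmonicNumber_succ_sub hs x
  have h6 : ∑ k ∈ range x, rate s (k + 1) x * K (x - (k + 1)) (y + 1 + (k + 1)) =
      ∑ k ∈ range x, rate s (k + 1) x * G (k + 1) := rfl
  have h7 : K x (y + 1) = G 0 := rfl
  rw [h1, h2, h6, h7]
  linear_combination h3 - G 0 * (x + 2 * y + 4 * s) * h4 + K (x + 1) y * (x + 2 * y + 4 * s) * h5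

end

noncomputable section

variable {n : ℕ} {s : ℝ}

/-! ## Elementary operators on the chain -/

theorem size_update (m : Config n) (i : Fin (n + 1)) (x : ℕ) :
    size (Function.update m i x) + m i = size m + x := by
  rw [size, size, Finset.sum_update_of_mem (Finset.mem_univ i), add_right_comm, add_comm x,
    ← Finset.sum_erase_add _ m (Finset.mem_univ i), Finset.sdiff_singleton_eq_erase, add_right_comm]
  omega

/-- The operator `|m⟩ ↦ |m + δ_i⟩`. -/
def shift (i : Fin (n + 1)) : Module.End ℝ (Vec n) where
  toFun v p := if p i = 0 then 0 else v (Function.update p i (p i - 1))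
  map_add' v w := by funext p; by_cases h : p i = 0 <;> simp [h]
  map_smul' c v := by funext p; by_cases h : p i = 0 <;> simp [h]

theorem Splus_eq (s : ℝ) (i : Fin (n + 1)) :
    Splus s i = shift i * diagOp fun m => (m i : ℝ) + 2 * s := by
  refine LinearMap.ext fun v => funext fun p => ?_
  by_cases h : p i = 0 <;> simp [Splus, shift, diagOp, h]

theorem shift_ket (i : Fin (n + 1)) (m : Config n) :
    shift i (ket m) = ket (Function.update m i (m i + 1)) := by
  funext p
  by_cases h : p = Function.update m i (m i + 1)
  · subst h
    simp [shift, ket]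
  · have hR : ket (Function.update m i (m i + 1)) p = 0 := by simp [ket, h]
    by_cases h0 : p i = 0
    · simp [shift, h0, hR]
    · have h2 : Function.update p i (p i - 1) ≠ m := by
        rintro rfl
        apply h
        have h3 : p i - 1 + 1 = p i := Nat.succ_pred_eq_of_ne_zero h0
        simp [h3]
      have hL : ket m (Function.update p i (p i - 1)) = 0 := by simp [ket, h2]
      simp [shift, h0, hR, hL]

theorem continuous_shift (i : Fin (n + 1)) : Continuous (shift i) := by
  refine continuous_pi fun p => ?_
  by_cases h : p i = 0
  · simpa [shift, h] using continuous_const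
  · simpa [shift, h] using continuous_apply _

theorem raises_shift (i : Fin (n + 1)) : Raises 1 (shift i) := by
  intro v p hv
  by_cases h : p i = 0
  · simp [shift, h]
  · have := size_update p i (p i - 1)
    have := hv (Function.update p i (p i - 1)) (by omega)
    simp [shift, h, this]

theorem raises_Splus (s : ℝ) (i : Fin (n + 1)) : Raises 1 (Splus s i) := by
  rw [Splus_eq]
  exact (raises_shift i).mul (raises_diagOp _)

theorem raises_SplusTot (s : ℝ) : Raises 1 (SplusTot (n := n) s) :=
  Raises.sum fun i _ => raises_Splus s i

theorem shift_pow_apply (i : Fin (n + 1)) (k : ℕ) (v : Vec n) (p : Config n) :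
    (shift i ^ k) v p = if k ≤ p i then v (take p i k) else 0 := by
  induction k generalizing v with
  | zero => simp [take]
  | succ k ih =>
    rw [pow_succ, Module.End.mul_apply, ih]
    by_cases h : k ≤ p i
    · rw [if_pos h]
      by_cases h' : k + 1 ≤ p i
      · have h2 : ¬ (p i - k = 0) := by omega
        rw [if_pos h']
        simp [shift, take, h2, Nat.sub_sub]
      · rw [if_neg h']
        have h2 : p i - k = 0 := by omega
        simp [shift, take, h2]
    · rw [if_neg h, if_neg (by omega)]

theorem commute_Splus (s : ℝ) (i j : Fin (n + 1)) : Commute (Splus s i) (Splus s j) := by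
  by_cases hij : i = j
  · rw [hij]
  refine ext_ket (continuous_mul' (continuous_Splus s i) (continuous_Splus s j))
    (continuous_mul' (continuous_Splus s j) (continuous_Splus s i)) fun m => ?_
  simp only [Module.End.mul_apply, Splus_ket, map_smul, smul_smul]
  rw [Function.update_of_ne hij, Function.update_of_ne (Ne.symm hij),
    Function.update_comm hij, mul_comm]

/-- The step of the harmonic number is exactly the inverse of the coefficient m_i + 2s of `S₊`. This
relation is the source of the logarithm in the triangular boundary term. -/
theorem harmonic_mul_Splus (hs : 0 < s) (i : Fin (n + 1)) :
    (diagOp fun m : Config n => harmonicNumber s (m i)) * Splus s i =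
      Splus s i * (diagOp fun m => harmonicNumber s (m i)) + shift i := by
  refine ext_ket (continuous_mul' (continuous_diagOp _) (continuous_Splus s i))
    (continuous_add' (continuous_mul' (continuous_Splus s i) (continuous_diagOp _))
      (continuous_shift i)) fun m => ?_
  simp only [Module.End.mul_apply, LinearMap.add_apply, Splus_ket, diagOp_ket, shift_ket, map_smul,
    smul_smul, Function.update_self]
  rw [← one_smul ℝ (ket (Function.update m i (m i + 1))), smul_smul, smul_smul, ← add_smul]
  congr 1
  linear_combination mul_harmonicNumber_succ_sub hs (m i)

theorem commute_diagOp_Splus {f : Config n → ℝ} {i : Fin (n + 1)}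
    (hf : ∀ m x, f (Function.update m i x) = f m) : Commute (diagOp f) (Splus s i) := by
  refine ext_ket (continuous_mul' (continuous_diagOp _) (continuous_Splus s i))
    (continuous_mul' (continuous_Splus s i) (continuous_diagOp _)) fun m => ?_
  simp only [Module.End.mul_apply, Splus_ket, diagOp_ket, map_smul, smul_smul, hf]
  rw [mul_comm]

theorem commute_diagOp_diagOp (f g : Config n → ℝ) : Commute (diagOp f) (diagOp g) :=
  LinearMap.ext fun v => funext fun p => mul_left_comm (f p) (g p) (v p)

/-- The coefficient m_i + 2s grows by one under the shift, so [S₊, E] = E². -/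
theorem Splus_mul_shift (s : ℝ) (i : Fin (n + 1)) :
    Splus s i * shift i = shift i * Splus s i + shift i * shift i := by
  refine ext_ket (continuous_mul' (continuous_Splus s i) (continuous_shift i))
    (continuous_add' (continuous_mul' (continuous_shift i) (continuous_Splus s i))
      (continuous_mul' (continuous_shift i) (continuous_shift i))) fun m => ?_
  simp only [Module.End.mul_apply, LinearMap.add_apply, Splus_ket, shift_ket, map_smul,
    Function.update_self]
  push_cast
  module

/-! ## Hopping operators -/

/-- The configuration which agrees with `m` except for `x` particles at site `i` and `y` particles
at site `j`. -/
def setTwo (m : Config n) (i j : Fin (n + 1)) (x y : ℕ) : Config n :=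
  Function.update (Function.update m i x) j y

section SetTwo

variable {i j : Fin (n + 1)} (m : Config n) (x y z : ℕ)

theorem setTwo_self : setTwo m i j (m i) (m j) = m := by simp [setTwo]

theorem setTwo_comm (hij : i ≠ j) : setTwo m i j x y = setTwo m j i y x :=
  Function.update_comm hij _ _ _

theorem setTwo_left (hij : i ≠ j) : setTwo m i j x y i = x := by
  simp [setTwo, Function.update_of_ne hij]

theorem setTwo_right : setTwo m i j x y j = y := by simp [setTwo]

theorem setTwo_of_ne {l : Fin (n + 1)} (hi : l ≠ i) (hj : l ≠ j) : setTwo m i j x y l = m l := by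
  simp [setTwo, Function.update_of_ne hi, Function.update_of_ne hj]

theorem update_setTwo_right : Function.update (setTwo m i j x y) j z = setTwo m i j x z := by
  simp [setTwo]

theorem update_setTwo_left (hij : i ≠ j) :
    Function.update (setTwo m i j x y) i z = setTwo m i j z y := by
  rw [setTwo_comm m x y hij, update_setTwo_right, setTwo_comm m z y hij]

theorem update_setTwo_of_ne {l : Fin (n + 1)} (hi : l ≠ i) (hj : l ≠ j) :
    Function.update (setTwo m i j x y) l z = setTwo (Function.update m l z) i j x y := by
  rw [setTwo, setTwo, Function.update_comm hj.symm, Function.update_comm hi.symm]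

theorem put_take_setTwo (hij : i ≠ j) :
    put (take (setTwo m i j x y) i z) j z = setTwo m i j (x - z) (y + z) := by
  rw [take, setTwo_left m x y hij, update_setTwo_left m x y _ hij, put, setTwo_right,
    update_setTwo_right]

end SetTwo

theorem size_put_take {m : Config n} {i j : Fin (n + 1)} {k : ℕ} (hk : k ≤ m i) :
    size (put (take m i k) j k) = size m := by
  have h1 := size_update m i (m i - k)
  have h2 := size_update (take m i k) j (take m i k j + k)
  rw [put]
  have h3 : size (take m i k) = size (Function.update m i (m i - k)) := rfl
  omega

/-- The image of `|m⟩` under the generator of particles jumping from site `i` to site `j`. -/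
def hopCol (s : ℝ) (i j : Fin (n + 1)) (m : Config n) : Vec n :=
  harmonicNumber s (m i) • ket m -
    ∑ k ∈ Icc 1 (m i), rate s k (m i) • ket (put (take m i k) j k)

theorem hopCol_eq_zero {i j : Fin (n + 1)} {m p : Config n}
    (h : size m ≠ size p) : hopCol s i j m p = 0 := by
  have h1 : ∀ q : Config n, size q = size m → ket q p = 0 := fun q hq => by
    have : p ≠ q := fun e => h (by rw [e, hq])
    simp [ket, this]
  rw [hopCol, Pi.sub_apply, Finset.sum_apply, Pi.smul_apply, h1 m rfl, smul_zero,
    Finset.sum_eq_zero, sub_zero]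
  intro k hk
  rw [Pi.smul_apply, h1 _ (size_put_take (Finset.mem_Icc.1 hk).2), smul_zero]

/-- The generator of particles jumping from site `i` to site `j`. -/
def hopEnd (s : ℝ) (i j : Fin (n + 1)) : Module.End ℝ (Vec n) := opOfCol (hopCol s i j)

theorem continuous_hopEnd (s : ℝ) (i j : Fin (n + 1)) : Continuous (hopEnd s i j) :=
  continuous_opOfCol _

theorem raises_hopEnd (i j : Fin (n + 1)) : Raises 0 (hopEnd s i j) :=
  raises_opOfCol fun _ _ h => hopCol_eq_zero h

theorem hopEnd_ket (i j : Fin (n + 1)) (m : Config n) :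
    hopEnd s i j (ket m) = hopCol s i j m :=
  opOfCol_ket (fun _ _ h => hopCol_eq_zero (by omega)) m

/-- Turns operator identities on the chain into scalar identities for `hopSum`: with T, the
spectator sites and the row p fixed, only the two occupation numbers vary. -/
theorem apply_hopEnd_setTwo {i j : Fin (n + 1)} (hij : i ≠ j) (T : Module.End ℝ (Vec n))
    (m : Config n) (x y : ℕ) (p : Config n) :
    T (hopEnd s i j (ket (setTwo m i j x y))) p =
      hopSum s (fun x y => T (ket (setTwo m i j x y)) p) x y := by
  rw [hopEnd_ket, hopCol, hopSum, setTwo_left m x y hij, map_sub, map_smul, map_sum,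
    Pi.sub_apply, Finset.sum_apply, Finset.range_eq_Ico,
    Finset.sum_Ico_add' (fun k => rate s k x * T (ket (setTwo m i j (x - k) (y + k))) p) 0 x 1]
  congr 1
  refine Finset.sum_congr rfl fun k _ => ?_
  rw [put_take_setTwo m x y k hij, map_smul]
  rfl

theorem hopEnd_setTwo {i j : Fin (n + 1)} (hij : i ≠ j) (m : Config n) (x y : ℕ)
    (p : Config n) : hopEnd s i j (ket (setTwo m i j x y)) p =
      hopSum s (fun x y => ket (setTwo m i j x y) p) x y :=
  apply_hopEnd_setTwo hij 1 m x y p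

/-! ### Conservation of particles in the two-site sums -/

theorem hopSum_const_mul (c : ℝ) (K : ℕ → ℕ → ℝ) (x y : ℕ) :
    hopSum s (fun x y => c * K x y) x y = c * hopSum s K x y := by
  rw [hopSum, hopSum, mul_sub, Finset.mul_sum]
  congr 1
  · ring
  · exact Finset.sum_congr rfl fun k _ => by ring

theorem hopSum_add (K K' : ℕ → ℕ → ℝ) (x y : ℕ) :
    hopSum s (fun x y => K x y + K' x y) x y = hopSum s K x y + hopSum s K' x y := by
  simp only [hopSum, mul_add, Finset.sum_add_distrib]
  ring

theorem hopSum_mul_of_add (g : ℕ → ℝ) (K : ℕ → ℕ → ℝ) (x y : ℕ) :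
    hopSum s (fun x y => g (x + y) * K x y) x y = g (x + y) * hopSum s K x y := by
  rw [← hopSum_const_mul, hopSum, hopSum]
  congr 1
  refine Finset.sum_congr rfl fun k hk => ?_
  have := Finset.mem_range.1 hk
  rw [show x - (k + 1) + (y + (k + 1)) = x + y by omega]

/-- The quadratic coefficients and their mirror images add up to 2(x + y) + 6s times the
coefficients of `S₊`. As x + y is conserved by hopping, the mirrored relation follows from
`hopSum_quadratic` and `hopSum_raise`. -/
theorem hopSum_quadratic_swap (hs : 0 < s) (K : ℕ → ℕ → ℝ) (x y : ℕ) :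
    (x + 2 * s) ^ 2 * hopSum s K (x + 1) y +
        (y + 2 * s) * (y + 2 * x + 4 * s) * hopSum s K x (y + 1) =
      hopSum s (fun x y => (x + 2 * s) ^ 2 * K (x + 1) y +
        (y + 2 * s) * (y + 2 * x + 4 * s) * K x (y + 1)) x y +
      (x + 2 * s) * K (x + 1) y - (2 * x + 2 * s) * K x (y + 1) := by
  have h1 := hopSum_raise hs K x y
  have h2 := hopSum_quadratic hs K x y
  have h3 := hopSum_mul_of_add (s := s) (fun N => 2 * (N : ℝ) + 6 * s)
    (fun x y => (x + 2 * s) * K (x + 1) y + (y + 2 * s) * K x (y + 1)) x y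
  have h4 := hopSum_add (s := s) (fun x y => (x + 2 * s) ^ 2 * K (x + 1) y +
        (y + 2 * s) * (y + 2 * x + 4 * s) * K x (y + 1))
        (fun x y => (x + 2 * s) * (x + 2 * y + 4 * s) * K (x + 1) y +
          (y + 2 * s) ^ 2 * K x (y + 1)) x y
  have h5 : (fun x y : ℕ => (2 * ((x + y : ℕ) : ℝ) + 6 * s) *
      (((x : ℝ) + 2 * s) * K (x + 1) y + (y + 2 * s) * K x (y + 1))) =
      fun x y : ℕ => ((x : ℝ) + 2 * s) ^ 2 * K (x + 1) y +
        (y + 2 * s) * (y + 2 * x + 4 * s) * K x (y + 1) +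
        ((x + 2 * s) * (x + 2 * y + 4 * s) * K (x + 1) y + (y + 2 * s) ^ 2 * K x (y + 1)) := by
    funext x y
    push_cast
    ring
  rw [h5, h4] at h3
  push_cast at h3
  linear_combination -h2 - h3 - (2 * (x + y) + 6 * s) * h1

/-! ### Commutators of hopping with site operators -/

theorem commute_hopEnd_of_ket {i j : Fin (n + 1)} (hij : i ≠ j) {T : Module.End ℝ (Vec n)}
    (hT : Continuous T)
    (h : ∀ m, ∃ c m', ∀ x y, T (ket (setTwo m i j x y)) = (c : ℝ) • ket (setTwo m' i j x y)) :
    Commute (hopEnd s i j) T := by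
  refine ext_ket (continuous_mul' (continuous_hopEnd _ _ _) hT)
    (continuous_mul' hT (continuous_hopEnd _ _ _)) fun m => funext fun p => ?_
  obtain ⟨c, m', hm⟩ := h m
  rw [Module.End.mul_apply, Module.End.mul_apply, ← setTwo_self (i := i) (j := j) m,
    apply_hopEnd_setTwo hij, hm, map_smul, Pi.smul_apply, hopEnd_setTwo hij, smul_eq_mul,
    ← hopSum_const_mul]
  simp only [hm, Pi.smul_apply, smul_eq_mul]

theorem commute_hopEnd_Sminus {i j l : Fin (n + 1)} (hij : i ≠ j) (hi : l ≠ i) (hj : l ≠ j) :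
    Commute (hopEnd s i j) (Sminus l) :=
  commute_hopEnd_of_ket hij (continuous_Sminus l) fun m =>
    ⟨m l, Function.update m l (m l - 1), fun x y => by
      rw [Sminus_ket, setTwo_of_ne m x y hi hj, update_setTwo_of_ne m x y _ hi hj]⟩

theorem commute_hopEnd_Splus {i j l : Fin (n + 1)} (hij : i ≠ j) (hi : l ≠ i) (hj : l ≠ j) :
    Commute (hopEnd s i j) (Splus s l) :=
  commute_hopEnd_of_ket hij (continuous_Splus s l) fun m =>
    ⟨m l + 2 * s, Function.update m l (m l + 1), fun x y => by
      rw [Splus_ket, setTwo_of_ne m x y hi hj, update_setTwo_of_ne m x y _ hi hj]⟩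

theorem commute_hopEnd_diagOp {i j : Fin (n + 1)} (hij : i ≠ j) {f : Config n → ℝ}
    (hf : ∀ m, ∃ g : ℕ → ℝ, ∀ x y, f (setTwo m i j x y) = g (x + y)) :
    Commute (hopEnd s i j) (diagOp f) := by
  refine ext_ket (continuous_mul' (continuous_hopEnd _ _ _) (continuous_diagOp f))
    (continuous_mul' (continuous_diagOp f) (continuous_hopEnd _ _ _)) fun m => funext fun p => ?_
  obtain ⟨g, hg⟩ := hf m
  rw [Module.End.mul_apply, Module.End.mul_apply, ← setTwo_self (i := i) (j := j) m,
    apply_hopEnd_setTwo hij, diagOp_ket, map_smul, Pi.smul_apply, hopEnd_setTwo hij, smul_eq_mul,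
    hg, ← hopSum_mul_of_add]
  simp only [diagOp_ket, hg, Pi.smul_apply, smul_eq_mul]

theorem commute_hopEnd_Sminus_add (hs : 0 < s) {i j : Fin (n + 1)} (hij : i ≠ j) :
    Commute (hopEnd s i j) (Sminus i + Sminus j) := by
  have hc := continuous_add' (continuous_Sminus i) (continuous_Sminus j)
  refine ext_ket (continuous_mul' (continuous_hopEnd _ _ _) hc)
    (continuous_mul' hc (continuous_hopEnd _ _ _)) fun m => funext fun p => ?_
  have key : ∀ x y, (Sminus i + Sminus j) (ket (setTwo m i j x y)) =
      (x : ℝ) • ket (setTwo m i j (x - 1) y) + (y : ℝ) • ket (setTwo m i j x (y - 1)) :=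
    fun x y => by
      rw [LinearMap.add_apply, Sminus_ket, Sminus_ket, setTwo_left m x y hij, setTwo_right,
        update_setTwo_left m x y _ hij, update_setTwo_right]
  rw [Module.End.mul_apply, Module.End.mul_apply, ← setTwo_self (i := i) (j := j) m,
    apply_hopEnd_setTwo hij, key, map_add, map_smul, map_smul, Pi.add_apply, Pi.smul_apply,
    Pi.smul_apply, hopEnd_setTwo hij, hopEnd_setTwo hij, smul_eq_mul, smul_eq_mul,
    ← hopSum_lower hs]
  simp only [key, Pi.add_apply, Pi.smul_apply, smul_eq_mul]

theorem hopEnd_mul_Splus_add (hs : 0 < s) {i j : Fin (n + 1)} (hij : i ≠ j) :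
    (Splus s i + Splus s j) * hopEnd s i j =
      hopEnd s i j * (Splus s i + Splus s j) + shift j - shift i := by
  have hc := continuous_add' (continuous_Splus s i) (continuous_Splus s j)
  refine ext_ket (continuous_mul' hc (continuous_hopEnd _ _ _))
    (continuous_sub' (continuous_add' (continuous_mul' (continuous_hopEnd _ _ _) hc)
      (continuous_shift j)) (continuous_shift i)) fun m => funext fun p => ?_
  have key : ∀ x y, (Splus s i + Splus s j) (ket (setTwo m i j x y)) =
      ((x : ℝ) + 2 * s) • ket (setTwo m i j (x + 1) y) +
        ((y : ℝ) + 2 * s) • ket (setTwo m i j x (y + 1)) := fun x y => by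
    rw [LinearMap.add_apply, Splus_ket, Splus_ket, setTwo_left m x y hij, setTwo_right,
      update_setTwo_left m x y _ hij, update_setTwo_right]
  have h := hopSum_raise hs (fun x y => ket (setTwo m i j x y) p) (m i) (m j)
  rw [LinearMap.sub_apply, LinearMap.add_apply, Module.End.mul_apply, Module.End.mul_apply,
    ← setTwo_self (i := i) (j := j) m, apply_hopEnd_setTwo hij, key, map_add, map_smul, map_smul,
    Pi.sub_apply, Pi.add_apply, Pi.add_apply, Pi.smul_apply, Pi.smul_apply, hopEnd_setTwo hij,
    hopEnd_setTwo hij, smul_eq_mul, smul_eq_mul, shift_ket, shift_ket, setTwo_left m _ _ hij,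
    setTwo_right, update_setTwo_left m _ _ _ hij, update_setTwo_right]
  rw [← h]
  simp only [key, Pi.add_apply, Pi.smul_apply, smul_eq_mul]

/-! ## The bulk density -/

/-- The bulk density as an everywhere defined operator. -/
def bulkEnd (s : ℝ) (i j : Fin (n + 1)) : Module.End ℝ (Vec n) := hopEnd s i j + hopEnd s j i

theorem continuous_bulkEnd (s : ℝ) (i j : Fin (n + 1)) : Continuous (bulkEnd s i j) :=
  continuous_add' (continuous_hopEnd _ _ _) (continuous_hopEnd _ _ _)

theorem raises_bulkEnd (i j : Fin (n + 1)) : Raises 0 (bulkEnd s i j) :=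
  (raises_hopEnd i j).add (raises_hopEnd j i)

theorem sum_eq_add_add_sum {M : Type*} [AddCommMonoid M] (f : Fin (n + 1) → M)
    {i j : Fin (n + 1)} (hij : i ≠ j) :
    ∑ l, f l = f i + f j + ∑ l ∈ (univ.erase i).erase j, f l := by
  rw [add_assoc, Finset.add_sum_erase _ f (Finset.mem_erase.2 ⟨hij.symm, Finset.mem_univ j⟩),
    Finset.add_sum_erase _ f (Finset.mem_univ i)]

theorem commute_bulkEnd_SminusTot (hs : 0 < s) {i j : Fin (n + 1)} (hij : i ≠ j) :
    Commute (bulkEnd s i j) SminusTot := by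
  rw [SminusTot, sum_eq_add_add_sum Sminus hij]
  refine Commute.add_right (Commute.add_left (commute_hopEnd_Sminus_add hs hij) ?_)
    (Commute.sum_right _ _ _ fun l hl => ?_)
  · rw [add_comm]
    exact commute_hopEnd_Sminus_add hs hij.symm
  · simp only [Finset.mem_erase, Finset.mem_univ, and_true] at hl
    exact Commute.add_left (commute_hopEnd_Sminus hij hl.2 hl.1)
      (commute_hopEnd_Sminus hij.symm hl.1 hl.2)

/-- The defect shift j - shift i of one hopping direction is cancelled by that of the opposite one;
the other sites are spectators. -/
theorem commute_bulkEnd_SplusTot (hs : 0 < s) {i j : Fin (n + 1)} (hij : i ≠ j) :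
    Commute (bulkEnd s i j) (SplusTot s) := by
  rw [SplusTot, sum_eq_add_add_sum (Splus s) hij]
  refine Commute.add_right ?_ (Commute.sum_right _ _ _ fun l hl => ?_)
  · have h1 := hopEnd_mul_Splus_add hs hij
    have h2 := hopEnd_mul_Splus_add hs hij.symm
    rw [add_comm (Splus s j)] at h2
    rw [Commute, SemiconjBy, bulkEnd, add_mul, mul_add _ (hopEnd s i j), h1, h2]
    abel
  · simp only [Finset.mem_erase, Finset.mem_univ, and_true] at hl
    exact Commute.add_left (commute_hopEnd_Splus hij hl.2 hl.1)
      (commute_hopEnd_Splus hij.symm hl.1 hl.2)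

/-! ## The charge `Q₊` -/

/-- The coefficient of `Q₊` at site `i`. -/
def chargeCoeff (s : ℝ) (i : Fin (n + 1)) (m : Config n) : ℝ :=
  m i + 2 * s + 2 * ∑ j ∈ Ioi i, ((m j : ℝ) + s)

theorem sum_diagOp {ι : Type*} (A : Finset ι) (f : ι → Config n → ℝ) :
    ∑ i ∈ A, diagOp (f i) = diagOp fun m => ∑ i ∈ A, f i m := by
  refine LinearMap.ext fun v => funext fun p => ?_
  rw [LinearMap.sum_apply, Finset.sum_apply]
  exact (Finset.sum_mul _ _ _).symm

/-- The term s S₊^tot is absorbed by turning the eigenvalue m_i + s of `S₀` into m_i + 2s. -/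
theorem Qplus_eq (s : ℝ) :
    Qplus (n := n) s = ∑ i, Splus s i * diagOp (chargeCoeff s i) := by
  rw [Qplus, SplusTot, Finset.smul_sum, ← Finset.sum_add_distrib]
  refine Finset.sum_congr rfl fun i _ => ?_
  rw [← mul_one (s • Splus s i), smul_mul_assoc, ← mul_smul_comm, ← mul_add]
  congr 1
  simp only [S0]
  rw [sum_diagOp]
  refine LinearMap.ext fun v => funext fun p => ?_
  simp only [LinearMap.add_apply, LinearMap.smul_apply, Module.End.one_apply, Pi.add_apply,
    Pi.smul_apply, smul_eq_mul, diagOp, LinearMap.coe_mk, AddHom.coe_mk, chargeCoeff]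
  ring

theorem continuous_Qplus (s : ℝ) : Continuous (Qplus (n := n) s) := by
  rw [Qplus_eq]
  exact continuous_sum' fun i _ => continuous_mul' (continuous_Splus s i) (continuous_diagOp _)

theorem raises_Qplus (s : ℝ) : Raises 1 (Qplus (n := n) s) := by
  rw [Qplus_eq]
  exact Raises.sum fun i _ => (raises_Splus s i).mul (raises_diagOp _)

theorem Splus_mul_diagOp_ket (s : ℝ) (i : Fin (n + 1)) (f : Config n → ℝ) (m : Config n) :
    (Splus s i * diagOp f) (ket m) =
      (((m i : ℝ) + 2 * s) * f m) • ket (Function.update m i (m i + 1)) := by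
  rw [Module.End.mul_apply, diagOp_ket, map_smul, Splus_ket, smul_smul, mul_comm]

theorem sum_setTwo {i j : Fin (n + 1)} (hij : i ≠ j) {A : Finset (Fin (n + 1))} (hi : i ∈ A)
    (hj : j ∈ A) (m : Config n) (x y : ℕ) :
    ∑ l ∈ A, ((setTwo m i j x y l : ℝ) + s) =
      ((x + y : ℕ) : ℝ) + 2 * s + ∑ l ∈ (A.erase i).erase j, ((m l : ℝ) + s) := by
  have hj' : j ∈ A.erase i := Finset.mem_erase.2 ⟨hij.symm, hj⟩
  rw [← Finset.add_sum_erase _ _ hi, ← Finset.add_sum_erase _ _ hj', setTwo_left m x y hij,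
    setTwo_right, ← add_assoc]
  congr 1
  · push_cast
    ring
  · refine Finset.sum_congr rfl fun l hl => ?_
    simp only [Finset.mem_erase] at hl
    rw [setTwo_of_ne m x y hl.2.1 hl.1]

theorem sum_setTwo_of_notMem {i j : Fin (n + 1)} {A : Finset (Fin (n + 1))} (hi : i ∉ A)
    (hj : j ∉ A) (m : Config n) (x y : ℕ) :
    ∑ l ∈ A, ((setTwo m i j x y l : ℝ) + s) = ∑ l ∈ A, ((m l : ℝ) + s) := by
  refine Finset.sum_congr rfl fun l hl => ?_
  rw [setTwo_of_ne m x y (ne_of_mem_of_not_mem hl hi) (ne_of_mem_of_not_mem hl hj)]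

/-- If i and j are both to the right of l or neither is, the coefficient of the charge at l depends
on them at most through m_i + m_j, which hopping conserves. -/
theorem commute_hopEnd_charge {i j l : Fin (n + 1)} (hij : i ≠ j)
    (hi : l ≠ i) (hj : l ≠ j) (h : i ∈ Ioi l ↔ j ∈ Ioi l) :
    Commute (hopEnd s i j) (Splus s l * diagOp (chargeCoeff s l)) := by
  refine Commute.mul_right (commute_hopEnd_Splus hij hi hj) (commute_hopEnd_diagOp hij fun m => ?_)
  by_cases h' : i ∈ Ioi l
  · refine ⟨fun N => m l + 2 * s + 2 * ((N : ℝ) + 2 * s +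
      ∑ l ∈ ((Ioi l).erase i).erase j, ((m l : ℝ) + s)), fun x y => ?_⟩
    rw [chargeCoeff, setTwo_of_ne m x y hi hj, sum_setTwo hij h' (h.1 h')]
  · refine ⟨fun _ => m l + 2 * s + 2 * ∑ l ∈ Ioi l, ((m l : ℝ) + s), fun x y => ?_⟩
    rw [chargeCoeff, setTwo_of_ne m x y hi hj, sum_setTwo_of_notMem h' (fun h'' => h' (h.2 h''))]

/-- The commutator is a discrete divergence, which will telescope along the chain. The sites to the
right of both enter only through the constant R, whose contribution is a multiple of the `S₊`
commutator and vanishes. -/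
theorem bulkEnd_mul_charge_pair (hs : 0 < s) {i j : Fin (n + 1)} (hij : i.val + 1 = j.val) :
    bulkEnd s i j * (Splus s i * diagOp (chargeCoeff s i) + Splus s j * diagOp (chargeCoeff s j)) =
      (Splus s i * diagOp (chargeCoeff s i) + Splus s j * diagOp (chargeCoeff s j)) *
        bulkEnd s i j + Splus s i - Splus s j := by
  have hne : i ≠ j := fun h => by rw [h] at hij; omega
  -- Here the sites must be neighbours: no third site may lie between them and be counted by one
  -- coefficient only.
  have hI : Ioi i = insert j (Ioi j) := by
    ext l
    simp only [Finset.mem_Ioi, Finset.mem_insert, Fin.lt_def, Fin.ext_iff]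
    omega
  have hi' : i ∉ Ioi j := by
    simp only [Finset.mem_Ioi, Fin.lt_def]
    omega
  have hj' : j ∉ Ioi j := by simp
  have hc := continuous_add' (continuous_mul' (continuous_Splus s i)
    (continuous_diagOp (chargeCoeff s i))) (continuous_mul' (continuous_Splus s j)
    (continuous_diagOp (chargeCoeff s j)))
  refine ext_ket (continuous_mul' (continuous_bulkEnd _ _ _) hc)
    (continuous_sub' (continuous_add' (continuous_mul' hc (continuous_bulkEnd _ _ _))
      (continuous_Splus s i)) (continuous_Splus s j)) fun m => funext fun p => ?_
  set R : ℝ := 2 * ∑ l ∈ Ioi j, ((m l : ℝ) + s) with hR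
  set Q := Splus s i * diagOp (chargeCoeff s i) + Splus s j * diagOp (chargeCoeff s j) with hQ
  have key : ∀ x y, Q (ket (setTwo m i j x y)) =
      (((x : ℝ) + 2 * s) * (x + 2 * y + 4 * s + R)) • ket (setTwo m i j (x + 1) y) +
        (((y : ℝ) + 2 * s) * (y + 2 * s + R)) • ket (setTwo m i j x (y + 1)) := fun x y => by
    rw [hQ, LinearMap.add_apply, Splus_mul_diagOp_ket, Splus_mul_diagOp_ket, chargeCoeff,
      chargeCoeff, hI, Finset.sum_insert hj', sum_setTwo_of_notMem hi' hj', setTwo_left m x y hne,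
      setTwo_right, update_setTwo_left m x y _ hne, update_setTwo_right, hR]
    congr 2
    ring
  set K : ℕ → ℕ → ℝ := fun x y => ket (setTwo m i j x y) p with hK
  set K' : ℕ → ℕ → ℝ := fun y x => ket (setTwo m j i y x) p with hK'
  have hKK' : ∀ x y, K' y x = K x y := fun x y => by
    simp only [hK, hK', setTwo_comm m x y hne]
  have hop1 : ∀ x y, hopEnd s i j (ket (setTwo m i j x y)) p = hopSum s K x y := fun x y =>
    hopEnd_setTwo hne m x y p
  have hop2 : ∀ x y, hopEnd s j i (ket (setTwo m i j x y)) p = hopSum s K' y x := fun x y => by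
    rw [setTwo_comm m x y hne, hopEnd_setTwo hne.symm m y x p]
  have hQ1 : ∀ x y, Q (hopEnd s i j (ket (setTwo m i j x y))) p =
      hopSum s (fun x y : ℕ => (x + 2 * s) * (x + 2 * y + 4 * s) * K (x + 1) y +
        (y + 2 * s) ^ 2 * K x (y + 1)) x y +
      R * hopSum s (fun x y => (x + 2 * s) * K (x + 1) y + (y + 2 * s) * K x (y + 1)) x y :=
    fun x y => by
      rw [apply_hopEnd_setTwo hne, ← hopSum_const_mul, ← hopSum_add]
      congr 1
      funext x y
      simp only [key, Pi.add_apply, Pi.smul_apply, smul_eq_mul, hK]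
      ring
  have hQ2 : ∀ x y, Q (hopEnd s j i (ket (setTwo m i j x y))) p =
      hopSum s (fun y x : ℕ => (y + 2 * s) ^ 2 * K' (y + 1) x +
        (x + 2 * s) * (x + 2 * y + 4 * s) * K' y (x + 1)) y x +
      R * hopSum s (fun y x => (y + 2 * s) * K' (y + 1) x + (x + 2 * s) * K' y (x + 1)) y x :=
    fun x y => by
      rw [setTwo_comm m x y hne, apply_hopEnd_setTwo hne.symm, ← hopSum_const_mul, ← hopSum_add]
      congr 1
      funext y x
      simp only [← setTwo_comm m x y hne, key, Pi.add_apply, Pi.smul_apply, smul_eq_mul, hKK']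
      ring
  have r1 := hopSum_raise hs K (m i) (m j)
  have r2 := hopSum_raise hs K' (m j) (m i)
  have q1 := hopSum_quadratic hs K (m i) (m j)
  have q2 := hopSum_quadratic_swap hs K' (m j) (m i)
  simp only [Module.End.mul_apply, LinearMap.add_apply, LinearMap.sub_apply, Pi.add_apply,
    Pi.sub_apply, bulkEnd, map_add]
  have hm : ket m = ket (setTwo m i j (m i) (m j)) := by rw [setTwo_self]
  rw [hm, hQ1, hQ2, key, Splus_ket, Splus_ket, setTwo_left m _ _ hne, setTwo_right,
    update_setTwo_left m _ _ _ hne, update_setTwo_right]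
  simp only [map_add, map_smul, Pi.add_apply, Pi.smul_apply, smul_eq_mul, hop1, hop2]
  rw [hKK', hKK'] at r2 q2
  change _ = _ + (↑(m i) + 2 * s) * K (m i + 1) (m j) - (↑(m j) + 2 * s) * K (m i) (m j + 1)
  linear_combination q1 + q2 - R * r1 - R * r2

theorem bulkEnd_mul_Qplus (hs : 0 < s) {i j : Fin (n + 1)} (hij : i.val + 1 = j.val) :
    bulkEnd s i j * Qplus s = Qplus s * bulkEnd s i j + Splus s i - Splus s j := by
  have hne : i ≠ j := fun h => by rw [h] at hij; omega
  rw [Qplus_eq, sum_eq_add_add_sum _ hne, mul_add, add_mul, bulkEnd_mul_charge_pair hs hij]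
  have : Commute (bulkEnd s i j)
      (∑ l ∈ (univ.erase i).erase j, Splus s l * diagOp (chargeCoeff s l)) := by
    refine Commute.sum_right _ _ _ fun l hl => ?_
    simp only [Finset.mem_erase, Finset.mem_univ, and_true] at hl
    have hi : l.val ≠ i.val := fun h => hl.2 (Fin.ext h)
    have hj : l.val ≠ j.val := fun h => hl.1 (Fin.ext h)
    refine Commute.add_left (commute_hopEnd_charge hne hl.2 hl.1 ?_)
      (commute_hopEnd_charge hne.symm hl.1 hl.2 ?_) <;>
    · simp only [Finset.mem_Ioi, Fin.lt_def]
      omega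
  rw [this.eq]
  abel

/-- The one-site operator `ψ(S₀ + s) - ψ(2 s)`. -/
def harmonicOp (s : ℝ) (i : Fin (n + 1)) : Module.End ℝ (Vec n) :=
  diagOp fun m => harmonicNumber s (m i)

theorem chargeCoeff_update {i l : Fin (n + 1)} (h : i < l) (m : Config n) (x : ℕ) :
    chargeCoeff s l (Function.update m i x) = chargeCoeff s l m := by
  rw [chargeCoeff, chargeCoeff, Function.update_of_ne h.ne']
  congr 2
  refine Finset.sum_congr rfl fun k hk => ?_
  rw [Function.update_of_ne (h.trans (Finset.mem_Ioi.1 hk)).ne']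

theorem harmonicOp_mul_charge (hs : 0 < s) (i : Fin (n + 1)) (f : Config n → ℝ) :
    harmonicOp s i * (Splus s i * diagOp f) =
      (Splus s i * diagOp f) * harmonicOp s i + shift i * diagOp f := by
  rw [← mul_assoc, harmonicOp, harmonic_mul_Splus hs, add_mul, mul_assoc, mul_assoc,
    (commute_diagOp_diagOp _ f).eq]

theorem commute_harmonicOp_Splus {i l : Fin (n + 1)} (h : i ≠ l) :
    Commute (harmonicOp s i) (Splus s l) :=
  commute_diagOp_Splus fun m x => by rw [Function.update_of_ne h]

theorem harmonicOp_mul_Qplus (hs : 0 < s) (i : Fin (n + 1)) :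
    harmonicOp s i * Qplus s =
      Qplus s * harmonicOp s i + shift i * diagOp (chargeCoeff s i) := by
  rw [Qplus_eq, ← Finset.add_sum_erase _ _ (Finset.mem_univ i), mul_add, add_mul,
    harmonicOp_mul_charge hs]
  have : Commute (harmonicOp s i)
      (∑ l ∈ univ.erase i, Splus s l * diagOp (chargeCoeff s l)) := by
    refine Commute.sum_right _ _ _ fun l hl => ?_
    exact (commute_harmonicOp_Splus (Finset.ne_of_mem_erase hl).symm).mul_right
      (commute_diagOp_diagOp _ _)
  rw [this.eq]
  abel

/-- The equilibrium Hamiltonian in the basis in which it preserves the number of particles. -/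
def diagonalHamiltonian (n : ℕ) (s : ℝ) : Module.End ℝ (Vec n) :=
  harmonicOp s 0 + ∑ i : Fin n, bulkEnd s i.castSucc i.succ + harmonicOp s (Fin.last n)

theorem continuous_diagonalHamiltonian (n : ℕ) (s : ℝ) : Continuous (diagonalHamiltonian n s) :=
  continuous_add' (continuous_add' (continuous_diagOp _)
    (continuous_sum' fun _ _ => continuous_bulkEnd _ _ _)) (continuous_diagOp _)

theorem raises_diagonalHamiltonian (n : ℕ) (s : ℝ) : Raises 0 (diagonalHamiltonian n s) :=
  ((raises_diagOp _).add (Raises.sum fun _ _ => raises_bulkEnd _ _)).add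
    (raises_diagOp _)

/-- The eigenvalue of `2 (S₀^tot + s)`. -/
def weight (s : ℝ) (m : Config n) : ℝ := 2 * (spinTot s m + s)

theorem weight_update (m : Config n) (i : Fin (n + 1)) :
    weight s (Function.update m i (m i + 1)) = weight s m + 2 := by
  rw [weight, weight, spinTot, spinTot, ← Finset.add_sum_erase _ _ (Finset.mem_univ i),
    ← Finset.add_sum_erase _ _ (Finset.mem_univ i), Function.update_self]
  have : ∑ l ∈ univ.erase i, ((Function.update m i (m i + 1) l : ℕ) + s : ℝ) =
      ∑ l ∈ univ.erase i, ((m l : ℝ) + s) :=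
    Finset.sum_congr rfl fun l hl => by rw [Function.update_of_ne (Finset.ne_of_mem_erase hl)]
  rw [this]
  push_cast
  ring

theorem weight_eq_chargeCoeff (m : Config n) :
    weight s m = chargeCoeff s 0 m + (m 0 + 2 * s) := by
  rw [weight, spinTot, ← Finset.add_sum_erase _ _ (Finset.mem_univ (0 : Fin (n + 1))), chargeCoeff]
  have : (Ioi (0 : Fin (n + 1))) = univ.erase 0 := by
    ext l
    simp
  rw [this]
  ring

theorem sum_castSucc_sub_succ {M : Type*} [AddCommGroup M] (f : Fin (n + 1) → M) :
    ∑ i : Fin n, (f i.castSucc - f i.succ) = f 0 - f (Fin.last n) := by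
  have h1 := Fin.sum_univ_castSucc f
  have h2 := Fin.sum_univ_succ f
  rw [Finset.sum_sub_distrib, sub_eq_sub_iff_add_eq_add, ← h1, h2]

/-- The bulk telescopes to S₊ at the first site minus S₊ at the last. The last boundary commutator
is exactly S₊ there and cancels; at the first site the two contributions add up to E_0 times the
total weight. The ordering of the sites in `Q₊` thus puts the whole defect at the left end. -/
theorem diagonalHamiltonian_mul_Qplus (hs : 0 < s) :
    diagonalHamiltonian n s * Qplus s =
      Qplus s * diagonalHamiltonian n s + shift 0 * diagOp (weight s) := by
  have hsum : (∑ i : Fin n, bulkEnd s i.castSucc i.succ) * Qplus s =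
      Qplus s * (∑ i : Fin n, bulkEnd s i.castSucc i.succ) +
        (Splus s 0 - Splus s (Fin.last n)) := by
    rw [Finset.sum_mul, Finset.mul_sum, ← sum_castSucc_sub_succ, ← Finset.sum_add_distrib]
    refine Finset.sum_congr rfl fun i _ => ?_
    rw [bulkEnd_mul_Qplus hs (by simp), add_sub_assoc]
  have hlast : shift (Fin.last n) * diagOp (chargeCoeff s (Fin.last n)) = Splus s (Fin.last n) := by
    rw [Splus_eq]
    congr 2
    funext m
    rw [chargeCoeff, show Ioi (Fin.last n) = ∅ by ext l; simp [Fin.le_last]]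
    simp
  have hfirst : shift (0 : Fin (n + 1)) * diagOp (weight s) =
      shift 0 * diagOp (chargeCoeff s 0) + Splus s 0 := by
    rw [Splus_eq, ← mul_add]
    congr 1
    refine LinearMap.ext fun v => funext fun p => ?_
    simp only [diagOp, LinearMap.coe_mk, AddHom.coe_mk, LinearMap.add_apply, Pi.add_apply,
      weight_eq_chargeCoeff]
    ring
  rw [diagonalHamiltonian, add_mul, add_mul, harmonicOp_mul_Qplus hs, harmonicOp_mul_Qplus hs,
    hsum, hlast, hfirst, mul_add, mul_add]
  abel

/-! ### The algebra of the weight, the charge and the left shift -/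

theorem diagOp_weight_mul_Qplus :
    diagOp (weight s) * Qplus (n := n) s = Qplus s * (diagOp (weight s) + 2) := by
  have hc : Continuous (diagOp (weight s) + 2 : Module.End ℝ (Vec n)) := by
    rw [show (2 : Module.End ℝ (Vec n)) = (2 : ℝ) • 1 by rw [two_smul, one_add_one_eq_two]]
    exact continuous_add' (continuous_diagOp _) (continuous_smul' 2 continuous_id)
  refine ext_ket (continuous_mul' (continuous_diagOp _) (continuous_Qplus s))
    (continuous_mul' (continuous_Qplus s) hc) fun m => ?_
  have h2 : (2 : Module.End ℝ (Vec n)) (ket m) = (2 : ℝ) • ket m := by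
    rw [← one_add_one_eq_two, LinearMap.add_apply, Module.End.one_apply, two_smul]
  rw [Module.End.mul_apply, Module.End.mul_apply, LinearMap.add_apply, diagOp_ket, h2, ← add_smul,
    map_smul, Qplus_eq, LinearMap.sum_apply, map_sum, Finset.smul_sum]
  refine Finset.sum_congr rfl fun i _ => ?_
  rw [Splus_mul_diagOp_ket, map_smul, diagOp_ket, weight_update, smul_smul, smul_smul, mul_comm]

theorem diagOp_weight_mul_shift (i : Fin (n + 1)) :
    diagOp (weight s) * shift i = shift i * (diagOp (weight s) + 2) := by
  have hc : Continuous (diagOp (weight s) + 2 : Module.End ℝ (Vec n)) := by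
    rw [show (2 : Module.End ℝ (Vec n)) = (2 : ℝ) • 1 by rw [two_smul, one_add_one_eq_two]]
    exact continuous_add' (continuous_diagOp _) (continuous_smul' 2 continuous_id)
  refine ext_ket (continuous_mul' (continuous_diagOp _) (continuous_shift i))
    (continuous_mul' (continuous_shift i) hc) fun m => ?_
  have h2 : (2 : Module.End ℝ (Vec n)) (ket m) = (2 : ℝ) • ket m := by
    rw [← one_add_one_eq_two, LinearMap.add_apply, Module.End.one_apply, two_smul]
  rw [Module.End.mul_apply, Module.End.mul_apply, LinearMap.add_apply, diagOp_ket, h2, ← add_smul,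
    map_smul, shift_ket, diagOp_ket, weight_update]

/-- A particle added at site 0 affects only the charge term of site 0, since site 0 is to the right
of no site. There both factors c and a = m_0 + 2s grow by one, and (a+1)(c+1) - ac = (a + c) + 1 is
the weight plus one. -/
theorem Qplus_mul_shift :
    Qplus (n := n) s * shift 0 =
      shift 0 * Qplus s + shift 0 * (shift 0 * (diagOp (weight s) + 1)) := by
  have hE := continuous_shift (0 : Fin (n + 1))
  have hc : Continuous (diagOp (weight s) + 1 : Module.End ℝ (Vec n)) :=
    continuous_add' (continuous_diagOp _) continuous_id
  refine ext_ket (continuous_mul' (continuous_Qplus s) hE)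
    (continuous_add' (continuous_mul' hE (continuous_Qplus s))
      (continuous_mul' hE (continuous_mul' hE hc))) fun m => ?_
  rw [Qplus_eq, LinearMap.add_apply]
  simp only [Module.End.mul_apply (shift 0), Module.End.mul_apply _ (shift 0)]
  rw [LinearMap.add_apply, Module.End.one_apply, diagOp_ket, shift_ket, LinearMap.sum_apply,
    LinearMap.sum_apply, map_sum, ← Finset.add_sum_erase _ _ (Finset.mem_univ 0),
    ← Finset.add_sum_erase _ _ (Finset.mem_univ (0 : Fin (n + 1))), add_right_comm]
  congr 1
  · rw [Splus_mul_diagOp_ket, Splus_mul_diagOp_ket, map_smul, map_add, map_smul, shift_ket,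
      map_add, map_smul, shift_ket, weight_eq_chargeCoeff]
    have : chargeCoeff s 0 (Function.update m 0 (m 0 + 1)) = chargeCoeff s 0 m + 1 := by
      rw [chargeCoeff, chargeCoeff, Function.update_self]
      have : ∑ j ∈ Ioi (0 : Fin (n + 1)), ((Function.update m 0 (m 0 + 1) j : ℕ) + s : ℝ) =
          ∑ j ∈ Ioi (0 : Fin (n + 1)), ((m j : ℝ) + s) :=
        Finset.sum_congr rfl fun l hl => by
          rw [Function.update_of_ne (Finset.mem_Ioi.1 hl).ne']
      rw [this]
      push_cast
      ring
    rw [this]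
    simp only [shift_ket, Function.update_self]
    push_cast
    module
  · refine Finset.sum_congr rfl fun l hl => ?_
    have hl0 : l ≠ 0 := Finset.ne_of_mem_erase hl
    rw [Splus_mul_diagOp_ket, Splus_mul_diagOp_ket, map_smul, shift_ket,
      Function.update_of_ne hl0, Function.update_of_ne hl0.symm,
      chargeCoeff_update (Fin.pos_iff_ne_zero.2 hl0), Function.update_comm hl0]

/-! ## Exchange relations -/

/-- If the commutators of `H` with `X` and of `X` with the powers of `E` act by scalars along the
sequence `w` generated by `X`, then `H` exchanges with the normalised powers of `X` up to the
coefficients of a logarithm. -/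
theorem exchange_relation {M : Type*} [AddCommGroup M] [Module ℝ M] {H X E : Module.End ℝ M}
    {w w' : ℕ → M} {x : ℕ → ℝ} {y : ℕ → ℕ → ℝ} (hx : ∀ k, x k ≠ 0)
    (hX : ∀ k, X (w k) = x k • w (k + 1)) (hX' : ∀ k, X (w' k) = x k • w' (k + 1))
    (hHX : ∀ k, H (X (w k)) = X (H (w k)) + y k 0 • E (w k))
    (hXE : ∀ k l, X ((E ^ (l + 1)) (w k)) =
      x k • (E ^ (l + 1)) (w (k + 1)) + ((l + 1) * y k (l + 1)) • (E ^ (l + 2)) (w k))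
    (h0 : H (w 0) = w' 0) (hxy : ∀ q l : ℕ, x q + (l + 1) * y (q + 1) l = x (q + l + 1))
    (hy : ∀ k : ℕ, (k + 1) * y 0 k = x k) (k : ℕ) :
    H (w k) = w' k + ∑ l ∈ range k, ((1 : ℝ) / (l + 1)) • (E ^ (l + 1)) (w (k - 1 - l)) := by
  induction k with
  | zero => simpa using h0
  | succ k ih =>
    -- Applying X to the tail yields, from each term, one with the same power of E and one with the
    -- next power. The term y k 0 • E (w k) from the commutator with H is the missing l = 0 member
    -- of the second family. Terms with l < k then combine by `hxy`, and the last one by `hy`.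
    have hsum : X (∑ l ∈ range k, ((1 : ℝ) / (l + 1)) • (E ^ (l + 1)) (w (k - 1 - l))) +
        y k 0 • E (w k) =
        x k • ∑ l ∈ range (k + 1), ((1 : ℝ) / (l + 1)) • (E ^ (l + 1)) (w (k - l)) := by
      have h1 : X (∑ l ∈ range k, ((1 : ℝ) / (l + 1)) • (E ^ (l + 1)) (w (k - 1 - l))) =
          ∑ l ∈ range k, (x (k - 1 - l) / (l + 1)) • (E ^ (l + 1)) (w (k - l)) +
          ∑ l ∈ range k, y (k - (l + 1)) (l + 1) • (E ^ (l + 1 + 1)) (w (k - (l + 1))) := by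
        rw [map_sum, ← Finset.sum_add_distrib]
        refine Finset.sum_congr rfl fun l hl => ?_
        have hl' := Finset.mem_range.1 hl
        rw [map_smul, hXE, show k - 1 - l + 1 = k - l by omega,
          show k - 1 - l = k - (l + 1) by omega, smul_add, smul_smul, smul_smul]
        have : ((l : ℝ) + 1) ≠ 0 := by positivity
        congr 2
        · field_simp
        · field_simp
      have h2 : ∑ l ∈ range k, y (k - (l + 1)) (l + 1) • (E ^ (l + 1 + 1)) (w (k - (l + 1))) +
          y k 0 • E (w k) = ∑ l ∈ range (k + 1), y (k - l) l • (E ^ (l + 1)) (w (k - l)) := by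
        rw [Finset.sum_range_succ']
        simp
      rw [h1, add_assoc, h2, Finset.sum_range_succ, ← add_assoc, ← Finset.sum_add_distrib,
        Finset.sum_range_succ, smul_add, Finset.smul_sum]
      congr 1
      · refine Finset.sum_congr rfl fun l hl => ?_
        obtain ⟨q, rfl⟩ := Nat.exists_eq_add_of_lt (Finset.mem_range.1 hl)
        rw [← add_smul, smul_smul]
        congr 1
        have h := hxy q l
        have hl0 : ((l : ℝ) + 1) ≠ 0 := by positivity
        rw [show l + q + 1 - 1 - l = q by omega, show l + q + 1 - l = q + 1 by omega,
          show l + q + 1 = q + l + 1 by omega, ← h]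
        field_simp
      · rw [Nat.sub_self, smul_smul, ← hy]
        have hl0 : ((k : ℝ) + 1) ≠ 0 := by positivity
        congr 1
        field_simp
    have h : x k • H (w (k + 1)) = x k • (w' (k + 1) +
        ∑ l ∈ range (k + 1), ((1 : ℝ) / (l + 1)) • (E ^ (l + 1)) (w (k - l))) := by
      rw [← map_smul, ← hX, hHX, ih, map_add, hX', add_assoc, hsum, smul_add]
    exact smul_right_injective M (hx k) h

/-- The formal operator `-log(1 - ρ E_i) = ∑_{k ≥ 1} ρ^k E_i^k / k`. -/
def logShift (ρ : ℝ) (i : Fin (n + 1)) : Module.End ℝ (Vec n) :=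
  gradedSum fun k => (ρ ^ k / k) • shift i ^ k

/-- The operator T is the graded series concentrated in degree zero. -/
theorem mul_gradedSum {A : ℕ → Module.End ℝ (Vec n)} {T : Module.End ℝ (Vec n)}
    (hT : Raises 0 T) : T * gradedSum A = gradedSum fun k => T * A k := by
  have h := gradedSum_mul (A := fun k => if k = 0 then T else 0) (B := A) fun k => by
    by_cases h : k = 0
    · rw [if_pos h, h]
      exact hT
    · rw [if_neg h]
      exact Raises.zero
  have h1 : gradedSum (fun k => if k = 0 then T else 0) = T := by
    refine LinearMap.ext fun v => funext fun p => ?_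
    rw [gradedSum_apply, Finset.sum_range_succ']
    simp
  rw [h1] at h
  rw [h]
  congr 1
  funext m
  rw [Finset.sum_range_succ']
  simp

theorem gradedSum_mul_right (A : ℕ → Module.End ℝ (Vec n)) (T : Module.End ℝ (Vec n)) :
    gradedSum A * T = gradedSum fun k => A k * T := rfl

theorem gradedSum_sub (A B : ℕ → Module.End ℝ (Vec n)) :
    gradedSum A - gradedSum B = gradedSum fun k => A k - B k :=
  LinearMap.ext fun v => funext fun p =>
    (Finset.sum_sub_distrib (s := range (size p + 1)) (fun k => A k v p) fun k => B k v p).symm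

/-- The exchange relations multiplied by ρ^k and summed over k: the tail is the Cauchy product of
the logarithm with the series. -/
theorem sub_logShift_mul_gradedSum {H H' : Module.End ℝ (Vec n)} {ρ : ℝ} {i : Fin (n + 1)}
    {A : ℕ → Module.End ℝ (Vec n)} (hH : Raises 0 H)
    (h : ∀ k, H * A k = A k * H' +
      ∑ l ∈ range k, ((1 : ℝ) / (l + 1)) • (shift i ^ (l + 1) * A (k - 1 - l))) :
    (H - logShift ρ i) * gradedSum (fun k => ρ ^ k • A k) =
      gradedSum (fun k => ρ ^ k • A k) * H' := by
  rw [sub_mul, mul_gradedSum hH, logShift,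
    gradedSum_mul (fun k => ((raises_shift i).pow k).smul _), gradedSum_sub, gradedSum_mul_right]
  congr 1
  funext k
  rw [Finset.sum_range_succ', mul_smul_comm, h, smul_add, smul_mul_assoc (ρ ^ k) (A k) H',
    Finset.smul_sum]
  -- The degree-zero term of `logShift` is absent because its coefficient ρ^0 / 0 is zero by the
  -- division convention.
  simp only [Nat.cast_zero, div_zero, zero_smul, zero_mul, add_zero]
  rw [add_sub_assoc, add_eq_left, sub_eq_zero]
  refine Finset.sum_congr rfl fun l hl => ?_
  have hl' := Finset.mem_range.1 hl
  rw [smul_mul_smul_comm, smul_smul, show k - (l + 1) = k - 1 - l by omega]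
  congr 1
  rw [show ρ ^ k = ρ ^ (l + 1) * ρ ^ (k - 1 - l) by rw [← pow_add]; congr 1; omega]
  push_cast
  ring

/-! ## The boundary term in triangular form -/

/-- The formal operator `h_s(m_i) + log(1 - ρ E_i)`, which is the boundary term in the triangular
form. -/
def boundaryForm (s ρ : ℝ) (i : Fin (n + 1)) : Module.End ℝ (Vec n) :=
  harmonicOp s i - logShift ρ i

theorem boundaryForm_zero (s : ℝ) (i : Fin (n + 1)) : boundaryForm s 0 i = harmonicOp s i := by
  rw [boundaryForm, sub_eq_self, logShift]
  refine LinearMap.ext fun v => funext fun p => ?_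
  rw [gradedSum_apply]
  refine Finset.sum_eq_zero fun k _ => ?_
  cases k <;> simp

theorem gradedExp_smul (c : ℝ) (X : Module.End ℝ (Vec n)) :
    gradedExp (c • X) = gradedSum fun k => c ^ k • ((k.factorial : ℝ)⁻¹ • X ^ k) := by
  rw [gradedExp]
  congr 1
  funext k
  rw [smul_pow, smul_comm]

/-- The exchange relation for X = S₊ and the operator h_s at one site, whose commutator is the
shift. -/
theorem boundaryForm_mul_exp (hs : 0 < s) (ρ : ℝ) (i : Fin (n + 1)) :
    boundaryForm s ρ i * gradedExp (ρ • Splus s i) =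
      gradedExp (ρ • Splus s i) * harmonicOp s i := by
  rw [gradedExp_smul]
  refine sub_logShift_mul_gradedSum (raises_diagOp _) fun k => LinearMap.ext fun v => ?_
  have hS : ∀ (k : ℕ) (u : Vec n), Splus s i (((k.factorial : ℝ)⁻¹ • Splus s i ^ k) u) =
      ((k : ℝ) + 1) • ((((k + 1).factorial : ℝ)⁻¹ • Splus s i ^ (k + 1)) u) := fun k u => by
    rw [LinearMap.smul_apply, LinearMap.smul_apply, map_smul, pow_succ', Module.End.mul_apply,
      smul_smul, Nat.factorial_succ]
    have h1 : (k.factorial : ℝ) ≠ 0 := by exact_mod_cast k.factorial_ne_zero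
    have h2 : (k : ℝ) + 1 ≠ 0 := by positivity
    push_cast
    congr 1
    field_simp
  have hE : ∀ (l : ℕ) (u : Vec n), Splus s i ((shift i ^ l) u) =
      (shift i ^ l) (Splus s i u) + (l : ℝ) • (shift i ^ (l + 1)) u := fun l => by
    induction l with
    | zero => simp
    | succ l ih =>
      intro u
      have := LinearMap.congr_fun (Splus_mul_shift s i) ((shift i ^ l) u)
      rw [pow_succ' (shift i) l, Module.End.mul_apply, ← Module.End.mul_apply (Splus s i), this,
        LinearMap.add_apply, Module.End.mul_apply, ih, Module.End.mul_apply]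
      simp only [map_add, map_smul, pow_succ', Module.End.mul_apply]
      push_cast
      module
  -- The values x_k = k + 1 come from the factorials, and y = 1 from [S₊, E^l] = l E^{l+1}.
  have h := exchange_relation (H := harmonicOp s i) (X := Splus s i) (E := shift i)
    (w := fun k => ((k.factorial : ℝ)⁻¹ • Splus s i ^ k) v)
    (w' := fun k => ((k.factorial : ℝ)⁻¹ • Splus s i ^ k) (harmonicOp s i v))
    (x := fun k => k + 1) (y := fun _ _ => 1) (fun k => by positivity) (fun k => hS k v)
    (fun k => hS k _)
    (fun k => by
      have := LinearMap.congr_fun (harmonic_mul_Splus hs i) (((k.factorial : ℝ)⁻¹ • Splus s i ^ k) v)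
      rw [one_smul]
      exact this)
    (fun k l => by
      rw [hE, hS, map_smul, mul_one]
      push_cast
      rfl)
    (by simp) (fun q l => by push_cast; ring) (fun k => by simp) k
  simpa using h

theorem neg_smul_end (c : ℝ) (X : Module.End ℝ (Vec n)) : -(c • X) = (-c) • X :=
  (neg_smul c X).symm

theorem boundaryForm_eq_conj (hs : 0 < s) (ρ : ℝ) (i : Fin (n + 1)) :
    boundaryForm s ρ i =
      gradedExp (ρ • Splus s i) * harmonicOp s i * gradedExp (-(ρ • Splus s i)) := by
  rw [← boundaryForm_mul_exp hs, mul_assoc, gradedExp_mul_neg ((raises_Splus s i).smul ρ), mul_one]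

/-- Of e^{cS₊^tot} only the factor at site i matters, the rest commutes with the boundary term; at
site i the exponents of the conjugated form add. -/
theorem exp_mul_boundaryForm (hs : 0 < s) (c ρ : ℝ) (i : Fin (n + 1)) :
    gradedExp (c • SplusTot s) * boundaryForm s ρ i =
      boundaryForm s (ρ + c) i * gradedExp (c • SplusTot s) := by
  set R : Module.End ℝ (Vec n) := ∑ l ∈ univ.erase i, Splus s l with hR
  have hRr : Raises 1 (c • R) := (Raises.sum fun l _ => raises_Splus s l).smul c
  have hSr : ∀ a : ℝ, Raises 1 (a • Splus s i) := fun a => (raises_Splus s i).smul a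
  have hSR : ∀ a b : ℝ, Commute (a • Splus s i) (b • R) := fun a b =>
    ((Commute.sum_right _ _ _ fun l _ => commute_Splus s i l).smul_left a).smul_right b
  have hSS : ∀ a b : ℝ, Commute (a • Splus s i) (b • Splus s i) := fun a b =>
    ((Commute.refl _).smul_left a).smul_right b
  have htot : c • SplusTot s = c • Splus s i + c • R := by
    rw [SplusTot, ← Finset.add_sum_erase _ _ (Finset.mem_univ i), smul_add]
  have hexp : ∀ a : ℝ, gradedExp (a • Splus s i) * gradedExp (c • R) =
      gradedExp (c • R) * gradedExp (a • Splus s i) := fun a => by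
    rw [gradedExp_add (hSr a) (hSR a c), gradedExp_add hRr (hSR a c).symm, add_comm]
  have hh : harmonicOp s i * gradedExp (c • R) = gradedExp (c • R) * harmonicOp s i := by
    refine gradedExp_comm (raises_diagOp _) (Commute.smul_right ?_ c)
    exact Commute.sum_right _ _ _ fun l hl =>
      commute_harmonicOp_Splus (Finset.ne_of_mem_erase hl).symm
  have hadd : ∀ a b : ℝ, gradedExp (a • Splus s i) * gradedExp (b • Splus s i) =
      gradedExp ((a + b) • Splus s i) := fun a b => by
    rw [gradedExp_add (hSr a) (hSS a b), add_smul]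
  rw [boundaryForm_eq_conj hs, boundaryForm_eq_conj hs, htot, ← gradedExp_add (hSr c) (hSR c c),
    neg_smul_end, neg_smul_end]
  have e1 : gradedExp (c • Splus s i) * gradedExp (c • R) *
      (gradedExp (ρ • Splus s i) * harmonicOp s i * gradedExp (-ρ • Splus s i)) =
      gradedExp (c • Splus s i) * (gradedExp (ρ • Splus s i) * harmonicOp s i *
        gradedExp (-ρ • Splus s i)) * gradedExp (c • R) := by
    simp only [mul_assoc]
    rw [hexp (-ρ), ← mul_assoc (harmonicOp s i) (gradedExp (c • R)), hh,
      mul_assoc (gradedExp (c • R)) (harmonicOp s i),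
      ← mul_assoc (gradedExp (ρ • Splus s i)) (gradedExp (c • R)), hexp ρ,
      mul_assoc (gradedExp (c • R)) (gradedExp (ρ • Splus s i))]
  rw [e1, ← mul_assoc, ← mul_assoc, ← mul_assoc, hadd, add_comm c ρ]
  congr 1
  rw [mul_assoc _ (gradedExp (-(ρ + c) • Splus s i)), hadd]
  congr 3
  ring

/-! ## The nonlocal transformation -/

theorem spinTot_eq (m : Config n) : spinTot s m = size m + (n + 1) * s := by
  rw [spinTot, size, Finset.sum_add_distrib]
  push_cast
  simp

theorem Raises.commute_diagOp {T : Module.End ℝ (Vec n)} (hT : Raises 0 T) {f : Config n → ℝ}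
    {g : ℕ → ℝ} (h : ∀ m, f m = g (size m)) : Commute (diagOp f) T := by
  refine LinearMap.ext fun v => funext fun p => ?_
  have : T (diagOp f v) p = T (g (size p) • v) p := hT.congr fun q hq => by
    simp only [diagOp, LinearMap.coe_mk, AddHom.coe_mk, h, Pi.smul_apply, smul_eq_mul]
    rw [← hq, add_zero]
  rw [Module.End.mul_apply, Module.End.mul_apply, this, map_smul]
  simp [diagOp, h]

/-- The coefficient of `Δ ^ k` in the nonlocal transformation. -/
def nonlocalCoeff (s : ℝ) (k : ℕ) : Module.End ℝ (Vec n) :=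
  (k.factorial : ℝ)⁻¹ • (Qplus s ^ k * diagOp fun m =>
    Real.Gamma (2 * (spinTot s m + s)) / Real.Gamma ((k : ℝ) + 2 * (spinTot s m + s)))

theorem raises_nonlocalCoeff (s : ℝ) (k : ℕ) : Raises k (nonlocalCoeff (n := n) s k) :=
  ((raises_Qplus s).pow k).mul (raises_diagOp _) |>.smul _

theorem weight_pos (hs : 0 < s) (m : Config n) : 0 < weight s m := by
  rw [weight, spinTot_eq]
  positivity

theorem Gamma_div_Gamma (hs : 0 < s) (k : ℕ) (m : Config n) :
    Real.Gamma (2 * (spinTot s m + s)) / Real.Gamma ((k : ℝ) + 2 * (spinTot s m + s)) =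
      (rising (weight s m) k)⁻¹ := by
  have h := weight_pos hs m
  rw [add_comm (k : ℝ), ← weight, Gamma_add_natCast h]
  have := (Real.Gamma_pos_of_pos h).ne'
  have := (rising_pos h k).ne'
  field_simp

theorem nonlocalCoeff_ket (hs : 0 < s) (k : ℕ) (m : Config n) :
    nonlocalCoeff s k (ket m) =
      (k.factorial * rising (weight s m) k)⁻¹ • (Qplus s ^ k) (ket m) := by
  rw [nonlocalCoeff, LinearMap.smul_apply, Module.End.mul_apply, diagOp_ket, Gamma_div_Gamma hs,
    map_smul, smul_smul, mul_inv]

theorem nonlocalCoeff_zero (hs : 0 < s) : nonlocalCoeff (n := n) s 0 = 1 := by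
  have : (fun m : Config n => Real.Gamma (2 * (spinTot s m + s)) /
      Real.Gamma (((0 : ℕ) : ℝ) + 2 * (spinTot s m + s))) = fun _ => 1 :=
    funext fun m => by rw [Gamma_div_Gamma hs, rising_zero, inv_one]
  rw [nonlocalCoeff, this]
  refine LinearMap.ext fun v => funext fun p => ?_
  simp [diagOp]

/-- The exchange relation for X = Q₊ on a basis vector of weight d. The Gamma quotient supplies
1/(d)_k, and precisely with this normalisation the coefficients (k+1)(d+k) and d + 2k + l satisfy
the required recursion. -/
theorem diagonalHamiltonian_mul_nonlocalCoeff (hs : 0 < s) (k : ℕ) :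
    diagonalHamiltonian n s * nonlocalCoeff s k = nonlocalCoeff s k * diagonalHamiltonian n s +
      ∑ l ∈ range k, ((1 : ℝ) / (l + 1)) • (shift 0 ^ (l + 1) * nonlocalCoeff s (k - 1 - l)) := by
  have hH := continuous_diagonalHamiltonian n s
  have hcN : ∀ k, Continuous (nonlocalCoeff (n := n) s k) := fun k =>
    continuous_smul' _ (continuous_mul' (continuous_pow' (continuous_Qplus s) k)
      (continuous_diagOp _))
  refine ext_ket (continuous_mul' hH (hcN k)) (continuous_add' (continuous_mul' (hcN k) hH)
    (continuous_sum' fun l _ => continuous_smul' _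
      (continuous_mul' (continuous_pow' (continuous_shift 0) _) (hcN _)))) fun m => ?_
  set d := weight s m with hd
  have hd0 : 0 < d := weight_pos hs m
  set w : Vec n → ℕ → Vec n := fun v k =>
    (k.factorial * rising d k)⁻¹ • (Qplus s ^ k) v with hw
  have hX : ∀ v k, Qplus s (w v k) = ((k + 1) * (d + k)) • w v (k + 1) := fun v k => by
    simp only [hw]
    rw [map_smul, ← Module.End.mul_apply, ← pow_succ', smul_smul, Nat.factorial_succ, rising_succ]
    have h1 : (k.factorial : ℝ) ≠ 0 := by exact_mod_cast k.factorial_ne_zero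
    have h2 : (k : ℝ) + 1 ≠ 0 := by positivity
    have h3 : rising d k ≠ 0 := (rising_pos hd0 k).ne'
    have h4 : d + k ≠ 0 := by positivity
    congr 1
    push_cast
    field_simp
  have h2 : ∀ u : Vec n, (2 : Module.End ℝ (Vec n)) u = (2 : ℝ) • u := fun u => by
    rw [← one_add_one_eq_two, LinearMap.add_apply, Module.End.one_apply, two_smul]
  have hD : ∀ k, diagOp (weight s) (w (ket m) k) = (d + 2 * k) • w (ket m) k := fun k => by
    simp only [hw]
    rw [map_smul, smul_comm]
    congr 1
    induction k with
    | zero => simp [diagOp_ket, hd]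
    | succ k ih =>
      have := LinearMap.congr_fun (diagOp_weight_mul_Qplus (s := s)) ((Qplus s ^ k) (ket m))
      rw [pow_succ', Module.End.mul_apply, ← Module.End.mul_apply (diagOp _), this,
        Module.End.mul_apply, LinearMap.add_apply, ih, h2, ← add_smul, map_smul]
      push_cast
      congr 1
      ring
  have hDE : ∀ (δ : ℝ) (u : Vec n), diagOp (weight s) u = δ • u → ∀ l : ℕ,
      diagOp (weight s) ((shift 0 ^ l) u) = (δ + 2 * l) • (shift 0 ^ l) u := fun δ u hu l => by
    induction l with
    | zero => simp [hu]
    | succ l ih =>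
      have := LinearMap.congr_fun (diagOp_weight_mul_shift (s := s) 0) ((shift 0 ^ l) u)
      rw [pow_succ', Module.End.mul_apply, ← Module.End.mul_apply (diagOp _), this,
        Module.End.mul_apply, LinearMap.add_apply, ih, h2, ← add_smul, map_smul]
      push_cast
      congr 1
      ring
  -- Commuting Q₊ past l shifts collects the sum of δ + 2j + 1 over j < l, which is l(δ + l).
  have hE : ∀ (δ : ℝ) (u : Vec n), diagOp (weight s) u = δ • u → ∀ l : ℕ,
      Qplus s ((shift 0 ^ l) u) =
        (shift 0 ^ l) (Qplus s u) + (l * (δ + l)) • (shift 0 ^ (l + 1)) u := fun δ u hu l => by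
    induction l with
    | zero => simp
    | succ l ih =>
      have := LinearMap.congr_fun (Qplus_mul_shift (s := s)) ((shift 0 ^ l) u)
      rw [pow_succ' (shift 0) l, Module.End.mul_apply, ← Module.End.mul_apply (Qplus s), this,
        LinearMap.add_apply, Module.End.mul_apply, ih, Module.End.mul_apply, Module.End.mul_apply,
        LinearMap.add_apply, hDE δ u hu l, Module.End.one_apply]
      simp only [map_add, map_smul, pow_succ', Module.End.mul_apply]
      push_cast
      module
  have h := exchange_relation (H := diagonalHamiltonian n s) (X := Qplus s) (E := shift 0)
    (w := w (ket m)) (w' := w (diagonalHamiltonian n s (ket m)))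
    (x := fun k => (k + 1) * (d + k)) (y := fun k l => d + 2 * k + l) (fun k => by positivity)
    (hX _) (hX _)
    (fun k => by
      have h1 : ∀ u, diagonalHamiltonian n s (Qplus s u) = Qplus s (diagonalHamiltonian n s u) +
          shift 0 (diagOp (weight s) u) :=
        fun u => LinearMap.congr_fun (diagonalHamiltonian_mul_Qplus hs) u
      rw [h1, hD, LinearMap.map_smul (shift 0), Nat.cast_zero, add_zero])
    (fun k l => by
      rw [hE _ _ (hD k), hX, map_smul]
      push_cast
      rfl)
    (by simp [hw]) (fun q l => by push_cast; ring) (fun k => by push_cast; ring) k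
  have hN : ∀ k, nonlocalCoeff s k (ket m) = w (ket m) k := fun k => nonlocalCoeff_ket hs k m
  -- The same d normalises both sequences, since the diagonal Hamiltonian preserves the particle
  -- number and hence the weight.
  have hN' : nonlocalCoeff s k (diagonalHamiltonian n s (ket m)) =
      w (diagonalHamiltonian n s (ket m)) k := by
    have hc : Commute (diagOp fun m : Config n => Real.Gamma (2 * (spinTot s m + s)) /
        Real.Gamma ((k : ℝ) + 2 * (spinTot s m + s))) (diagonalHamiltonian n s) :=
      (raises_diagonalHamiltonian n s).commute_diagOp (g := fun N =>
        Real.Gamma (2 * ((N + (n + 1) * s) + s)) /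
          Real.Gamma ((k : ℝ) + 2 * ((N + (n + 1) * s) + s))) fun m => by rw [spinTot_eq]
    have := LinearMap.congr_fun hc.eq (ket m)
    rw [Module.End.mul_apply, Module.End.mul_apply, diagOp_ket, map_smul,
      Gamma_div_Gamma hs] at this
    rw [nonlocalCoeff, LinearMap.smul_apply, Module.End.mul_apply, this, map_smul, smul_smul]
    simp only [hw, mul_inv, hd]
  rw [Module.End.mul_apply, hN, h, LinearMap.add_apply, Module.End.mul_apply, hN',
    LinearMap.sum_apply]
  congr 1
  refine Finset.sum_congr rfl fun l _ => ?_
  rw [LinearMap.smul_apply, Module.End.mul_apply, hN]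

/-- The nonlocal transformation as an everywhere defined operator. -/
def nonlocalEnd (s Δ : ℝ) : Module.End ℝ (Vec n) := gradedSum fun k => Δ ^ k • nonlocalCoeff s k

theorem nonlocalW_eq_total (s Δ : ℝ) :
    nonlocalW (n := n) s Δ = total (nonlocalEnd s Δ) := by
  rw [nonlocalEnd, ← seriesOp_eq_total fun k => (raises_nonlocalCoeff s k).smul _, nonlocalW]
  congr 1
  funext k
  rw [nonlocalCoeff, smul_smul, div_eq_mul_inv]

/-- The Hamiltonian in triangular form. -/
def hamiltonianForm (n : ℕ) (s a b : ℝ) : Module.End ℝ (Vec n) :=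
  boundaryForm s a 0 + ∑ i : Fin n, bulkEnd s i.castSucc i.succ + boundaryForm s b (Fin.last n)

theorem exp_mul_hamiltonianForm (hs : 0 < s) (a b c : ℝ) :
    gradedExp (c • SplusTot s) * hamiltonianForm n s a b =
      hamiltonianForm n s (a + c) (b + c) * gradedExp (c • SplusTot s) := by
  have : Commute (∑ i : Fin n, bulkEnd s i.castSucc i.succ) (SplusTot s) :=
    Commute.sum_left _ _ _ fun i _ => commute_bulkEnd_SplusTot hs Fin.castSucc_lt_succ.ne
  rw [hamiltonianForm, hamiltonianForm, mul_add, mul_add, add_mul, add_mul,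
    exp_mul_boundaryForm hs, exp_mul_boundaryForm hs,
    gradedExp_comm (Raises.sum fun _ _ => raises_bulkEnd _ _) (this.smul_right c)]

/-- The map `P` in triangular form. -/
def mapForm (n : ℕ) (s ρL ρR ρ : ℝ) : Module.End ℝ (Vec n) :=
  gradedExp (ρR • SplusTot s) * (nonlocalEnd s (ρL - ρR) * gradedExp (-(ρ • SplusTot s)))

/-- Densities are transported as (ρ, ρ) → (0, 0) → (ρ_L - ρ_R, 0) → (ρ_L, ρ_R): the outer arrows are
exponentials of `S₊^tot`, the middle one is the non-local transformation. -/
theorem hamiltonianForm_mul_mapForm (hs : 0 < s) (ρL ρR ρ : ℝ) :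
    hamiltonianForm n s ρL ρR * mapForm n s ρL ρR ρ =
      mapForm n s ρL ρR ρ * hamiltonianForm n s ρ ρ := by
  have h1 := exp_mul_hamiltonianForm (n := n) hs (ρL - ρR) 0 ρR
  have h2 := exp_mul_hamiltonianForm (n := n) hs ρ ρ (-ρ)
  rw [sub_add_cancel, zero_add] at h1
  rw [add_neg_cancel, ← neg_smul_end] at h2
  have h00 : hamiltonianForm n s 0 0 = diagonalHamiltonian n s := by
    rw [hamiltonianForm, boundaryForm_zero, boundaryForm_zero, diagonalHamiltonian]
  have h10 : hamiltonianForm n s (ρL - ρR) 0 =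
      diagonalHamiltonian n s - logShift (ρL - ρR) 0 := by
    rw [hamiltonianForm, boundaryForm_zero, boundaryForm, diagonalHamiltonian]
    abel
  have h3 : hamiltonianForm n s (ρL - ρR) 0 * nonlocalEnd s (ρL - ρR) =
      nonlocalEnd s (ρL - ρR) * diagonalHamiltonian n s := by
    rw [h10]
    exact sub_logShift_mul_gradedSum (raises_diagonalHamiltonian n s)
      (diagonalHamiltonian_mul_nonlocalCoeff hs)
  rw [mapForm, ← mul_assoc, ← h1, mul_assoc, ← mul_assoc (hamiltonianForm _ _ _ _), h3, mul_assoc,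
    mul_assoc, mul_assoc, h2, h00]

theorem mapForm_injective (hs : 0 < s) (ρL ρR ρ : ℝ) :
    Function.Injective (mapForm n s ρL ρR ρ) := by
  have hS : ∀ c : ℝ, Raises 1 (c • SplusTot (n := n) s) := fun c => (raises_SplusTot s).smul c
  have he : ∀ c : ℝ, Function.Injective (gradedExp (c • SplusTot (n := n) s)) := fun c =>
    gradedSum_injective (by simp) (hS c).exp_coeff
  have hw : Function.Injective (nonlocalEnd (n := n) s (ρL - ρR)) :=
    gradedSum_injective (by rw [pow_zero, one_smul, nonlocalCoeff_zero hs])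
      fun k => (raises_nonlocalCoeff s k).smul _
  rw [mapForm, neg_smul_end]
  exact (he ρR).comp (hw.comp (he (-ρ)))

/-! ## Vectors of exponential decay -/

theorem pow_size (q : ℝ) (m : Config n) : q ^ size m = ∏ i, q ^ m i := by
  rw [size, Finset.prod_pow_eq_pow_sum]

theorem summable_pow_size {q : ℝ} (h0 : 0 ≤ q) (h1 : q < 1) :
    Summable fun m : Config n => q ^ size m := by
  refine summable_of_sum_le (c := ∏ _i : Fin (n + 1), (1 - q)⁻¹) (fun m => by positivity) fun u => ?_
  set M := u.sup size
  have hu : u ⊆ Fintype.piFinset fun _ : Fin (n + 1) => range (M + 1) := fun m hm =>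
    mem_box_of_size_le (Finset.le_sup (f := size) hm)
  calc ∑ m ∈ u, q ^ size m ≤ ∑ m ∈ Fintype.piFinset fun _ : Fin (n + 1) => range (M + 1),
        q ^ size m := Finset.sum_le_sum_of_subset_of_nonneg hu fun _ _ _ => by positivity
    _ = ∏ _i : Fin (n + 1), ∑ k ∈ range (M + 1), q ^ k := by
        rw [Finset.prod_univ_sum]
        exact Finset.sum_congr rfl fun m _ => pow_size q m
    _ ≤ _ := by
        refine Finset.prod_le_prod (fun _ _ => Finset.sum_nonneg fun _ _ => by positivity)
          fun _ _ => ?_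
        rw [← tsum_geometric_of_lt_one h0 h1]
        exact (summable_geometric_of_lt_one h0 h1).sum_le_tsum _ fun _ _ => by positivity

/-- Splits a rate of decay R among several factors, so that growth can be absorbed and some decay
kept. -/
theorem exists_one_lt_pow_lt {R : ℝ} (hR : 1 < R) (k : ℕ) : ∃ t : ℝ, 1 < t ∧ t ^ k < R := by
  have h : ∀ᶠ t in nhds (1 : ℝ), t ^ k < R :=
    (continuous_pow k).continuousAt.eventually_lt_const (by simpa using hR)
  obtain ⟨t, h1, h2⟩ :=
    ((h.filter_mono (nhdsWithin_le_nhds (s := Set.Ioi 1))).and self_mem_nhdsWithin).exists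
  exact ⟨t, h2, h1⟩

/-- Functions of at most subexponential growth. -/
def SubExp (g : Config n → ℝ) : Prop := ∀ r : ℝ, 1 < r → ∃ C : ℝ, ∀ m, |g m| ≤ C * r ^ size m

theorem SubExp.exists_summable {g : Config n → ℝ} (hg : SubExp g) {v : Vec n}
    (hv : v ∈ decaying n) :
    ∃ r : ℝ, 1 < r ∧ Summable fun m => |g m| * |v m| * r ^ size m := by
  obtain ⟨R, hR, C, hC⟩ := hv
  -- One factor t pays for the growth of g and another for the weight kept in the conclusion; the
  -- ratio t²/R stays below one.
  obtain ⟨t, ht1, htR⟩ := exists_one_lt_pow_lt hR 3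
  have ht0 : 0 < t := by linarith
  obtain ⟨D, hD⟩ := hg t ht1
  refine ⟨t, ht1, ?_⟩
  have hq : t * t / R < 1 := by
    rw [div_lt_one (by linarith)]
    nlinarith [pow_pos ht0 2]
  have hq0 : 0 ≤ t * t / R := by positivity
  refine Summable.of_nonneg_of_le (fun m => by positivity) (fun m => ?_)
    ((summable_pow_size (n := n) hq0 hq).mul_left (D * C))
  have hR0 : 0 < R ^ size m := by positivity
  have h1 : |v m| ≤ C / R ^ size m := by
    rw [le_div_iff₀ hR0]
    exact hC m
  calc |g m| * |v m| * t ^ size m ≤ (D * t ^ size m) * (C / R ^ size m) * t ^ size m := by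
        gcongr
        · exact (abs_nonneg _).trans (hD m)
        · exact hD m
    _ = D * C * (t * t / R) ^ size m := by
        rw [div_pow, mul_pow]
        ring

theorem SubExp.summable {g : Config n → ℝ} (hg : SubExp g) {v : Vec n} (hv : v ∈ decaying n) :
    Summable fun m => g m * v m := by
  obtain ⟨r, hr, h⟩ := hg.exists_summable hv
  refine Summable.of_norm_bounded h fun m => ?_
  rw [Real.norm_eq_abs, abs_mul]
  exact le_mul_of_one_le_right (by positivity) (one_le_pow₀ hr.le)

/-! ## Exponentials of lowering operators -/

/-- The sum of the lowering operators over a set of sites. -/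
def lowering (F : Finset (Fin (n + 1))) : Module.End ℝ (Vec n) := ∑ i ∈ F, Sminus i

theorem lowering_univ : lowering (univ : Finset (Fin (n + 1))) = SminusTot := rfl

theorem lowering_singleton (i : Fin (n + 1)) : lowering {i} = Sminus i :=
  Finset.sum_singleton _ _

theorem continuous_lowering (F : Finset (Fin (n + 1))) : Continuous (lowering F) :=
  continuous_sum' fun i _ => continuous_Sminus i

/-- The matrix elements of the exponential of `lowering F`. -/
def binom (F : Finset (Fin (n + 1))) (j m : Config n) : ℝ :=
  ∏ i, if i ∈ F then ((m i).choose (j i) : ℝ) else if m i = j i then 1 else 0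

theorem binom_nonneg (F : Finset (Fin (n + 1))) (j m : Config n) : 0 ≤ binom F j m :=
  Finset.prod_nonneg fun i _ => by split_ifs <;> positivity

theorem choose_mul_pow_le {t : ℝ} (ht : 0 ≤ t) (a j : ℕ) :
    (a.choose j : ℝ) * t ^ j ≤ (1 + t) ^ a := by
  by_cases h : a < j
  · rw [Nat.choose_eq_zero_of_lt h]
    simp only [Nat.cast_zero, zero_mul]
    positivity
  · rw [add_comm, add_pow]
    have h := Finset.single_le_sum (f := fun k => t ^ k * 1 ^ (a - k) * (a.choose k : ℝ))
      (s := range (a + 1)) (fun k _ => by positivity) (a := j) (Finset.mem_range.2 (by omega))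
    simpa [mul_comm] using h

theorem binom_mul_pow_le (F : Finset (Fin (n + 1))) {t : ℝ} (ht : 0 ≤ t) (ht1 : t ≤ 1)
    (j m : Config n) : binom F j m * t ^ size j ≤ (1 + t) ^ size m := by
  rw [pow_size, pow_size, binom, ← Finset.prod_mul_distrib]
  refine Finset.prod_le_prod (fun i _ => by split_ifs <;> positivity) fun i _ => ?_
  have h1 : (1 : ℝ) ≤ (1 + t) ^ m i := one_le_pow₀ (by linarith)
  split_ifs
  · exact choose_mul_pow_le ht _ _
  · rw [one_mul]
    exact (pow_le_one₀ ht ht1).trans h1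
  · rw [zero_mul]
    linarith

/-- For fixed j a binomial coefficient grows polynomially; the bound C(a, j) t^j ≤ (1 + t)^a
expresses this with any base 1 + t. -/
theorem subExp_binom (F : Finset (Fin (n + 1))) (j : Config n) : SubExp (binom F j) := by
  intro r hr
  -- The cap at 1 is for the sites outside F, where t^{j_i} itself has to be at most one.
  set t := min (r - 1) 1 with htd
  have ht : 0 < t := lt_min (by linarith) one_pos
  refine ⟨(t ^ size j)⁻¹, fun m => ?_⟩
  rw [abs_of_nonneg (binom_nonneg F j m), inv_mul_eq_div, le_div_iff₀ (by positivity)]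
  refine (binom_mul_pow_le F ht.le (min_le_right _ _) j m).trans ?_
  have : t ≤ r - 1 := min_le_left _ _
  exact pow_le_pow_left₀ (by positivity) (by linarith) _

theorem binom_update_succ {F : Finset (Fin (n + 1))} {i : Fin (n + 1)} (hi : i ∈ F)
    (j m : Config n) :
    ((j i : ℝ) + 1) * binom F (Function.update j i (j i + 1)) m =
      ((m i : ℝ) - j i) * binom F j m := by
  rw [binom, binom, ← Finset.mul_prod_erase _ _ (Finset.mem_univ i),
    ← Finset.mul_prod_erase _ _ (Finset.mem_univ i), if_pos hi, if_pos hi, Function.update_self,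
    ← mul_assoc, ← mul_assoc]
  congr 1
  · by_cases h : j i ≤ m i
    · have := Nat.choose_succ_right_eq (m i) (j i)
      rw [← Nat.cast_sub h, mul_comm, mul_comm _ (((m i).choose (j i) : ℕ) : ℝ)]
      exact_mod_cast this
    · rw [Nat.choose_eq_zero_of_lt (by omega), Nat.choose_eq_zero_of_lt (by omega)]
      simp
  · refine Finset.prod_congr rfl fun l hl => ?_
    rw [Function.update_of_ne (Finset.ne_of_mem_erase hl)]

/-- Either m and j agree off F, so that these sites do not contribute to the difference of sizes, or
the matrix element vanishes. -/
theorem sum_sub_mul_binom (F : Finset (Fin (n + 1))) (j m : Config n) :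
    ∑ i ∈ F, ((m i : ℝ) - j i) * binom F j m = ((size m : ℝ) - size j) * binom F j m := by
  by_cases h : ∀ i ∉ F, m i = j i
  · rw [← Finset.sum_mul]
    congr 1
    rw [size, size, Nat.cast_sum, Nat.cast_sum, ← Finset.sum_sub_distrib]
    refine Finset.sum_subset (Finset.subset_univ F) fun i _ hi => ?_
    rw [h i hi, sub_self]
  · push Not at h
    obtain ⟨i, hi, hne⟩ := h
    have : binom F j m = 0 :=
      Finset.prod_eq_zero (Finset.mem_univ i) (by rw [if_neg hi, if_neg hne])
    simp [this]

theorem binom_eq_zero_of_size_lt (F : Finset (Fin (n + 1))) {j m : Config n}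
    (h : size m < size j) : binom F j m = 0 := by
  obtain ⟨i, -, hi⟩ := Finset.exists_lt_of_sum_lt h
  refine Finset.prod_eq_zero (Finset.mem_univ i) ?_
  rw [Nat.choose_eq_zero_of_lt hi, if_neg hi.ne]
  simp

/-- One more lowering step multiplies the matrix element by the sum over F of m_i - j_i, which is
the number k + 1 of particles removed. -/
theorem lowering_pow_ket (F : Finset (Fin (n + 1))) (k : ℕ) (m j : Config n) :
    (lowering F ^ k) (ket m) j =
      if size m = size j + k then (k.factorial : ℝ) * binom F j m else 0 := by
  induction k generalizing j with
  | zero =>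
    rw [pow_zero, Module.End.one_apply]
    by_cases h : j = m
    · subst h
      have : binom F j j = 1 := Finset.prod_eq_one fun i _ => by simp
      simp [ket, this]
    · have h0 : ket m j = 0 := by simp [ket, h]
      rw [h0]
      split_ifs with hs
      · obtain ⟨i, hi⟩ : ∃ i, m i < j i := by
          by_contra hc
          push Not at hc
          refine h (funext fun i => ?_)
          have := (Finset.sum_eq_sum_iff_of_le fun i _ => hc i).1 (by
            simpa [size] using hs.symm : ∑ i, j i = ∑ i, m i)
          exact this i (Finset.mem_univ i)
        have : binom F j m = 0 := by
          refine Finset.prod_eq_zero (Finset.mem_univ i) ?_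
          rw [Nat.choose_eq_zero_of_lt hi, if_neg hi.ne]
          simp
        simp [this]
      · rfl
  | succ k ih =>
    rw [pow_succ', Module.End.mul_apply, lowering, LinearMap.sum_apply, Finset.sum_apply]
    have h1 : ∀ i ∈ F, Sminus i ((lowering F ^ k) (ket m)) j =
        if size m = size j + (k + 1) then
          (k.factorial : ℝ) * (((m i : ℝ) - j i) * binom F j m) else 0 := fun i hi => by
      change ((j i : ℝ) + 1) * (lowering F ^ k) (ket m) (Function.update j i (j i + 1)) = _
      have hsz := size_update j i (j i + 1)
      rw [ih, show size (Function.update j i (j i + 1)) + k = size j + (k + 1) by omega]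
      split_ifs
      · rw [← binom_update_succ hi]
        ring
      · rw [mul_zero]
    rw [lowering] at h1
    rw [Finset.sum_congr rfl h1]
    split_ifs with hs
    · rw [← Finset.mul_sum, sum_sub_mul_binom, hs, Nat.factorial_succ]
      push_cast
      ring
    · simp

/-- The exponential of `lowering F` on vectors of exponential decay. -/
def lowered (F : Finset (Fin (n + 1))) (v : Vec n) : Vec n := fun j => ∑' m, binom F j m * v m

theorem lowering_pow_apply (F : Finset (Fin (n + 1))) (v : Vec n) (k : ℕ) (j : Config n) :
    HasSum (fun m => if size m = size j + k then binom F j m * v m else 0)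
      ((((k.factorial : ℝ)⁻¹) • lowering F ^ k) v j) := by
  have h := (Pi.hasSum.1 (hasSum_apply_ket (continuous_pow' (continuous_lowering F) k) v) j).mul_left
    ((k.factorial : ℝ)⁻¹)
  convert! h using 1
  funext m
  have h1 : (k.factorial : ℝ) ≠ 0 := by exact_mod_cast k.factorial_ne_zero
  rw [Pi.smul_apply, smul_eq_mul, lowering_pow_ket]
  split_ifs
  · field_simp
  · simp

/-- The exponential series is the absolutely convergent binomial sum grouped by the number of
removed particles. -/
theorem hasSum_lowering (F : Finset (Fin (n + 1))) {v : Vec n} (hv : v ∈ decaying n)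
    (j : Config n) :
    HasSum (fun k : ℕ => (((k.factorial : ℝ)⁻¹) • lowering F ^ k) v j) (lowered F v j) := by
  -- Truncated subtraction puts every m with size m < size j into the fibre of 0; their matrix
  -- elements vanish.
  have h := ((subExp_binom F j).summable hv).hasSum.tsum_fiberwise fun m => size m - size j
  convert! h using 1
  funext k
  rw [← (lowering_pow_apply F v k j).tsum_eq,
    tsum_subtype ((fun m : Config n => size m - size j) ⁻¹' {k}) fun m => binom F j m * v m]
  refine tsum_congr fun m => ?_
  by_cases hm : size m = size j + k
  · rw [if_pos hm, Set.indicator_of_mem]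
    simp [hm]
  · rw [if_neg hm]
    by_cases hm' : size m - size j = k
    · rw [Set.indicator_of_mem (by exact hm'), binom_eq_zero_of_size_lt F (by omega), zero_mul]
    · rw [Set.indicator_of_notMem (by exact hm')]

/-- Exponential decay gives each coordinate of t ↦ e^{tA} v, with A the lowering operator, a radius
of convergence larger than one, as needed for injectivity at t = 1. -/
theorem lowering_pow_bound (F : Finset (Fin (n + 1))) {v : Vec n} (hv : v ∈ decaying n)
    (j : Config n) : ∃ r : ℝ, 1 < r ∧ ∃ C : ℝ, ∀ k : ℕ,
      |(((k.factorial : ℝ)⁻¹) • lowering F ^ k) v j| * r ^ k ≤ C := by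
  obtain ⟨r, hr, h⟩ := (subExp_binom F j).exists_summable hv
  refine ⟨r, hr, ∑' m, |binom F j m| * |v m| * r ^ size m, fun k => ?_⟩
  have hk := lowering_pow_apply F v k j
  have h0 : (0 : ℝ) ≤ r := by linarith
  rw [← abs_of_nonneg (pow_nonneg h0 k), ← abs_mul]
  have hk' := hk.mul_right (r ^ k)
  rw [← Real.norm_eq_abs]
  refine hk'.norm_le_of_bounded h.hasSum fun m => ?_
  split_ifs with hm
  · rw [Real.norm_eq_abs, abs_mul, abs_mul, abs_of_nonneg (pow_nonneg h0 k)]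
    gcongr
    · exact hr.le
    · omega
  · rw [zero_mul, norm_zero]
    positivity

theorem expDec_domain (F : Finset (Fin (n + 1))) : (expDec (lowering F)).domain = decaying n := by
  change decaying n ⊓ (expOp (lowering F)).domain = decaying n
  exact inf_eq_left.2 fun v hv j => (hasSum_lowering F hv j).summable

theorem expDec_apply (F : Finset (Fin (n + 1))) (v : (expDec (lowering F)).domain) :
    expDec (lowering F) v = lowered F v := by
  have hv : (v : Vec n) ∈ decaying n := (expDec_domain F) ▸ v.2
  funext j
  exact (hasSum_lowering F hv j).tsum_eq

/-! ## Injectivity -/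

/-- A power series of radius of convergence larger than one is determined by its Taylor
coefficients at one. -/
theorem eq_zero_of_tsum_choose_mul_eq_zero {a : ℕ → ℝ} {r C : ℝ} (hr : 1 < r)
    (ha : ∀ k, |a k| * r ^ k ≤ C) (h : ∀ l : ℕ, ∑' k : ℕ, (k.choose l : ℝ) * a k = 0) : a = 0 := by
  have hr0 : 0 < r := by linarith
  set p := FormalMultilinearSeries.ofScalars ℝ a with hp
  have hrad : ENNReal.ofReal r ≤ p.radius := by
    refine p.le_radius_of_bound C fun k => ?_
    rw [hp, FormalMultilinearSeries.ofScalars_norm, Real.norm_eq_abs, Real.coe_toNNReal r hr0.le]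
    exact ha k
  have hpos : 0 < ENNReal.ofReal r := ENNReal.ofReal_pos.2 hr0
  have hball : HasFPowerSeriesOnBall p.sum p 0 (ENNReal.ofReal r) :=
    (p.hasFPowerSeriesOnBall (hpos.trans_le hrad)).mono hpos hrad
  have hsum : ∀ x, p.sum x = ∑' k, a k * x ^ k := fun x => by
    rw [FormalMultilinearSeries.sum]
    refine tsum_congr fun k => ?_
    rw [hp, FormalMultilinearSeries.ofScalars_apply_eq, smul_eq_mul]
  have hU : Metric.eball (0 : ℝ) (ENNReal.ofReal r) = Metric.ball 0 r := Metric.eball_ofReal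
  have hanal : AnalyticOnNhd ℝ p.sum (Metric.ball 0 r) := by
    rw [← hU]
    exact hball.analyticOnNhd
  -- Expanding (1 + t)^k and exchanging the sums writes the series near 1 through its Taylor
  -- coefficients there, which vanish. The double series converges absolutely because 1 + |t| < r.
  have hnear : ∀ t : ℝ, |t| < r - 1 → p.sum (1 + t) = 0 := fun t ht => by
    rw [hsum]
    have hq : (1 + |t|) / r < 1 := (div_lt_one hr0).2 (by linarith)
    have hgeo := (summable_geometric_of_lt_one (by positivity) hq).mul_left C
    have hF : Summable (Function.uncurry fun k l : ℕ => a k * ((k.choose l : ℝ) * t ^ l)) := by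
      have hpw : ∀ k, HasSum (fun l : ℕ => |a k * ((k.choose l : ℝ) * t ^ l)|)
          (|a k| * (1 + |t|) ^ k) := fun k => by
        have e : |a k| * (1 + |t|) ^ k =
            ∑ l ∈ range (k + 1), |a k * ((k.choose l : ℝ) * t ^ l)| := by
          rw [add_comm (1 : ℝ), add_pow, Finset.mul_sum]
          refine Finset.sum_congr rfl fun l _ => ?_
          rw [abs_mul, abs_mul, abs_pow, Nat.abs_cast]
          ring
        rw [e]
        refine hasSum_sum_of_ne_finset_zero fun l hl => ?_
        rw [Nat.choose_eq_zero_of_lt (by simpa using hl)]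
        simp
      refine Summable.of_abs ((summable_prod_of_nonneg fun _ => abs_nonneg _).2
        ⟨fun k => (hpw k).summable, ?_⟩)
      refine Summable.of_nonneg_of_le (fun k => tsum_nonneg fun _ => abs_nonneg _) (fun k => ?_) hgeo
      rw [show ∑' l, |Function.uncurry (fun k l : ℕ => a k * ((k.choose l : ℝ) * t ^ l)) (k, l)| =
        |a k| * (1 + |t|) ^ k from (hpw k).tsum_eq, div_pow, mul_div_assoc',
        le_div_iff₀ (by positivity), mul_right_comm]
      exact mul_le_mul_of_nonneg_right (ha k) (by positivity)
    have h1 : ∀ k, a k * (1 + t) ^ k = ∑' l : ℕ, a k * ((k.choose l : ℝ) * t ^ l) := fun k => by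
      rw [tsum_mul_left, tsum_eq_sum (s := range (k + 1))]
      · rw [add_comm (1 : ℝ), add_pow]
        congr 1
        exact Finset.sum_congr rfl fun l _ => by ring
      · intro l hl
        rw [Nat.choose_eq_zero_of_lt (by simpa using hl)]
        simp
    rw [tsum_congr h1, ← hF.tsum_comm]
    rw [tsum_congr (g := fun _ => (0 : ℝ)), tsum_zero]
    intro l
    have : ∀ k, a k * ((k.choose l : ℝ) * t ^ l) = ((k.choose l : ℝ) * a k) * t ^ l := fun k => by
      ring
    rw [tsum_congr this, tsum_mul_right, h, zero_mul]
  have hev : p.sum =ᶠ[nhds 1] 0 := by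
    filter_upwards [Metric.ball_mem_nhds (1 : ℝ) (by linarith : 0 < r - 1)] with x hx
    have := hnear (x - 1) (by simpa [Real.dist_eq] using hx)
    simpa using this
  -- The point 1 lies inside the ball of convergence, so the identity theorem carries the vanishing
  -- near 1 back to the centre.
  have hzero := hanal.eqOn_zero_of_preconnected_of_eventuallyEq_zero
    (convex_ball (0 : ℝ) r).isPreconnected
    (by simpa using hr : (1 : ℝ) ∈ Metric.ball 0 r) hev
  have hev0 : p.sum =ᶠ[nhds 0] 0 := by
    filter_upwards [Metric.ball_mem_nhds (0 : ℝ) hr0] with x hx using hzero hx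
  have hp0 := hball.hasFPowerSeriesAt.eq_zero_of_eventually hev0
  exact (FormalMultilinearSeries.ofScalars_series_eq_zero ℝ).1 hp0

/-- Let a_k be the coefficient of t^k in a coordinate of e^{tA} v, with A the lowering operator. If
e^A v = 0 then A^l e^A v / l! = 0 for all l, that is Σ_k C(k, l) a_k = 0: all Taylor coefficients at
t = 1 vanish, so a_0, the coordinate of v, is zero. -/
theorem lowered_eq_zero (F : Finset (Fin (n + 1))) {v : Vec n} (hv : v ∈ decaying n)
    (h : lowered F v = 0) : v = 0 := by
  funext j
  obtain ⟨r, hr, C, hC⟩ := lowering_pow_bound F hv j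
  have key := eq_zero_of_tsum_choose_mul_eq_zero hr hC fun l => ?_
  · simpa using congrFun key 0
  have hs : HasSum (fun k : ℕ => (((k.factorial : ℝ)⁻¹) • lowering F ^ k) v) (lowered F v) :=
    Pi.hasSum.2 fun j => hasSum_lowering F hv j
  -- The exponential series converges coordinatewise and powers of the lowering operator are
  -- continuous, so they may be applied term by term even if the sum no longer decays.
  have hl := hs.map (lowering F ^ l).toAddMonoidHom (continuous_pow' (continuous_lowering F) l)
  rw [h] at hl
  have hl' := (Pi.hasSum.1 hl j).mul_left ((l.factorial : ℝ)⁻¹)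
  have hshift : HasSum (fun k : ℕ => ((k + l).choose l : ℝ) *
      (((k + l).factorial : ℝ)⁻¹ • lowering F ^ (k + l)) v j) 0 := by
    convert! hl' using 1
    · funext k
      have h1 : (k.factorial : ℝ) ≠ 0 := by exact_mod_cast k.factorial_ne_zero
      have h2 : (l.factorial : ℝ) ≠ 0 := by exact_mod_cast l.factorial_ne_zero
      have h3 : ((k + l).factorial : ℝ) ≠ 0 := by exact_mod_cast (k + l).factorial_ne_zero
      have h4 : (k + l).choose l * k.factorial * l.factorial = (k + l).factorial := by
        rw [← Nat.add_choose_mul_factorial_mul_factorial k l]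
      have h6 : ((k + l).choose l : ℝ) ≠ 0 := by
        exact_mod_cast (Nat.choose_pos (Nat.le_add_left l k)).ne'
      have h5 : ((k + l).choose l : ℝ) * k.factorial * l.factorial = (k + l).factorial := by
        exact_mod_cast h4
      simp only [Function.comp_apply, LinearMap.toAddMonoidHom_coe, LinearMap.smul_apply, map_smul,
        Pi.smul_apply, smul_eq_mul]
      rw [← Module.End.mul_apply, ← pow_add, add_comm l k, ← h5]
      field_simp
    · simp
  have hall : HasSum (fun k : ℕ => (k.choose l : ℝ) *
      (((k.factorial : ℝ)⁻¹) • lowering F ^ k) v j) 0 := by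
    rw [← hasSum_nat_add_iff' l]
    rw [Finset.sum_eq_zero, sub_zero]
    · exact hshift
    · intro k hk
      rw [Nat.choose_eq_zero_of_lt (Finset.mem_range.1 hk), Nat.cast_zero, zero_mul]
  exact hall.tsum_eq

theorem ker_expDec (F : Finset (Fin (n + 1))) :
    LinearMap.ker (expDec (lowering F)).toFun = ⊥ := by
  rw [LinearMap.ker_eq_bot']
  intro v hv
  have h1 : lowered F v = 0 := by
    rw [← expDec_apply]
    exact hv
  exact Subtype.ext (lowered_eq_zero F ((expDec_domain F) ▸ v.2) h1)

/-! ## Binomial identities for the boundary terms -/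

/-- Marking j of the particles that stay behind shifts the spin from s to s + j/2 in the rate of the
unmarked ones. -/
theorem rate_mul_choose (hs : 0 < s) {k : ℕ} (hk : 1 ≤ k) (j r : ℕ) :
    rate s k (k + (j + r)) * ((j + r).choose j : ℝ) =
      ((k + (j + r)).choose j : ℝ) * rate (s + j / 2) k (k + r) := by
  have hj : (0 : ℝ) ≤ (j : ℝ) / 2 := by positivity
  have hc : ∀ r : ℕ, ((j + r).choose j : ℝ) = (j + r).factorial / (j.factorial * r.factorial) :=
    fun r => by
      rw [Nat.choose_symm_add, Nat.add_choose,
        Nat.cast_div (Nat.factorial_mul_factorial_dvd_factorial_add _ _) (by positivity)]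
      push_cast
      rfl
  rw [rate_add hs hk, rate_add (by linarith) hk,
    show 2 * (s + (j : ℝ) / 2) + r = 2 * s + ((j + r : ℕ) : ℝ) by push_cast; ring,
    rising_natCast, rising_natCast, show k + (j + r) = j + (r + k) by ring, hc, hc,
    show j + r + k = j + (r + k) by ring]
  have h1 : rising (2 * s + ((j + r : ℕ) : ℝ)) k ≠ 0 := (rising_pos (by positivity) k).ne'
  field_simp

/-- Removal of particles is diagonal on binomial moments: by `rate_mul_choose` the second sum is
C(m, j) times the harmonic number of m - j at spin s + j/2, and its difference to h_s(m) is h_s(j).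
-/
theorem sum_rate_mul_choose (hs : 0 < s) (m j : ℕ) :
    ∑ k ∈ Icc 1 m, rate s k m * ((m.choose j : ℝ) - ((m - k).choose j : ℝ)) =
      harmonicNumber s j * (m.choose j : ℝ) := by
  rcases lt_or_ge m j with h | h
  · rw [Nat.choose_eq_zero_of_lt h, Nat.cast_zero, mul_zero]
    refine Finset.sum_eq_zero fun k _ => ?_
    rw [Nat.choose_eq_zero_of_lt (by omega), Nat.cast_zero, sub_zero, mul_zero]
  obtain ⟨r, rfl⟩ := Nat.exists_eq_add_of_le h
  have h1 : ∑ k ∈ Icc 1 (j + r), rate s k (j + r) * ((j + r - k).choose j : ℝ) =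
      ((j + r).choose j : ℝ) * harmonicNumber (s + j / 2) r := by
    rw [harmonicNumber, Finset.mul_sum]
    symm
    refine Finset.sum_subset_zero_on_sdiff (Finset.Icc_subset_Icc_right (by omega))
      (fun k hk => ?_) fun k hk => ?_
    · rw [Finset.mem_sdiff, Finset.mem_Icc, Finset.mem_Icc] at hk
      rw [Nat.choose_eq_zero_of_lt (by omega), Nat.cast_zero, mul_zero]
    · rw [Finset.mem_Icc] at hk
      obtain ⟨t, rfl⟩ := Nat.exists_eq_add_of_le hk.2
      rw [show j + (k + t) = k + (j + t) by ring, Nat.add_sub_cancel_left,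
        rate_mul_choose hs hk.1]
  simp only [mul_sub, Finset.sum_sub_distrib]
  rw [h1, ← Finset.sum_mul, ← harmonicNumber, harmonicNumber_add hs j r]
  ring

/-- Absorption C(k+1, l)/(k+1) = C(k, l-1)/l reduces this to the negative binomial series. This is
where β turns into the density β/(1-β). -/
theorem hasSum_pow_div_mul_choose {β : ℝ} (h0 : 0 < β) (h1 : β < 1) {l : ℕ} (hl : 1 ≤ l) :
    HasSum (fun k : ℕ => β ^ (k + 1) / ((k : ℝ) + 1) * ((k + 1).choose l : ℝ))
      ((β / (1 - β)) ^ l / l) := by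
  obtain ⟨r, rfl⟩ := Nat.exists_eq_add_of_le' hl
  have h := (hasSum_choose_mul_geometric_of_norm_lt_one r (r := β)
    (by rwa [Real.norm_of_nonneg h0.le])).mul_left (β ^ (r + 1) / ((r + 1 : ℕ) : ℝ))
  have hz : ∑ k ∈ range r, β ^ (k + 1) / ((k : ℝ) + 1) * ((k + 1).choose (r + 1) : ℝ) = 0 :=
    Finset.sum_eq_zero fun k hk => by
      rw [Nat.choose_eq_zero_of_lt (by simpa using hk), Nat.cast_zero, mul_zero]
  rw [← hasSum_nat_add_iff' r, hz, sub_zero]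
  convert! h using 1
  · funext k
    have h2 := Nat.add_one_mul_choose_eq (k + r) r
    have h3 : (((k + r : ℕ) : ℝ) + 1) * ((k + r).choose r : ℝ) =
      ((k + r + 1).choose (r + 1) : ℝ) * ((r : ℝ) + 1) := by exact_mod_cast h2
    have h4 : ((k + r + 1).choose (r + 1) : ℝ) =
      (((k + r : ℕ) : ℝ) + 1) * ((k + r).choose r : ℝ) / ((r : ℝ) + 1) := by
      rw [h3]; field_simp
    rw [h4]
    push_cast
    have h5 : (k : ℝ) + r + 1 ≠ 0 := by positivity
    field_simp
    ring
  · have : 1 - β ≠ 0 := by linarith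
    rw [div_pow]
    field_simp

/-- Vandermonde's identity; the subtracted binomial is its l = 0 term, so only l ≥ 1 remains. -/
theorem hasSum_pow_div_mul_choose_sub {β : ℝ} (h0 : 0 < β) (h1 : β < 1) (m j : ℕ) :
    HasSum (fun k : ℕ => β ^ (k + 1) / ((k : ℝ) + 1) *
        (((m + (k + 1)).choose j : ℝ) - (m.choose j : ℝ)))
      (∑ l ∈ Icc 1 j, (β / (1 - β)) ^ l / l * (m.choose (j - l) : ℝ)) := by
  have h := hasSum_sum fun l (hl : l ∈ Icc 1 j) =>
    (hasSum_pow_div_mul_choose h0 h1 (Finset.mem_Icc.1 hl).1).mul_right (m.choose (j - l) : ℝ)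
  convert! h using 1
  funext k
  have h2 : (m + (k + 1)).choose j = ∑ l ∈ range (j + 1), (k + 1).choose l * m.choose (j - l) := by
    rw [add_comm m, Nat.add_choose_eq, Finset.Nat.sum_antidiagonal_eq_sum_range_succ_mk]
  rw [h2, Finset.sum_range_succ', Finset.range_eq_Ico, Finset.sum_Ico_add'
    (fun l => (k + 1).choose l * m.choose (j - l)) 0 j 1, Nat.choose_zero_right, one_mul,
    Nat.sub_zero, Nat.cast_add, add_sub_cancel_right, Nat.cast_sum, Finset.mul_sum]
  refine Finset.sum_congr (by ext; simp) fun l _ => ?_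
  push_cast
  ring

theorem summable_pow_div {β : ℝ} (h0 : 0 ≤ β) (h1 : β < 1) :
    Summable fun k : ℕ => β ^ (k + 1) / ((k : ℝ) + 1) := by
  refine Summable.of_nonneg_of_le (fun k => by positivity) (fun k => ?_)
    ((summable_nat_add_iff 1).2 (summable_geometric_of_lt_one h0 h1))
  exact div_le_self (by positivity) (by linarith [Nat.cast_nonneg (α := ℝ) k])

/-! ## Infinite matrices with tame columns -/

/-- Columns that decay exponentially, with norms of arbitrarily small exponential growth. -/
def Tame (col : Config n → Vec n) : Prop :=
  ∀ r : ℝ, 1 < r → ∃ r' : ℝ, 1 < r' ∧ ∃ C : ℝ, ∀ m,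
    (Summable fun p => |col m p| * r' ^ size p) ∧
      ∑' p, |col m p| * r' ^ size p ≤ C * r ^ size m

theorem Tame.exists_summable {col : Config n → Vec n} (h : Tame col) {v : Vec n}
    (hv : v ∈ decaying n) :
    ∃ r : ℝ, 1 < r ∧ Summable fun x : Config n × Config n =>
      |col x.1 x.2| * |v x.1| * r ^ size x.2 := by
  obtain ⟨R, hR, C, hC⟩ := hv
  obtain ⟨t, ht1, htR⟩ := exists_one_lt_pow_lt hR 1
  rw [pow_one] at htR
  obtain ⟨r, hr, D, hD⟩ := h t ht1
  have ht0 : 0 < t := by linarith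
  have hR0 : 0 < R := by linarith
  refine ⟨r, hr, ?_⟩
  have he : ∀ m p, |col m p| * |v m| * r ^ size p = |v m| * (|col m p| * r ^ size p) :=
    fun m p => by ring
  rw [summable_prod_of_nonneg fun x => by
    have : 0 < r := by linarith
    positivity]
  simp only [he]
  refine ⟨fun m => (hD m).1.mul_left _, ?_⟩
  simp only [tsum_mul_left]
  have hq : t / R < 1 := (div_lt_one hR0).2 htR
  refine Summable.of_nonneg_of_le (fun m => mul_nonneg (abs_nonneg _) (tsum_nonneg fun p => by
    have : 0 < r := by linarith
    positivity)) (fun m => ?_)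
    ((summable_pow_size (n := n) (div_nonneg ht0.le hR0.le) hq).mul_left (C * D))
  have h1 : |v m| ≤ C / R ^ size m := by
    rw [le_div_iff₀ (by positivity)]
    exact hC m
  calc |v m| * ∑' p, |col m p| * r ^ size p ≤ C / R ^ size m * (D * t ^ size m) :=
        mul_le_mul h1 (hD m).2 (tsum_nonneg fun p => by
          have : 0 < r := by linarith
          positivity) ((abs_nonneg _).trans h1)
    _ = C * D * (t / R) ^ size m := by
        rw [div_pow]
        ring

theorem Tame.summable_apply {col : Config n → Vec n} (h : Tame col) {v : Vec n}
    (hv : v ∈ decaying n) (p : Config n) : Summable fun m => col m p * v m := by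
  obtain ⟨r, hr, hs⟩ := h.exists_summable hv
  have h1 := (hs.prod_symm.prod_factor p)
  refine Summable.of_norm_bounded h1 fun m => ?_
  rw [Real.norm_eq_abs, abs_mul]
  exact le_mul_of_one_le_right (by positivity) (one_le_pow₀ hr.le)

theorem Tame.domain_matrixOp {col : Config n → Vec n} (h : Tame col) :
    (matrixOp col).domain = decaying n :=
  le_antisymm (fun _ hv => hv.1) fun _ hv => ⟨hv, h.summable_apply hv⟩

theorem Tame.matrixOp_mem {col : Config n → Vec n} (h : Tame col) (v : (matrixOp col).domain) :
    matrixOp col v ∈ decaying n := by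
  obtain ⟨r, hr, hs⟩ := h.exists_summable v.2.1
  have hr0 : 0 < r := by linarith
  refine ⟨r, hr, ∑' x : Config n × Config n, |col x.1 x.2| * |(v : Vec n) x.1| * r ^ size x.2,
    fun p => ?_⟩
  have h1 := hs.prod_symm.prod_factor p
  have h2 : Summable fun m => |col m p * (v : Vec n) m| := (h.summable_apply v.2.1 p).abs
  calc |matrixOp col v p| * r ^ size p ≤ (∑' m, |col m p * (v : Vec n) m|) * r ^ size p := by
        refine mul_le_mul_of_nonneg_right ?_ (by positivity)
        have := norm_tsum_le_tsum_norm (f := fun m => col m p * (v : Vec n) m) h2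
        exact this
    _ = ∑' m, |col m p| * |(v : Vec n) m| * r ^ size p := by
        rw [← tsum_mul_right]
        simp only [abs_mul]
    _ ≤ ∑' x : Config n × Config n, |col x.1 x.2| * |(v : Vec n) x.1| * r ^ size x.2 := by
        have h3 := h1.tsum_le_tsum_of_inj (g := fun x : Config n × Config n =>
          |col x.1 x.2| * |(v : Vec n) x.1| * r ^ size x.2) (fun m : Config n => (m, p))
          (fun a b hab => (Prod.mk.inj hab).1) (fun c _ => by positivity) (fun _ => le_rfl) hs
        exact h3

/-- Fubini: the decay of v and of the columns beats the growth of f. It allows the binomial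
transform of the image to be computed column by column. -/
theorem Tame.tsum_mul_matrixOp {col : Config n → Vec n} (h : Tame col) {f : Config n → ℝ}
    (hf : SubExp f) (v : (matrixOp col).domain) :
    ∑' p, f p * matrixOp col v p = ∑' m, (∑' p, f p * col m p) * (v : Vec n) m := by
  obtain ⟨r, hr, hs⟩ := h.exists_summable v.2.1
  obtain ⟨C, hC⟩ := hf r hr
  have h1 : Summable (Function.uncurry fun m p => f p * (col m p * (v : Vec n) m)) := by
    refine Summable.of_norm_bounded (hs.mul_left C) fun x => ?_
    rw [Function.uncurry, Real.norm_eq_abs, abs_mul, abs_mul]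
    calc _ ≤ C * r ^ size x.2 * (|col x.1 x.2| * |(v : Vec n) x.1|) := by
          gcongr
          exact hC _
      _ = _ := by ring
  calc ∑' p, f p * matrixOp col v p = ∑' p, ∑' m, f p * (col m p * (v : Vec n) m) := by
        refine tsum_congr fun p => ?_
        rw [tsum_mul_left]
        rfl
    _ = ∑' m, ∑' p, f p * (col m p * (v : Vec n) m) := h1.tsum_comm
    _ = _ := by
        refine tsum_congr fun m => ?_
        rw [← tsum_mul_right]
        exact tsum_congr fun p => by ring

/-! ## The columns of the Hamiltonian -/

theorem hasSum_mul_ket (g : Config n → ℝ) (q : Config n) :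
    HasSum (fun p => g p * ket q p) (g q) := by
  have h := hasSum_single (f := fun p => g p * ket q p) q fun p hp => by simp [ket, hp]
  simpa [ket] using h

theorem ket_nonneg (q p : Config n) : 0 ≤ ket q p := by
  rw [ket, Pi.single_apply]
  split_ifs <;> norm_num

/-- A tail `∑ₖ z k |m + (k + 1) δ_i⟩`, whose `p`-th entry has a single nonzero summand. -/
def tailCol (i : Fin (n + 1)) (m : Config n) (z : ℕ → ℝ) : Vec n := fun p =>
  z (p i - m i - 1) * ket (put m i (p i - m i - 1 + 1)) p

theorem tsum_mul_ket_put (i : Fin (n + 1)) (m : Config n) (z : ℕ → ℝ) (p : Config n) :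
    ∑' k : ℕ, z k * ket (put m i (k + 1)) p = tailCol i m z p := by
  refine tsum_eq_single _ fun k hk => ?_
  have : p ≠ put m i (k + 1) := by
    rintro rfl
    apply hk
    rw [put, Function.update_self]
    omega
  simp [ket, this]

theorem hasSum_mul_tailCol {g : Config n → ℝ} {i : Fin (n + 1)} {m : Config n} {z : ℕ → ℝ} {Z : ℝ}
    (h : HasSum (fun k => g (put m i (k + 1)) * z k) Z) :
    HasSum (fun p => g p * tailCol i m z p) Z := by
  have hinj : Function.Injective fun k : ℕ => put m i (k + 1) := fun a b hab => by
    have := congrFun hab i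
    simp only [put, Function.update_self] at this
    omega
  rw [← hinj.hasSum_iff]
  · convert! h using 1
    funext k
    have : put m i (k + 1) i - m i - 1 = k := by
      rw [put, Function.update_self]
      omega
    simp only [Function.comp_apply, tailCol, this]
    simp [ket]
  · intro p hp
    have : p ≠ put m i (p i - m i - 1 + 1) := fun h => hp ⟨_, h.symm⟩
    simp [tailCol, ket, this]

/-- The columns of the boundary term. -/
def boundaryCol (s β : ℝ) (i : Fin (n + 1)) (m : Config n) : Vec n :=
  (harmonicNumber s (m i) + ∑' k : ℕ, β ^ (k + 1) / ((k : ℝ) + 1)) • ket m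
    - ∑ k ∈ Icc 1 (m i), rate s k (m i) • ket (take m i k)
    - tailCol i m fun k => β ^ (k + 1) / ((k : ℝ) + 1)

theorem boundary_eq (s β : ℝ) (i : Fin (n + 1)) :
    boundary s β i = matrixOp (boundaryCol s β i) := by
  rw [boundary]
  congr 1
  funext m
  rw [boundaryCol]
  congr 1
  funext p
  exact tsum_mul_ket_put i m _ p

theorem hasSum_mul_boundaryCol (s β : ℝ) {g : Config n → ℝ} {i : Fin (n + 1)} {m : Config n} {Z : ℝ}
    (h : HasSum (fun k : ℕ => g (put m i (k + 1)) * (β ^ (k + 1) / ((k : ℝ) + 1))) Z) :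
    HasSum (fun p => g p * boundaryCol s β i m p)
      ((harmonicNumber s (m i) + ∑' k : ℕ, β ^ (k + 1) / ((k : ℝ) + 1)) * g m
        - ∑ k ∈ Icc 1 (m i), rate s k (m i) * g (take m i k) - Z) := by
  have h1 := (((hasSum_mul_ket g m).mul_left
    (harmonicNumber s (m i) + ∑' k : ℕ, β ^ (k + 1) / ((k : ℝ) + 1))).sub
    (hasSum_sum fun k (_ : k ∈ Icc 1 (m i)) =>
      (hasSum_mul_ket g (take m i k)).mul_left (rate s k (m i)))).sub (hasSum_mul_tailCol h)
  convert! h1 using 1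
  funext p
  rw [boundaryCol, Pi.sub_apply, Pi.sub_apply, Finset.sum_apply, mul_sub, mul_sub, Finset.mul_sum]
  simp only [Pi.smul_apply, smul_eq_mul]
  congr 2
  · ring
  · exact Finset.sum_congr rfl fun k _ => by ring

/-- By Bernoulli's inequality a factor linear in size m is dominated by t^(size m) for any t > 1. -/
theorem Tame.of_linear {col : Config n → Vec n} {R : ℝ} (hR : 1 < R)
    (h : ∀ r : ℝ, 1 < r → r < R → ∃ a b : ℝ, 0 ≤ a ∧ 0 ≤ b ∧ ∀ m,
      (Summable fun p => |col m p| * r ^ size p) ∧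
        ∑' p, |col m p| * r ^ size p ≤ (a * size m + b) * r ^ size m) : Tame col := by
  intro r hr
  -- One factor t is the weight on the columns, the other absorbs the linear factor.
  obtain ⟨t, ht1, ht⟩ := exists_one_lt_pow_lt (lt_min hr hR) 2
  have htr : t ^ 2 ≤ r := (ht.trans_le (min_le_left _ _)).le
  obtain ⟨a, b, ha, hb, hab⟩ := h t ht1 (by nlinarith [ht.trans_le (min_le_right r R)])
  refine ⟨t, ht1, a / (t - 1) + b, fun m => ⟨(hab m).1, (hab m).2.trans ?_⟩⟩
  have ht0 : 0 < t := by linarith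
  have h1 : (1 : ℝ) + size m * (t - 1) ≤ t ^ size m := by
    have := one_add_mul_le_pow (a := t - 1) (by linarith) (size m)
    simpa using this
  have h2 : (1 : ℝ) ≤ t ^ size m := one_le_pow₀ ht1.le
  have h3 : a * size m + b ≤ (a / (t - 1) + b) * t ^ size m := by
    have h4 : a * size m = a / (t - 1) * (size m * (t - 1)) := by
      have : t - 1 ≠ 0 := by linarith
      field_simp
    have h5 : 0 ≤ a / (t - 1) := div_nonneg ha (by linarith)
    nlinarith
  calc (a * size m + b) * t ^ size m ≤ (a / (t - 1) + b) * t ^ size m * t ^ size m := by gcongr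
    _ = (a / (t - 1) + b) * (t ^ 2) ^ size m := by ring
    _ ≤ _ := by
        have : 0 ≤ a / (t - 1) := div_nonneg ha (by linarith)
        gcongr

theorem summable_and_tsum_le {f g : Config n → ℝ} {a B : ℝ} (h0 : ∀ p, 0 ≤ f p)
    (h : ∀ p, f p ≤ g p) (hg : HasSum g a) (hB : a ≤ B) : Summable f ∧ ∑' p, f p ≤ B :=
  have hf := Summable.of_nonneg_of_le h0 h hg.summable
  ⟨hf, ((hf.tsum_le_tsum h hg.summable).trans_eq hg.tsum_eq).trans hB⟩

theorem abs_sub_sub_le {x y z : ℝ} (hx : 0 ≤ x) (hy : 0 ≤ y) (hz : 0 ≤ z) :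
    |x - y - z| ≤ x + y + z :=
  abs_le.2 ⟨by linarith, by linarith⟩

theorem harmonicNumber_le_size (hs : 0 < s) (m : Config n) (i : Fin (n + 1)) :
    harmonicNumber s (m i) ≤ 1 / (2 * s) * size m := by
  refine (harmonicNumber_le hs _).trans ?_
  rw [mul_comm]
  have : (m i : ℝ) ≤ size m := by exact_mod_cast le_size m i
  gcongr

theorem hasSum_pow_size_mul_tail {β r : ℝ} (h0 : 0 < β * r) (h1 : β * r < 1)
    (i : Fin (n + 1)) (m : Config n) :
    HasSum (fun k : ℕ => r ^ size (put m i (k + 1)) * (β ^ (k + 1) / ((k : ℝ) + 1)))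
      (r ^ size m * ∑' k : ℕ, (β * r) ^ (k + 1) / ((k : ℝ) + 1)) := by
  have := (summable_pow_div h0.le h1).hasSum.mul_left (r ^ size m)
  convert! this using 1
  funext k
  have hsz : size (put m i (k + 1)) = size m + (k + 1) := by
    have := size_update m i (m i + (k + 1))
    rw [put]
    omega
  rw [hsz, mul_pow, pow_add]
  ring

theorem abs_boundaryCol_le (hs : 0 < s) {β : ℝ} (h0 : 0 < β) (i : Fin (n + 1)) (m p : Config n) :
    |boundaryCol s β i m p| ≤
      (harmonicNumber s (m i) + ∑' k : ℕ, β ^ (k + 1) / ((k : ℝ) + 1)) * ket m p +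
        ∑ k ∈ Icc 1 (m i), rate s k (m i) * ket (take m i k) p +
        tailCol i m (fun k => β ^ (k + 1) / ((k : ℝ) + 1)) p := by
  rw [boundaryCol, Pi.sub_apply, Pi.sub_apply, Finset.sum_apply]
  exact abs_sub_sub_le
    (mul_nonneg (add_nonneg (harmonicNumber_nonneg hs _) (tsum_nonneg fun k => by positivity))
      (ket_nonneg m p))
    (Finset.sum_nonneg fun k _ => mul_nonneg (rate_nonneg hs _ _) (ket_nonneg _ _))
    (mul_nonneg (by positivity) (ket_nonneg _ _))

theorem tame_boundaryCol (hs : 0 < s) {β : ℝ} (h0 : 0 < β) (h1 : β < 1) (i : Fin (n + 1)) :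
    Tame (boundaryCol s β i) := by
  -- The injected tail is weighted by (βr)^k / k, which is summable exactly when r < 1/β.
  refine Tame.of_linear (R := 1 / β) (by rwa [lt_div_iff₀ h0, one_mul]) fun r hr hrβ => ?_
  have hr0 : 0 < r := by linarith
  have hβr : β * r < 1 := by rwa [lt_div_iff₀ h0, mul_comm] at hrβ
  have habs := fun m p => abs_boundaryCol_le (n := n) hs h0 i m p
  have htail := fun m => hasSum_pow_size_mul_tail (mul_pos h0 hr0) hβr i m
  obtain ⟨lam, hlam⟩ : ∃ x : ℝ, x = ∑' k : ℕ, β ^ (k + 1) / ((k : ℝ) + 1) := ⟨_, rfl⟩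
  obtain ⟨mu, hmu⟩ : ∃ x : ℝ, x = ∑' k : ℕ, (β * r) ^ (k + 1) / ((k : ℝ) + 1) := ⟨_, rfl⟩
  have hlam0 : 0 ≤ lam := hlam ▸ tsum_nonneg fun k => by positivity
  have hmu0 : 0 ≤ mu := hmu ▸ tsum_nonneg fun k => by positivity
  simp only [← hlam] at habs
  simp only [← hmu] at htail
  refine ⟨1 / (2 * s) * 2, lam + mu, by positivity, by positivity, fun m => ?_⟩
  have hmaj := (((hasSum_mul_ket (fun p => r ^ size p) m).mul_left (harmonicNumber s (m i) + lam)).add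
    (hasSum_sum fun k (_ : k ∈ Icc 1 (m i)) =>
      (hasSum_mul_ket (fun p => r ^ size p) (take m i k)).mul_left (rate s k (m i)))).add
    (hasSum_mul_tailCol (g := fun p => r ^ size p) (htail m))
  refine summable_and_tsum_le (fun p => by positivity) (fun p => ?_) hmaj ?_
  · refine (mul_le_mul_of_nonneg_right (habs m p) (by positivity)).trans_eq ?_
    rw [add_mul, add_mul, Finset.sum_mul]
    congr 1
    · congr 1
      · ring
      · exact Finset.sum_congr rfl fun k _ => by ring
    · ring
  · have h2 : ∑ k ∈ Icc 1 (m i), rate s k (m i) * r ^ size (take m i k) ≤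
        harmonicNumber s (m i) * r ^ size m := by
      rw [harmonicNumber, Finset.sum_mul]
      refine Finset.sum_le_sum fun k hk => mul_le_mul_of_nonneg_left ?_ (rate_nonneg hs _ _)
      refine pow_le_pow_right₀ hr.le ?_
      have := size_update m i (m i - k)
      rw [take]
      omega
    have h3 := harmonicNumber_le_size hs m i
    calc _ ≤ (harmonicNumber s (m i) + lam) * r ^ size m + harmonicNumber s (m i) * r ^ size m +
          r ^ size m * mu := by gcongr
      _ = (harmonicNumber s (m i) * 2 + (lam + mu)) * r ^ size m := by ring
      _ ≤ (1 / (2 * s) * size m * 2 + (lam + mu)) * r ^ size m := by gcongr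
      _ = _ := by ring

/-- The columns of the bulk Hamiltonian density. -/
def bulkCol (s : ℝ) (i j : Fin (n + 1)) (m : Config n) : Vec n :=
  (harmonicNumber s (m i) + harmonicNumber s (m j)) • ket m
    - ∑ k ∈ Icc 1 (m i), rate s k (m i) • ket (put (take m i k) j k)
    - ∑ k ∈ Icc 1 (m j), rate s k (m j) • ket (put (take m j k) i k)

theorem tame_bulkCol (hs : 0 < s) (i j : Fin (n + 1)) : Tame (bulkCol s i j) := by
  refine Tame.of_linear one_lt_two fun r hr _ => ?_
  have hr0 : 0 < r := by linarith
  refine ⟨1 / (2 * s) * 4, 0, by positivity, le_rfl, fun m => ?_⟩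
  have hhi := harmonicNumber_nonneg hs (m i)
  have hhj := harmonicNumber_nonneg hs (m j)
  have hmaj := (((hasSum_mul_ket (fun p => r ^ size p) m).mul_left
    (harmonicNumber s (m i) + harmonicNumber s (m j))).add
    (hasSum_sum fun k (_ : k ∈ Icc 1 (m i)) => (hasSum_mul_ket (fun p => r ^ size p)
      (put (take m i k) j k)).mul_left (rate s k (m i)))).add
    (hasSum_sum fun k (_ : k ∈ Icc 1 (m j)) => (hasSum_mul_ket (fun p => r ^ size p)
      (put (take m j k) i k)).mul_left (rate s k (m j)))
  refine summable_and_tsum_le (fun p => by positivity) (fun p => ?_) hmaj ?_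
  · have habs : |bulkCol s i j m p| ≤
        (harmonicNumber s (m i) + harmonicNumber s (m j)) * ket m p +
        ∑ k ∈ Icc 1 (m i), rate s k (m i) * ket (put (take m i k) j k) p +
        ∑ k ∈ Icc 1 (m j), rate s k (m j) * ket (put (take m j k) i k) p := by
      rw [bulkCol, Pi.sub_apply, Pi.sub_apply, Finset.sum_apply, Finset.sum_apply]
      exact abs_sub_sub_le (mul_nonneg (by positivity) (ket_nonneg m p))
        (Finset.sum_nonneg fun k _ => mul_nonneg (rate_nonneg hs _ _) (ket_nonneg _ _))
        (Finset.sum_nonneg fun k _ => mul_nonneg (rate_nonneg hs _ _) (ket_nonneg _ _))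
    refine (mul_le_mul_of_nonneg_right habs (by positivity)).trans_eq ?_
    rw [add_mul, add_mul, Finset.sum_mul, Finset.sum_mul]
    congr 1
    · congr 1
      · ring
      · exact Finset.sum_congr rfl fun k _ => by ring
    · exact Finset.sum_congr rfl fun k _ => by ring
  · have h2 : ∀ i j : Fin (n + 1), ∑ k ∈ Icc 1 (m i), rate s k (m i) *
        r ^ size (put (take m i k) j k) = harmonicNumber s (m i) * r ^ size m := fun i j => by
      rw [harmonicNumber, Finset.sum_mul]
      exact Finset.sum_congr rfl fun k hk => by rw [size_put_take (Finset.mem_Icc.1 hk).2]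
    rw [h2, h2]
    have h3 := harmonicNumber_le_size hs m i
    have h4 := harmonicNumber_le_size hs m j
    calc _ = (harmonicNumber s (m i) * 2 + harmonicNumber s (m j) * 2) * r ^ size m := by ring
      _ ≤ (1 / (2 * s) * size m * 2 + 1 / (2 * s) * size m * 2) * r ^ size m := by gcongr
      _ = _ := by ring

/-! ## Action on vectors of exponential decay -/

theorem bulk_domain (hs : 0 < s) (i j : Fin (n + 1)) : (bulk s i j).domain = decaying n :=
  (tame_bulkCol hs i j).domain_matrixOp

theorem bulk_mem (hs : 0 < s) (i j : Fin (n + 1)) (v : (bulk s i j).domain) :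
    bulk s i j v ∈ decaying n := (tame_bulkCol hs i j).matrixOp_mem v

theorem bulkEnd_ket (i j : Fin (n + 1)) (m : Config n) :
    bulkEnd s i j (ket m) = bulkCol s i j m := by
  rw [bulkEnd, LinearMap.add_apply, hopEnd_ket, hopEnd_ket, hopCol, hopCol, bulkCol, add_smul]
  abel

theorem bulk_apply (i j : Fin (n + 1)) (v : (bulk s i j).domain) :
    bulk s i j v = bulkEnd s i j v := by
  funext p
  have h := Pi.hasSum.1 (hasSum_apply_ket (continuous_bulkEnd s i j) v) p
  rw [← h.tsum_eq]
  refine tsum_congr fun m => ?_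
  rw [Pi.smul_apply, smul_eq_mul, mul_comm, bulkEnd_ket]
  rfl

/-- The bulk operator is continuous and commutes with each power of `S₋^tot`, so it passes through
the exponential series. -/
theorem lowered_bulk {i j : Fin (n + 1)} (hs : 0 < s) (hij : i ≠ j) (v : (bulk s i j).domain) :
    lowered univ (bulk s i j v) = bulkEnd s i j (lowered univ (v : Vec n)) := by
  have h1 : HasSum (fun k : ℕ => (((k.factorial : ℝ)⁻¹) • lowering univ ^ k) (bulk s i j v))
      (lowered univ (bulk s i j v)) := Pi.hasSum.2 (hasSum_lowering univ (bulk_mem hs i j v))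
  have h2 : HasSum (fun k : ℕ => (((k.factorial : ℝ)⁻¹) • lowering univ ^ k) (v : Vec n))
      (lowered univ (v : Vec n)) := Pi.hasSum.2 (hasSum_lowering univ v.2.1)
  have h3 := h2.map (bulkEnd s i j).toAddMonoidHom (continuous_bulkEnd s i j)
  refine h1.unique ?_
  convert! h3 using 1
  funext k
  have hc : Commute (bulkEnd s i j) (((k.factorial : ℝ)⁻¹) • lowering univ ^ k) :=
    ((commute_bulkEnd_SminusTot hs hij).pow_right k).smul_right _
  rw [bulk_apply]
  exact (LinearMap.congr_fun hc.eq _).symm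

theorem exists_binom_update {F : Finset (Fin (n + 1))} {i : Fin (n + 1)} (hi : i ∈ F)
    (j m : Config n) : ∃ c : ℝ,
      (∀ a, binom F j (Function.update m i a) = (a.choose (j i) : ℝ) * c) ∧
      ∀ b, binom F (Function.update j i b) m = ((m i).choose b : ℝ) * c := by
  refine ⟨∏ k ∈ univ.erase i, if k ∈ F then ((m k).choose (j k) : ℝ) else
    if m k = j k then 1 else 0, fun a => ?_, fun b => ?_⟩
  all_goals
    rw [binom, ← Finset.mul_prod_erase _ _ (Finset.mem_univ i), if_pos hi, Function.update_self]
    congr 1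
    refine Finset.prod_congr rfl fun k hk => ?_
    rw [Function.update_of_ne (Finset.ne_of_mem_erase hk)]

theorem boundaryForm_apply (s ρ : ℝ) (i : Fin (n + 1)) (u : Vec n) (j : Config n) :
    boundaryForm s ρ i u j = harmonicNumber s (j i) * u j -
      ∑ l ∈ Icc 1 (j i), ρ ^ l / l * u (take j i l) := by
  have h : logShift ρ i u j = ∑ l ∈ Icc 1 (j i), ρ ^ l / l * u (take j i l) := by
    rw [logShift, gradedSum_apply]
    simp only [LinearMap.smul_apply, Pi.smul_apply, smul_eq_mul, shift_pow_apply]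
    symm
    refine Finset.sum_subset_zero_on_sdiff (fun k hk => ?_) (fun k hk => ?_) fun k hk => ?_
    · have := (Finset.mem_Icc.1 hk).2
      have := le_size j i
      exact Finset.mem_range.2 (by omega)
    · rw [Finset.mem_sdiff, Finset.mem_Icc] at hk
      rcases Nat.eq_zero_or_pos k with rfl | h0
      · simp
      · rw [if_neg (by omega), mul_zero]
    · rw [if_pos (Finset.mem_Icc.1 hk).2]
  rw [boundaryForm, LinearMap.sub_apply, Pi.sub_apply, h]
  rfl

/-- Duality with binomial moments. Removal contributes the harmonic number of j_i, injection
contributes the coefficients of the logarithm, and the constant Σ β^k/k cancels the part of the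
injection that leaves the moment unchanged. -/
theorem tsum_binom_mul_boundaryCol (hs : 0 < s) {β : ℝ} (h0 : 0 < β) (h1 : β < 1)
    {F : Finset (Fin (n + 1))} {i : Fin (n + 1)} (hi : i ∈ F) (j m : Config n) :
    ∑' p, binom F j p * boundaryCol s β i m p = harmonicNumber s (j i) * binom F j m -
      ∑ l ∈ Icc 1 (j i), (β / (1 - β)) ^ l / l * binom F (take j i l) m := by
  obtain ⟨c, hc1, hc2⟩ := exists_binom_update hi j m
  have hm : binom F j m = ((m i).choose (j i) : ℝ) * c := by
    rw [← hc1, Function.update_eq_self]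
  have hA := ((hasSum_pow_div_mul_choose_sub h0 h1 (m i) (j i)).add
    ((summable_pow_div h0.le h1).hasSum.mul_right ((m i).choose (j i) : ℝ))).mul_right c
  have hfun : (fun k : ℕ => (β ^ (k + 1) / ((k : ℝ) + 1) *
      (((m i + (k + 1)).choose (j i) : ℝ) - ((m i).choose (j i) : ℝ)) +
      β ^ (k + 1) / ((k : ℝ) + 1) * ((m i).choose (j i) : ℝ)) * c) =
      fun k => binom F j (put m i (k + 1)) * (β ^ (k + 1) / ((k : ℝ) + 1)) := by
    funext k
    rw [put, hc1]
    ring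
  rw [hfun] at hA
  rw [(hasSum_mul_boundaryCol s β hA).tsum_eq, hm]
  simp only [take, hc1, hc2]
  have hI := sum_rate_mul_choose hs (m i) (j i)
  simp only [mul_sub, Finset.sum_sub_distrib, ← Finset.sum_mul] at hI
  rw [← harmonicNumber] at hI
  simp only [← mul_assoc, ← Finset.sum_mul]
  linear_combination c * hI

theorem boundary_domain (hs : 0 < s) {β : ℝ} (h0 : 0 < β) (h1 : β < 1) (i : Fin (n + 1)) :
    (boundary s β i).domain = decaying n := by
  rw [boundary_eq]
  exact (tame_boundaryCol hs h0 h1 i).domain_matrixOp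

theorem boundary_mem (hs : 0 < s) {β : ℝ} (h0 : 0 < β) (h1 : β < 1) (i : Fin (n + 1))
    (v : (boundary s β i).domain) : boundary s β i v ∈ decaying n := by
  revert v
  rw [boundary_eq]
  exact (tame_boundaryCol hs h0 h1 i).matrixOp_mem

/-- Any set F containing the site works: all sites are used for H, and F = {i} for identifying the
equilibrium boundary term, whose exponentials act at one site. -/
theorem lowered_boundary (hs : 0 < s) {β : ℝ} (h0 : 0 < β) (h1 : β < 1)
    {F : Finset (Fin (n + 1))} {i : Fin (n + 1)} (hi : i ∈ F) (v : (boundary s β i).domain) :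
    lowered F (boundary s β i v) = boundaryForm s (β / (1 - β)) i (lowered F (v : Vec n)) := by
  revert v
  rw [boundary_eq]
  intro v
  funext j
  rw [boundaryForm_apply, lowered,
    (tame_boundaryCol hs h0 h1 i).tsum_mul_matrixOp (subExp_binom F j) v]
  simp only [tsum_binom_mul_boundaryCol hs h0 h1 hi]
  have hsum : ∀ j, HasSum (fun m => binom F j m * (v : Vec n) m) (lowered F (v : Vec n) j) :=
    fun j => ((subExp_binom F j).summable v.2.1).hasSum
  have h2 := ((hsum j).mul_left (harmonicNumber s (j i))).sub
    (hasSum_sum fun l (_ : l ∈ Icc 1 (j i)) =>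
      (hsum (take j i l)).mul_left ((β / (1 - β)) ^ l / l))
  rw [← h2.tsum_eq]
  refine tsum_congr fun m => ?_
  rw [sub_mul, Finset.sum_mul, mul_assoc]
  congr 1
  exact Finset.sum_congr rfl fun l _ => by ring

/-! ## Graphs of partially defined operators -/

section Graph

variable {E : Type*} [AddCommGroup E] [Module ℝ E]

/-- In terms of graphs the natural domain of a long composition becomes a chain of existential
quantifiers, which keeps the domain bookkeeping out of the later arguments. -/
theorem mem_graph_after {f g : E →ₗ.[ℝ] E} {x y : E} :
    (x, y) ∈ (g ∘ₙ f).graph ↔ ∃ z, (x, z) ∈ f.graph ∧ (z, y) ∈ g.graph := by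
  simp only [LinearPMap.mem_graph_iff]
  constructor
  · rintro ⟨⟨w, ⟨w', h1, h2⟩, h3⟩, rfl, h4⟩
    exact ⟨f ⟨w, h3⟩, ⟨⟨w, h3⟩, rfl, rfl⟩, ⟨f ⟨w, h3⟩, by
      have : w' = ⟨w, h3⟩ := Subtype.ext h2
      subst this
      exact h1⟩, rfl, h4⟩
  · rintro ⟨z, ⟨a, rfl, rfl⟩, b, hb, rfl⟩
    have hd : (a : E) ∈ (g ∘ₙ f).domain := ⟨⟨a, by
      change f a ∈ g.domain
      rw [← hb]
      exact b.2, rfl⟩, a.2⟩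
    refine ⟨⟨a, hd⟩, rfl, ?_⟩
    have : b = ⟨f a, by rw [← hb]; exact b.2⟩ := Subtype.ext hb
    rw [this]
    rfl

theorem mem_graph_total {A : E →ₗ[ℝ] E} {x y : E} : (x, y) ∈ (total A).graph ↔ y = A x := by
  rw [LinearPMap.mem_graph_iff]
  constructor
  · rintro ⟨a, rfl, rfl⟩
    rfl
  · rintro rfl
    exact ⟨⟨x, trivial⟩, rfl, rfl⟩

theorem add_mem_graph {f g : E →ₗ.[ℝ] E} {x y z : E} (hf : (x, y) ∈ f.graph)
    (hg : (x, z) ∈ g.graph) : (x, y + z) ∈ (f + g).graph := by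
  rw [LinearPMap.mem_graph_iff] at *
  obtain ⟨a, rfl, rfl⟩ := hf
  obtain ⟨b, hb, rfl⟩ := hg
  have hbg : (a : E) ∈ g.domain := by
    have := b.2
    rwa [hb] at this
  refine ⟨⟨a, a.2, hbg⟩, rfl, ?_⟩
  have : b = ⟨a, hbg⟩ := Subtype.ext hb
  rw [this]
  rfl

theorem sum_mem_graph {ι : Type*} (F : Finset ι) {f : ι → E →ₗ.[ℝ] E} {x : E} {y : ι → E}
    (h : ∀ i ∈ F, (x, y i) ∈ (f i).graph) : (x, ∑ i ∈ F, y i) ∈ (∑ i ∈ F, f i).graph := by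
  classical
  induction F using Finset.induction_on with
  | empty =>
    rw [Finset.sum_empty, Finset.sum_empty, LinearPMap.mem_graph_iff]
    exact ⟨⟨x, trivial⟩, rfl, rfl⟩
  | insert i F hi ih =>
    rw [Finset.sum_insert hi, Finset.sum_insert hi]
    exact add_mem_graph (h i (Finset.mem_insert_self i F))
      (ih fun j hj => h j (Finset.mem_insert_of_mem hj))

theorem mem_graph_inverse {f : E →ₗ.[ℝ] E} (hf : LinearMap.ker f.toFun = ⊥) {x y : E} :
    (x, y) ∈ f.inverse.graph ↔ (y, x) ∈ f.graph := by
  rw [LinearPMap.inverse_graph hf, Submodule.mem_map]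
  constructor
  · rintro ⟨⟨a, b⟩, h, heq⟩
    obtain ⟨rfl, rfl⟩ := Prod.mk.inj heq
    exact h
  · exact fun h => ⟨(y, x), h, rfl⟩

end Graph

/-! ## The lowering exponential as a linear map -/

theorem lowered_add (F : Finset (Fin (n + 1))) {v w : Vec n} (hv : v ∈ decaying n)
    (hw : w ∈ decaying n) : lowered F (v + w) = lowered F v + lowered F w := by
  funext j
  have h := ((subExp_binom F j).summable hv).tsum_add ((subExp_binom F j).summable hw)
  rw [Pi.add_apply, lowered, lowered, lowered, ← h]
  exact tsum_congr fun m => by rw [Pi.add_apply, mul_add]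

theorem lowered_zero (F : Finset (Fin (n + 1))) : lowered F (0 : Vec n) = 0 := by
  funext j
  simp [lowered]

theorem lowered_smul (F : Finset (Fin (n + 1))) (c : ℝ) (v : Vec n) :
    lowered F (c • v) = c • lowered F v := by
  funext j
  rw [Pi.smul_apply, smul_eq_mul, lowered, lowered, ← tsum_mul_left]
  exact tsum_congr fun m => by rw [Pi.smul_apply, smul_eq_mul, mul_left_comm]

theorem lowered_sub (F : Finset (Fin (n + 1))) {v w : Vec n} (hv : v ∈ decaying n)
    (hw : w ∈ decaying n) : lowered F (v - w) = lowered F v - lowered F w := by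
  rw [sub_eq_add_neg, ← neg_one_smul ℝ w, lowered_add F hv (Submodule.smul_mem _ _ hw),
    lowered_smul, neg_one_smul, ← sub_eq_add_neg]

theorem lowered_sum (F : Finset (Fin (n + 1))) {ι : Type*} (S : Finset ι) {v : ι → Vec n}
    (hv : ∀ i ∈ S, v i ∈ decaying n) : lowered F (∑ i ∈ S, v i) = ∑ i ∈ S, lowered F (v i) := by
  classical
  induction S using Finset.induction_on with
  | empty =>
    rw [Finset.sum_empty, Finset.sum_empty, lowered_zero]
  | insert i S hi ih =>
    rw [Finset.sum_insert hi, Finset.sum_insert hi, lowered_add F (hv i (Finset.mem_insert_self i S))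
      (Submodule.sum_mem _ fun j hj => hv j (Finset.mem_insert_of_mem hj)),
      ih fun j hj => hv j (Finset.mem_insert_of_mem hj)]

theorem lowered_injective (F : Finset (Fin (n + 1))) {v w : Vec n} (hv : v ∈ decaying n)
    (hw : w ∈ decaying n) (h : lowered F v = lowered F w) : v = w :=
  sub_eq_zero.1 (lowered_eq_zero F (sub_mem hv hw) (by rw [lowered_sub F hv hw, h, sub_self]))

theorem mem_graph_expDec {F : Finset (Fin (n + 1))} {v u : Vec n} :
    (v, u) ∈ (expDec (lowering F)).graph ↔ v ∈ decaying n ∧ u = lowered F v := by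
  rw [LinearPMap.mem_graph_iff]
  constructor
  · rintro ⟨a, rfl, rfl⟩
    exact ⟨expDec_domain F ▸ a.2, expDec_apply F a⟩
  · rintro ⟨hv, rfl⟩
    exact ⟨⟨v, (expDec_domain F).symm ▸ hv⟩, rfl, expDec_apply F _⟩

theorem mem_graph_expDecInv {F : Finset (Fin (n + 1))} {v u : Vec n} :
    (v, u) ∈ (expDecInv (lowering F)).graph ↔ u ∈ decaying n ∧ v = lowered F u := by
  rw [expDecInv, mem_graph_inverse (ker_expDec F), mem_graph_expDec]

/-! ## The Hamiltonians -/

/-- By injectivity of the binomial transform the triangular form determines the boundary term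
completely, domain included. -/
theorem mem_graph_boundary (hs : 0 < s) {β : ℝ} (h0 : 0 < β) (h1 : β < 1)
    {F : Finset (Fin (n + 1))} {i : Fin (n + 1)} (hi : i ∈ F) {v u : Vec n} :
    (v, u) ∈ (boundary s β i).graph ↔ v ∈ decaying n ∧ u ∈ decaying n ∧
      lowered F u = boundaryForm s (β / (1 - β)) i (lowered F v) := by
  rw [LinearPMap.mem_graph_iff]
  constructor
  · rintro ⟨a, rfl, rfl⟩
    exact ⟨boundary_domain hs h0 h1 i ▸ a.2, boundary_mem hs h0 h1 i a,
      lowered_boundary hs h0 h1 hi a⟩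
  · rintro ⟨hv, hu, h⟩
    refine ⟨⟨v, (boundary_domain hs h0 h1 i).symm ▸ hv⟩, rfl, ?_⟩
    refine lowered_injective F (boundary_mem hs h0 h1 i _) hu ?_
    rw [h]
    exact lowered_boundary hs h0 h1 hi _

/-- Both operators relate v to the decaying u whose transform is e^{ρS₊} h_s e^{-ρS₊} applied to
that of v. The parameter whose odds β/(1-β) equal ρ is ρ/(1+ρ). -/
theorem boundaryEq_eq (hs : 0 < s) {ρ : ℝ} (hρ : 0 < ρ) (i : Fin (n + 1)) :
    boundaryEq s ρ i = boundary s (ρ / (1 + ρ)) i := by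
  have h0 : 0 < ρ / (1 + ρ) := by positivity
  have h1 : ρ / (1 + ρ) < 1 := by rw [div_lt_one (by positivity)]; linarith
  have hβ : ρ / (1 + ρ) / (1 - ρ / (1 + ρ)) = ρ := by field_simp; ring
  have hψ : (diagOp fun m : Config n => psi (((m i : ℝ) + s) + s) - psi (2 * s)) =
      harmonicOp s i := by
    rw [harmonicOp]
    congr 1
    funext m
    exact psi_sub_psi hs (m i)
  refine LinearPMap.eq_of_eq_graph (Submodule.ext fun ⟨v, u⟩ => ?_)
  rw [mem_graph_boundary hs h0 h1 (Finset.mem_singleton_self i), hβ, boundaryForm_eq_conj hs,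
    boundaryEq, hψ, ← lowering_singleton, expOp_eq_total ((raises_Splus s i).smul ρ),
    expOp_eq_total ((raises_Splus s i).smul ρ).neg]
  simp only [mem_graph_after, mem_graph_total, mem_graph_expDec, mem_graph_expDecInv]
  constructor
  · rintro ⟨_, ⟨_, ⟨_, ⟨_, ⟨hv, rfl⟩, rfl⟩, rfl⟩, rfl⟩, hu, h⟩
    exact ⟨hv, hu, h.symm⟩
  · rintro ⟨hv, hu, h⟩
    exact ⟨_, ⟨_, ⟨_, ⟨_, ⟨hv, rfl⟩, rfl⟩, rfl⟩, rfl⟩, hu, h.symm⟩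

theorem hamiltonianEq_eq (hs : 0 < s) {ρ : ℝ} (hρ : 0 < ρ) :
    hamiltonianEq n s ρ = hamiltonian n s (ρ / (1 + ρ)) (ρ / (1 + ρ)) := by
  rw [hamiltonianEq, boundaryEq_eq hs hρ, boundaryEq_eq hs hρ, hamiltonian]

theorem exists_mem_graph_hamiltonian (hs : 0 < s) {βL βR : ℝ} (hL : βL ∈ Set.Ioo (0 : ℝ) 1)
    (hR : βR ∈ Set.Ioo (0 : ℝ) 1) {v : Vec n} (hv : v ∈ decaying n) :
    ∃ w ∈ decaying n, (v, w) ∈ (hamiltonian n s βL βR).graph ∧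
      lowered univ w =
        hamiltonianForm n s (βL / (1 - βL)) (βR / (1 - βR)) (lowered univ v) := by
  have hdL : v ∈ (boundary s βL (0 : Fin (n + 1))).domain :=
    (boundary_domain hs hL.1 hL.2 0).symm ▸ hv
  have hdR : v ∈ (boundary s βR (Fin.last n)).domain :=
    (boundary_domain hs hR.1 hR.2 (Fin.last n)).symm ▸ hv
  have hdi : ∀ i : Fin n, v ∈ (bulk s i.castSucc i.succ).domain := fun i =>
    (bulk_domain hs i.castSucc i.succ).symm ▸ hv
  have mL := boundary_mem hs hL.1 hL.2 0 ⟨v, hdL⟩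
  have mR := boundary_mem hs hR.1 hR.2 (Fin.last n) ⟨v, hdR⟩
  have mi : ∀ i : Fin n, bulk s i.castSucc i.succ ⟨v, hdi i⟩ ∈ decaying n := fun i =>
    bulk_mem hs _ _ _
  have mS := Submodule.sum_mem (decaying n) fun i (_ : i ∈ (univ : Finset (Fin n))) => mi i
  refine ⟨boundary s βL 0 ⟨v, hdL⟩ + ∑ i : Fin n, bulk s i.castSucc i.succ ⟨v, hdi i⟩ +
    boundary s βR (Fin.last n) ⟨v, hdR⟩, add_mem (add_mem mL mS) mR, ?_, ?_⟩
  · exact add_mem_graph (add_mem_graph (LinearPMap.mem_graph _ ⟨v, hdL⟩)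
      (sum_mem_graph univ fun i _ => LinearPMap.mem_graph _ ⟨v, hdi i⟩))
      (LinearPMap.mem_graph _ ⟨v, hdR⟩)
  · rw [lowered_add _ (add_mem mL mS) mR, lowered_add _ mL mS, lowered_sum _ _ fun i _ => mi i,
      lowered_boundary hs hL.1 hL.2 (Finset.mem_univ _),
      lowered_boundary hs hR.1 hR.2 (Finset.mem_univ _), hamiltonianForm]
    simp only [LinearMap.add_apply, LinearMap.sum_apply]
    congr 2
    exact Finset.sum_congr rfl fun i _ => lowered_bulk hs Fin.castSucc_lt_succ.ne _

theorem hamiltonian_domain (hs : 0 < s) {βL βR : ℝ} (hL : βL ∈ Set.Ioo (0 : ℝ) 1)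
    (hR : βR ∈ Set.Ioo (0 : ℝ) 1) : (hamiltonian n s βL βR).domain = decaying n := by
  refine le_antisymm (fun v hv => ?_) fun v hv => ?_
  · rw [← boundary_domain hs hR.1 hR.2 (Fin.last n)]
    exact hv.2
  · obtain ⟨w, -, h, -⟩ := exists_mem_graph_hamiltonian hs hL hR hv
    exact LinearPMap.mem_domain_of_mem_graph h

theorem div_one_add_mem_Ioo {ρ : ℝ} (hρ : 0 < ρ) : ρ / (1 + ρ) ∈ Set.Ioo (0 : ℝ) 1 :=
  ⟨by positivity, by rw [div_lt_one (by positivity)]; linarith⟩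

/-! ## The transformation -/

/-- The three middle factors of P are defined everywhere, so apart from decay of v the only
restriction is that the result be a binomial transform of a decaying vector. -/
theorem mem_graph_mapP {ρL ρR ρ : ℝ} {v u : Vec n} :
    (v, u) ∈ (mapP n s ρL ρR ρ).graph ↔ v ∈ decaying n ∧ u ∈ decaying n ∧
      lowered univ u = mapForm n s ρL ρR ρ (lowered univ v) := by
  rw [mapP, ← lowering_univ, expOp_eq_total ((raises_SplusTot s).smul ρR),
    expOp_eq_total ((raises_SplusTot s).smul ρ).neg, nonlocalW_eq_total]
  simp only [mem_graph_after, mem_graph_total, mem_graph_expDec, mem_graph_expDecInv]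
  constructor
  · rintro ⟨_, ⟨_, ⟨_, ⟨_, ⟨hv, rfl⟩, rfl⟩, rfl⟩, rfl⟩, hu, h⟩
    exact ⟨hv, hu, h.symm⟩
  · rintro ⟨hv, hu, h⟩
    exact ⟨_, ⟨_, ⟨_, ⟨_, ⟨hv, rfl⟩, rfl⟩, rfl⟩, rfl⟩, hu, h.symm⟩

theorem ker_mapP (hs : 0 < s) (ρL ρR ρ : ℝ) :
    LinearMap.ker (mapP n s ρL ρR ρ).toFun = ⊥ := by
  rw [LinearMap.ker_eq_bot']
  intro v hv
  have h := mem_graph_mapP.1 (LinearPMap.mem_graph (mapP n s ρL ρR ρ) v)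
  obtain ⟨hd, -, h⟩ := h
  have h0 : lowered univ (mapP n s ρL ρR ρ v) = 0 := by
    have : mapP n s ρL ρR ρ v = 0 := hv
    rw [this, lowered_zero]
  rw [h0] at h
  have h1 := mapForm_injective (n := n) hs ρL ρR ρ (a₁ := lowered univ (v : Vec n)) (a₂ := 0)
    (by rw [← h, map_zero])
  exact Subtype.ext (lowered_eq_zero univ hd h1)

theorem domRestrict_hamiltonianEq (hs : 0 < s) {βL βR ρ : ℝ} (hL : βL ∈ Set.Ioo (0 : ℝ) 1)
    (hR : βR ∈ Set.Ioo (0 : ℝ) 1) (hρ : 0 < ρ) :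
    (hamiltonianEq n s ρ).domRestrict (mapP n s (βL / (1 - βL)) (βR / (1 - βR)) ρ).domain =
      (mapP n s (βL / (1 - βL)) (βR / (1 - βR)) ρ).inverse ∘ₙ
        hamiltonian n s βL βR ∘ₙ mapP n s (βL / (1 - βL)) (βR / (1 - βR)) ρ := by
  set P := mapP n s (βL / (1 - βL)) (βR / (1 - βR)) ρ with hP
  have hker : LinearMap.ker P.toFun = ⊥ := ker_mapP hs _ _ _
  have hβ : ρ / (1 + ρ) / (1 - ρ / (1 + ρ)) = ρ := by field_simp; ring
  have hI := div_one_add_mem_Ioo hρ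
  -- With u = P v, both x = H^eq v and w = H u exist because u and v decay. The intertwining
  -- relation says that the transform of w is the image of that of x, so x is again in the domain of
  -- P and P x = w.
  have key : ∀ v ∈ P.domain, ∃ x u w, (v, x) ∈ (hamiltonianEq n s ρ).graph ∧ (v, u) ∈ P.graph ∧
      (u, w) ∈ (hamiltonian n s βL βR).graph ∧ (x, w) ∈ P.graph := by
    intro v hv
    have hvu := LinearPMap.mem_graph P ⟨v, hv⟩
    obtain ⟨hvd, hud, hu⟩ := mem_graph_mapP.1 hvu
    obtain ⟨x, hx, hvx, hAx⟩ := exists_mem_graph_hamiltonian hs hI hI hvd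
    obtain ⟨w, hw, huw, hAw⟩ := exists_mem_graph_hamiltonian hs hL hR hud
    rw [← hamiltonianEq_eq hs hρ] at hvx
    refine ⟨x, _, w, hvx, hvu, huw, mem_graph_mapP.2 ⟨hx, hw, ?_⟩⟩
    rw [hAw, hAx, hu, hβ]
    exact LinearMap.congr_fun (hamiltonianForm_mul_mapForm hs _ _ ρ) _
  refine LinearPMap.eq_of_eq_graph (Submodule.ext fun ⟨v, x⟩ => ?_)
  simp only [mem_graph_after, mem_graph_inverse hker]
  constructor
  · intro h
    obtain ⟨⟨a, ha⟩, rfl, rfl⟩ := (LinearPMap.mem_graph_iff _).1 h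
    obtain ⟨x, u, w, h1, h2, h3, h4⟩ := key a ha.1
    have hx : x = (hamiltonianEq n s ρ).domRestrict P.domain ⟨a, ha⟩ :=
      LinearPMap.mem_graph_snd_inj _ h1 (LinearPMap.mem_graph (hamiltonianEq n s ρ) ⟨a, ha.2⟩) rfl
    exact ⟨w, ⟨u, h2, h3⟩, hx ▸ h4⟩
  · rintro ⟨w, ⟨u, h2, h3⟩, h4⟩
    have hv := LinearPMap.mem_domain_of_mem_graph h2
    obtain ⟨x', u', w', g1, g2, g3, g4⟩ := key v hv
    obtain rfl := LinearPMap.mem_graph_snd_inj _ h2 g2 rfl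
    obtain rfl := LinearPMap.mem_graph_snd_inj _ h3 g3 rfl
    -- Injectivity of P: x and x' have the same image.
    have hxx : x = x' := LinearPMap.mem_graph_snd_inj _ ((mem_graph_inverse hker).2 h4)
      ((mem_graph_inverse hker).2 g4) rfl
    rw [hxx]
    obtain ⟨a, ha1, ha2⟩ := (LinearPMap.mem_graph_iff _).1 g1
    simp only at ha1 ha2
    rw [← ha1] at hv ⊢
    rw [← ha2]
    exact LinearPMap.mem_graph ((hamiltonianEq n s ρ).domRestrict P.domain) ⟨a, hv, a.2⟩

/-! ## Ordered Dirichlet variables -/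

section Moments

open MeasureTheory ProbabilityTheory

theorem betaPDFReal_nonneg {a b : ℝ} (ha : 0 < a) (hb : 0 < b) (x : ℝ) :
    0 ≤ betaPDFReal a b x := by
  by_cases h : 0 < x ∧ x < 1
  · exact (betaPDFReal_pos h.1 h.2 ha hb).le
  · simp [betaPDFReal, h]

theorem integral_betaPDFReal {a b : ℝ} (ha : 0 < a) (hb : 0 < b) :
    ∫ x, betaPDFReal a b x = 1 := by
  rw [integral_eq_lintegral_of_nonneg_ae (ae_of_all _ (betaPDFReal_nonneg ha hb)) (by fun_prop)]
  have := lintegral_betaPDF_eq_one ha hb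
  simp only [betaPDF] at this
  rw [this, ENNReal.toReal_one]

/-- A factor x^K turns the beta density with first parameter a into that with a + K. Clamping
changes nothing on the support but makes the variable lie in [0, 1] everywhere rather than almost
everywhere. -/
theorem integral_clamp_pow_betaMeasure {a b : ℝ} (ha : 0 < a) (hb : 0 < b) (K : ℕ) :
    ∫ x, (max 0 (min 1 x)) ^ K ∂betaMeasure a b = rising a K / rising (a + b) K := by
  have hc : ∀ x, (betaPDF a b x).toReal • (max 0 (min 1 x)) ^ K =
      (rising a K / rising (a + b) K) * betaPDFReal (a + K) b x := by
    intro x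
    rw [betaPDF, ENNReal.toReal_ofReal (betaPDFReal_nonneg ha hb x), smul_eq_mul]
    by_cases h : 0 < x ∧ x < 1
    · rw [betaPDFReal, betaPDFReal, if_pos h, if_pos h, min_eq_right h.2.le, max_eq_right h.1.le,
        beta, beta, show a + K + b = a + b + K by ring, Gamma_add_natCast ha,
        Gamma_add_natCast (by positivity), show a + (K : ℝ) - 1 = (a - 1) + K by ring,
        Real.rpow_add h.1, Real.rpow_natCast]
      have h1 := (Real.Gamma_pos_of_pos ha).ne'
      have h2 := (Real.Gamma_pos_of_pos hb).ne'
      have h3 := (Real.Gamma_pos_of_pos (add_pos ha hb)).ne'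
      have h4 := (rising_pos ha K).ne'
      have h5 := (rising_pos (add_pos ha hb) K).ne'
      field_simp
    · simp [betaPDFReal, h]
  rw [betaMeasure, integral_withDensity_eq_integral_toReal_smul
    (by unfold betaPDF; fun_prop) (ae_of_all _ fun x => by simp [betaPDF])]
  simp only [hc]
  rw [integral_const_mul, integral_betaPDFReal (by positivity) hb, mul_one]

/-- The product `∏ᵢ (cᵢ + k_{i+1} + ⋯)_{kᵢ}`. -/
def risingProd {N : ℕ} (c : Fin N → ℝ) (k : Fin N → ℕ) : ℝ :=
  ∏ i, rising (c i + ∑ j ∈ Ioi i, (k j : ℝ)) (k i)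

theorem sum_Ioi_zero {N : ℕ} (f : Fin (N + 1) → ℝ) :
    ∑ j ∈ Ioi (0 : Fin (N + 1)), f j = ∑ j : Fin N, f j.succ := by
  rw [Fin.Ioi_zero_eq_map, Finset.sum_map]
  rfl

theorem sum_Ioi_succ {N : ℕ} (f : Fin (N + 1) → ℝ) (i : Fin N) :
    ∑ j ∈ Ioi i.succ, f j = ∑ j ∈ Ioi i, f j.succ := by
  rw [← Fin.map_succEmb_Ioi, Finset.sum_map]
  rfl

theorem risingProd_succ {N : ℕ} (c : Fin (N + 1) → ℝ) (k : Fin (N + 1) → ℕ) :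
    risingProd c k = rising (c 0 + ∑ j : Fin N, (k j.succ : ℝ)) (k 0) *
      risingProd (fun i => c i.succ) fun i => k i.succ := by
  rw [risingProd, Fin.prod_univ_succ, sum_Ioi_zero fun j => (k j : ℝ), risingProd]
  congr 1
  exact Finset.prod_congr rfl fun i _ => by rw [sum_Ioi_succ fun j => (k j : ℝ)]

/-- Random variables in the unit cube with the moments of an ordered Dirichlet distribution. -/
theorem exists_moments (N : ℕ) (c : Fin N → ℝ) (D : ℝ) (hD : 0 < D) (hc0 : ∀ i, 0 < c i)
    (hcD : ∀ i, c i < D) (hc : StrictAnti c) :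
    ∃ (Ω : Type) (_ : MeasurableSpace Ω) (μ : Measure Ω) (_ : IsProbabilityMeasure μ)
      (X : Fin N → Ω → ℝ), (∀ i, Measurable (X i)) ∧ (∀ i ω, X i ω ∈ Set.Icc (0 : ℝ) 1) ∧
      ∀ k : Fin N → ℕ, ∫ ω, ∏ i, X i ω ^ k i ∂μ = risingProd c k / rising D (∑ i, k i) := by
  induction N generalizing D with
  | zero =>
    refine ⟨Unit, inferInstance, Measure.dirac (), inferInstance, fun i => i.elim0,
      fun i => i.elim0, fun i => i.elim0, fun k => ?_⟩
    simp [risingProd]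
  | succ N ih =>
    -- Stick breaking: the remaining variables, relative to the first, follow the same law with c 0
    -- in the role of D.
    obtain ⟨Ω, _, μ, _, X, hX, hX1, hmom⟩ := ih (fun i => c i.succ) (c 0) (hc0 0)
      (fun i => hc0 _) (fun i => hc (Fin.succ_pos i)) fun i j hij => hc (Fin.succ_lt_succ_iff.2 hij)
    have hb : 0 < D - c 0 := sub_pos.2 (hcD 0)
    have := isProbabilityMeasureBeta (hc0 0) hb
    set τ : ℝ → ℝ := fun x => max 0 (min 1 x) with hτ
    have hτm : Measurable τ := measurable_const.max (measurable_const.min measurable_id)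
    have hτ1 : ∀ x, τ x ∈ Set.Icc (0 : ℝ) 1 := fun x =>
      ⟨le_max_left _ _, max_le zero_le_one (min_le_left _ _)⟩
    refine ⟨ℝ × Ω, inferInstance, (betaMeasure (c 0) (D - c 0)).prod μ, inferInstance,
      Fin.cons (fun ω => τ ω.1) fun i ω => τ ω.1 * X i ω.2, fun i => ?_, fun i => ?_, fun k => ?_⟩
    · refine Fin.cases ?_ (fun i => ?_) i
      · exact hτm.comp measurable_fst
      · exact (hτm.comp measurable_fst).mul ((hX i).comp measurable_snd)
    · refine Fin.cases (fun ω => hτ1 ω.1) (fun i ω => ?_) i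
      exact ⟨mul_nonneg (hτ1 _).1 (hX1 i _).1, mul_le_one₀ (hτ1 _).2 (hX1 i _).1 (hX1 i _).2⟩
    · have hprod : ∀ ω : ℝ × Ω, ∏ i, (Fin.cons (fun ω : ℝ × Ω => τ ω.1)
          (fun i ω => τ ω.1 * X i ω.2) : Fin (N + 1) → ℝ × Ω → ℝ) i ω ^ k i =
          τ ω.1 ^ (∑ i, k i) * ∏ i, X i ω.2 ^ k i.succ := by
        intro ω
        rw [Fin.prod_univ_succ, Fin.sum_univ_succ, pow_add]
        simp only [Fin.cons_zero, Fin.cons_succ, mul_pow, Finset.prod_mul_distrib,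
          Finset.prod_pow_eq_pow_sum]
        ring
      simp only [hprod]
      -- The first variable enters with the total power. Its moment (c_0)_{|k|} splits as (c_0)_r
      -- (c_0 + r)_{k_0} with r the sum of the other powers, and (c_0)_r cancels the denominator of
      -- the inner moments.
      rw [integral_prod_mul (fun x => τ x ^ ∑ i, k i) (fun ω => ∏ i, X i ω ^ k i.succ),
        integral_clamp_pow_betaMeasure (hc0 0) hb, hmom, add_sub_cancel, risingProd_succ,
        Fin.sum_univ_succ, add_comm (k 0), rising_add (c 0)]
      push_cast
      have h1 := (rising_pos (hc0 0) (∑ i : Fin N, k i.succ)).ne'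
      have h2 := (rising_pos hD (∑ i : Fin N, k i.succ + k 0)).ne'
      field_simp

end Moments

/-! ## Powers of raising operators on basis vectors -/

open Classical in
/-- The vector `G` moved to the configurations above `m`. -/
def translate (m : Config n) (G : Vec n) : Vec n := fun q =>
  if m ≤ q then G fun i => q i - m i else 0

theorem translate_add (m k : Config n) (G : Vec n) : translate m G (fun i => m i + k i) = G k := by
  have h : m ≤ fun i => m i + k i := fun i => Nat.le_add_right _ _
  rw [translate, if_pos h]
  congr 1
  funext i
  exact Nat.add_sub_cancel_left _ _

theorem exists_eq_add_of_le {m q : Config n} (h : m ≤ q) : ∃ k : Config n, q = fun i => m i + k i :=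
  ⟨fun i => q i - m i, funext fun i => (Nat.add_sub_cancel' (h i)).symm⟩

theorem size_add (m k : Config n) : size (fun i => m i + k i) = size m + size k :=
  Finset.sum_add_distrib

theorem translate_eq_zero {m q : Config n} (G : Vec n) (h : size q ≤ size m) (hq : q ≠ m) :
    translate m G q = 0 := by
  refine if_neg fun hle => hq ?_
  obtain ⟨k, rfl⟩ := exists_eq_add_of_le hle
  rw [size_add] at h
  funext i
  have : k i ≤ size k := le_size k i
  omega

/-- F plays the role of e^X |m⟩. The hypothesis `hF` is the differential equation of the
exponential, graded by level, and together with the initial level it determines all terms. -/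
theorem pow_apply_ket {X : Module.End ℝ (Vec n)} (hX : Raises 1 X) {m : Config n} {F : Vec n}
    (hF : ∀ p, X F p = ((size p : ℝ) - size m) * F p) (hm : F m = 1)
    (h0 : ∀ p, size p ≤ size m → p ≠ m → F p = 0) (K : ℕ) (p : Config n) :
    (X ^ K) (ket m) p = if size p = size m + K then (K.factorial : ℝ) * F p else 0 := by
  induction K generalizing p with
  | zero =>
    rw [pow_zero, Module.End.one_apply]
    by_cases h : p = m
    · simp [ket, h, hm]
    · split_ifs with h1
      · simp [ket, h, h0 p h1.le h]
      · simp [ket, h]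
  | succ K ih =>
    rw [pow_succ', Module.End.mul_apply]
    split_ifs with h
    · have h1 : X ((X ^ K) (ket m)) p = X ((K.factorial : ℝ) • F) p := hX.congr fun q hq => by
        rw [ih, if_pos (by omega), Pi.smul_apply, smul_eq_mul]
      rw [h1, map_smul, Pi.smul_apply, hF, h, Nat.factorial_succ, smul_eq_mul]
      push_cast
      ring
    · exact hX _ p fun q hq => by rw [ih, if_neg (by omega)]

/-- Reduces the level equation to a recursion in the displacement k from m. A site with k i = 0 does
not contribute, since its predecessor is no longer above m. -/
theorem sum_Splus_mul_translate (g : Fin (n + 1) → Config n → ℝ) (m : Config n) {G : Vec n}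
    (hG : ∀ k : Config n, ∑ i, (if k i = 0 then 0 else
      ((m i : ℝ) + (k i - 1 : ℕ) + 2 * s) *
        (g i (fun j => m j + Function.update k i (k i - 1) j) *
          G (Function.update k i (k i - 1)))) = size k * G k) (p : Config n) :
    (∑ i, Splus s i * diagOp (g i)) (translate m G) p =
      ((size p : ℝ) - size m) * translate m G p := by
  have hterm : ∀ i, (Splus s i * diagOp (g i)) (translate m G) p = if p i = 0 then 0 else
      (((p i - 1 : ℕ) : ℝ) + 2 * s) * (g i (Function.update p i (p i - 1)) *
        translate m G (Function.update p i (p i - 1))) := fun i => rfl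
  rw [LinearMap.sum_apply, Finset.sum_apply]
  simp only [hterm]
  by_cases h : m ≤ p
  · obtain ⟨k, rfl⟩ := exists_eq_add_of_le h
    rw [translate_add, size_add, Nat.cast_add, add_sub_cancel_left, ← hG]
    refine Finset.sum_congr rfl fun i _ => ?_
    by_cases hk : k i = 0
    · rw [if_pos hk]
      split_ifs with hmi
      · rfl
      · have : ¬ m ≤ Function.update (fun i => m i + k i) i (m i + k i - 1) := fun hle => by
          have h1 : m i ≤ Function.update (fun i => m i + k i) i (m i + k i - 1) i := hle i
          rw [Function.update_self] at h1
          have h2 : m i + k i ≠ 0 := hmi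
          omega
        rw [translate, if_neg this, mul_zero, mul_zero]
    · have hq : Function.update (fun i => m i + k i) i (m i + k i - 1) =
          fun j => m j + Function.update k i (k i - 1) j := by
        funext j
        by_cases hj : j = i
        · subst hj
          simp only [Function.update_self]
          omega
        · simp only [Function.update_of_ne hj]
      rw [if_neg hk, if_neg (show ¬ m i + k i = 0 by omega), hq, translate_add,
        show m i + k i - 1 = m i + (k i - 1) by omega, Nat.cast_add]
  · have hz : translate m G p = 0 := if_neg h
    rw [hz, mul_zero]
    refine Finset.sum_eq_zero fun i _ => ?_
    split_ifs with h0
    · rfl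
    · have : ¬ m ≤ Function.update p i (p i - 1) := fun hle => h fun j => by
        have := hle j
        by_cases hj : j = i
        · subst hj
          rw [Function.update_self] at this
          exact this.trans (Nat.sub_le _ _)
        · rwa [Function.update_of_ne hj] at this
      rw [translate, if_neg this, mul_zero, mul_zero]

/-- The product `∏ᵢ θᵢ^{kᵢ} (aᵢ)_{kᵢ} / kᵢ!`. -/
def risingSeries {N : ℕ} (θ a : Fin N → ℝ) (k : Fin N → ℕ) : ℝ :=
  ∏ i, θ i ^ k i * (rising (a i) (k i) / (k i).factorial)

theorem risingSeries_succ {N : ℕ} (θ a : Fin (N + 1) → ℝ) (k : Fin (N + 1) → ℕ) :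
    risingSeries θ a k = θ 0 ^ k 0 * (rising (a 0) (k 0) / (k 0).factorial) *
      risingSeries (fun i => θ i.succ) (fun i => a i.succ) fun i => k i.succ :=
  Fin.prod_univ_succ _

/-- Peel off site 0. Let t + 1 be its occupation, K the sum of the others and c = c_0. The other
sites contribute K(c + K - 1) and site 0 contributes (t + 1)(c + t + 2K); together these are (t + 1
+ K)(c + K + t). -/
theorem risingSeries_mul_risingProd_recursion {N : ℕ} (a c : Fin N → ℝ) (k : Fin N → ℕ) :
    ∑ i, (if k i = 0 then 0 else (a i + (k i - 1 : ℕ)) *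
      ((c i + (k i - 1 : ℕ) + 2 * ∑ j ∈ Ioi i, (k j : ℝ)) *
        (risingSeries 1 a (Function.update k i (k i - 1)) *
          risingProd c (Function.update k i (k i - 1))))) =
      (∑ i, (k i : ℝ)) * (risingSeries 1 a k * risingProd c k) := by
  induction N with
  | zero => simp
  | succ N ih =>
    have hs : ∀ i : Fin N, ∀ x, (fun j : Fin N => Function.update k i.succ x j.succ) =
        Function.update (fun j : Fin N => k j.succ) i x := fun i x => by
      funext j
      by_cases hj : j = i
      · subst hj
        simp
      · rw [Function.update_of_ne hj, Function.update_of_ne fun h => hj (Fin.succ_injective _ h)]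
    have h0 : ∀ x, (fun j : Fin N => Function.update k 0 x j.succ) = fun j => k j.succ := fun x => by
      funext j
      rw [Function.update_of_ne (Fin.succ_ne_zero j)]
    have hs0 : ∀ i : Fin N, ∀ x, Function.update k i.succ x 0 = k 0 := fun i x =>
      Function.update_of_ne (Fin.succ_ne_zero i).symm _ _
    specialize ih (fun i => a i.succ) (fun i => c i.succ) fun i => k i.succ
    set K := ∑ j : Fin N, (k j.succ : ℝ) with hK
    set G := risingSeries 1 (fun i => a i.succ) (fun i => k i.succ) *
      risingProd (fun i => c i.succ) fun i => k i.succ with hGdef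
    have hF : ∀ k : Fin (N + 1) → ℕ, risingSeries 1 a k * risingProd c k =
        (rising (a 0) (k 0) / (k 0).factorial * rising (c 0 + ∑ j : Fin N, (k j.succ : ℝ)) (k 0)) *
        (risingSeries 1 (fun i => a i.succ) (fun i => k i.succ) *
          risingProd (fun i => c i.succ) fun i => k i.succ) := fun k => by
      rw [risingSeries_succ, risingProd_succ]
      simp only [Pi.one_apply, one_pow, one_mul]
      change _ * risingSeries 1 _ _ * _ = _
      ring
    have hrest : ∑ i : Fin N, (if k i.succ = 0 then 0 else (a i.succ + (k i.succ - 1 : ℕ)) *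
        ((c i.succ + (k i.succ - 1 : ℕ) + 2 * ∑ j ∈ Ioi i.succ, (k j : ℝ)) *
        (risingSeries 1 a (Function.update k i.succ (k i.succ - 1)) *
          risingProd c (Function.update k i.succ (k i.succ - 1))))) =
        rising (a 0) (k 0) / (k 0).factorial * rising (c 0 + K - 1) (k 0) * (K * G) := by
      rw [← ih, Finset.mul_sum]
      refine Finset.sum_congr rfl fun i _ => ?_
      by_cases hki : k i.succ = 0
      · simp [hki]
      · have hsum : ∑ j : Fin N, ((Function.update k i.succ (k i.succ - 1) j.succ : ℕ) : ℝ) = K - 1 := by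
          have h1 := congrFun (hs i (k i.succ - 1))
          simp only [h1]
          rw [hK, ← Finset.add_sum_erase _ _ (Finset.mem_univ i),
            ← Finset.add_sum_erase _ (fun j : Fin N => (k j.succ : ℝ)) (Finset.mem_univ i),
            Function.update_self, Nat.cast_sub (by omega)]
          rw [Finset.sum_congr rfl fun j hj => by
            rw [Function.update_of_ne (Finset.ne_of_mem_erase hj)]]
          push_cast
          ring
        rw [if_neg hki, if_neg hki, hF, hs0, hs, hsum, sum_Ioi_succ fun j => (k j : ℝ),
          add_sub_assoc]
        ring
    rw [Fin.sum_univ_succ, hrest, Fin.sum_univ_succ, ← hK, hF k, ← hK, ← hGdef, sum_Ioi_zero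
      fun j => (k j : ℝ), ← hK]
    rcases Nat.eq_zero_or_pos (k 0) with hk | hk
    · simp [hk]
    · obtain ⟨t, ht⟩ := Nat.exists_eq_add_of_le' hk
      rw [if_neg hk.ne', hF, h0, Function.update_self, ← hGdef]
      have h3 : ∑ j : Fin N, ((Function.update k 0 (k 0 - 1) j.succ : ℕ) : ℝ) = K := by
        rw [hK]
        exact Finset.sum_congr rfl fun j _ => by
          rw [Function.update_of_ne (Fin.succ_ne_zero j)]
      have h4 : rising (c 0 + K - 1) (t + 1) = (c 0 + K - 1) * rising (c 0 + K) t := by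
        rw [rising_succ', sub_add_cancel]
      rw [h3, ht, Nat.add_sub_cancel, h4, rising_succ, rising_succ, Nat.factorial_succ]
      have h5 : ((t : ℝ) + 1) ≠ 0 := by positivity
      push_cast
      field_simp
      ring

theorem risingSeries_recursion {N : ℕ} (θ a : Fin N → ℝ) (k : Fin N → ℕ) :
    ∑ i, (if k i = 0 then 0 else (a i + (k i - 1 : ℕ)) *
      (θ i * risingSeries θ a (Function.update k i (k i - 1)))) =
      (∑ i, (k i : ℝ)) * risingSeries θ a k := by
  rw [Finset.sum_mul]
  refine Finset.sum_congr rfl fun i _ => ?_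
  split_ifs with h
  · simp [h]
  · obtain ⟨t, ht⟩ := Nat.exists_eq_succ_of_ne_zero h
    rw [risingSeries, risingSeries, ← Finset.mul_prod_erase _ _ (Finset.mem_univ i),
      ← Finset.mul_prod_erase _ (fun i => θ i ^ k i * (rising (a i) (k i) / (k i).factorial))
        (Finset.mem_univ i), Function.update_self,
      Finset.prod_congr rfl fun j hj => by rw [Function.update_of_ne (Finset.ne_of_mem_erase hj)],
      ht, Nat.succ_sub_one, Nat.succ_eq_add_one, rising_succ, pow_succ, Nat.factorial_succ]
    have h5 : ((t : ℝ) + 1) ≠ 0 := by positivity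
    push_cast
    field_simp

theorem cast_size (k : Config n) : (size k : ℝ) = ∑ i, (k i : ℝ) := Nat.cast_sum _ _

theorem risingSeries_zero {N : ℕ} (θ a : Fin N → ℝ) : risingSeries θ a 0 = 1 := by
  simp [risingSeries]

theorem translate_self (m : Config n) (G : Vec n) : translate m G m = G 0 :=
  translate_add m 0 G

/-! ### Closed forms of the raising exponentials and of the charge -/

theorem sum_Splus_pow_ket (θ : Fin (n + 1) → ℝ) (m : Config n) (K : ℕ) (p : Config n) :
    ((∑ i, θ i • Splus s i) ^ K) (ket m) p = if size p = size m + K then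
      (K.factorial : ℝ) * translate m (risingSeries θ fun i => m i + 2 * s) p else 0 := by
  have hX : (∑ i, θ i • Splus s i) = ∑ i, Splus s i * diagOp fun _ : Config n => θ i :=
    Finset.sum_congr rfl fun i _ => LinearMap.ext fun v => by
      have : diagOp (fun _ : Config n => θ i) v = θ i • v := rfl
      rw [Module.End.mul_apply, this, map_smul, LinearMap.smul_apply]
  refine pow_apply_ket (Raises.sum fun i _ => (raises_Splus s i).smul _) (fun p => ?_) ?_
    (fun p h1 h2 => translate_eq_zero _ h1 h2) K p
  · rw [hX]
    refine sum_Splus_mul_translate _ m (fun k => ?_) p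
    rw [cast_size, ← risingSeries_recursion]
    refine Finset.sum_congr rfl fun i _ => ?_
    split_ifs
    · rfl
    · ring
  · rw [translate_self]
    exact risingSeries_zero _ _

theorem gradedExp_sum_Splus_ket (θ : Fin (n + 1) → ℝ) (m p : Config n) :
    gradedExp (∑ i, θ i • Splus s i) (ket m) p =
      translate m (risingSeries θ fun i => m i + 2 * s) p := by
  rw [gradedExp, gradedSum_apply]
  simp only [LinearMap.smul_apply, Pi.smul_apply, smul_eq_mul, sum_Splus_pow_ket]
  by_cases h : size m ≤ size p
  · rw [Finset.sum_eq_single (size p - size m), if_pos (by omega),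
      inv_mul_cancel_left₀ (by positivity)]
    · intro k _ hk
      rw [if_neg (by omega), mul_zero]
    · intro hk
      exact absurd (Finset.mem_range.2 (by omega)) hk
  · have : ¬ m ≤ p := fun hle => h (Finset.sum_le_sum fun i _ => hle i)
    rw [translate, if_neg this]
    exact Finset.sum_eq_zero fun k _ => by rw [if_neg (by omega), mul_zero]

theorem Qplus_pow_ket (m : Config n) (K : ℕ) (p : Config n) :
    (Qplus s ^ K) (ket m) p = if size p = size m + K then
      (K.factorial : ℝ) * translate m (fun k => risingSeries 1 (fun i => m i + 2 * s) k *
        risingProd (fun i => chargeCoeff s i m) k) p else 0 := by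
  refine pow_apply_ket (raises_Qplus s) (fun p => ?_) ?_
    (fun p h1 h2 => translate_eq_zero _ h1 h2) K p
  · rw [Qplus_eq]
    refine sum_Splus_mul_translate _ m (fun k => ?_) p
    rw [cast_size, ← risingSeries_mul_risingProd_recursion]
    refine Finset.sum_congr rfl fun i _ => ?_
    split_ifs
    · rfl
    · have hc : chargeCoeff s i (fun j => m j + Function.update k i (k i - 1) j) =
          chargeCoeff s i m + (k i - 1 : ℕ) + 2 * ∑ j ∈ Ioi i, (k j : ℝ) := by
        have : ∑ j ∈ Ioi i, (((m j + Function.update k i (k i - 1) j : ℕ) : ℝ) + s) =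
            ∑ j ∈ Ioi i, ((m j : ℝ) + s) + ∑ j ∈ Ioi i, (k j : ℝ) := by
          rw [← Finset.sum_add_distrib]
          refine Finset.sum_congr rfl fun j hj => ?_
          rw [Function.update_of_ne (Finset.mem_Ioi.1 hj).ne']
          push_cast
          ring
        rw [chargeCoeff, this, Function.update_self, chargeCoeff]
        push_cast
        ring
      rw [hc]
      ring
  · rw [translate_self, risingSeries_zero, risingProd]
    simp

theorem nonlocalEnd_ket (hs : 0 < s) (Δ : ℝ) (m p : Config n) :
    nonlocalEnd s Δ (ket m) p = translate m (fun k => Δ ^ size k *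
      (risingSeries 1 (fun i => m i + 2 * s) k * risingProd (fun i => chargeCoeff s i m) k /
        rising (weight s m) (size k))) p := by
  rw [nonlocalEnd, gradedSum_apply]
  simp only [LinearMap.smul_apply, Pi.smul_apply, smul_eq_mul, nonlocalCoeff_ket hs, Qplus_pow_ket]
  by_cases h : m ≤ p
  · obtain ⟨k, rfl⟩ := exists_eq_add_of_le h
    rw [translate_add, translate_add, size_add, Finset.sum_eq_single (size k), if_pos rfl, mul_inv]
    · field_simp
    · intro l _ hl
      rw [if_neg (by omega), mul_zero, mul_zero]
    · intro hk
      exact absurd (Finset.mem_range.2 (by omega)) hk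
  · rw [translate, translate, if_neg h, if_neg h]
    exact Finset.sum_eq_zero fun k _ => by
      split_ifs <;> simp

/-! ## The non-local transformation as a mixture -/

open MeasureTheory in
/-- On a basis vector, the non-local transformation is a mixture of exponentials of raising
operators with inhomogeneous parameters. -/
theorem exists_mixture (hs : 0 < s) (m : Config n) (a Δ : ℝ) :
    ∃ (Ω : Type) (_ : MeasurableSpace Ω) (μ : Measure Ω) (_ : IsProbabilityMeasure μ)
      (X : Fin (n + 1) → Ω → ℝ), (∀ i, Measurable (X i)) ∧ (∀ i ω, X i ω ∈ Set.Icc (0 : ℝ) 1) ∧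
      ∀ p, gradedExp (a • SplusTot s) (nonlocalEnd s Δ (ket m)) p =
        ∫ ω, translate m (risingSeries (fun i => a + Δ * X i ω) fun i => m i + 2 * s) p ∂μ := by
  have hc0 : ∀ i, 0 < chargeCoeff s i m := fun i => by
    rw [chargeCoeff]
    positivity
  have hw : weight s m = chargeCoeff s 0 m + (m 0 + 2 * s) := weight_eq_chargeCoeff m
  -- For i < j the coefficient at i counts twice the spin m_j + s, so the difference is at least m_i
  -- + m_j + 2s. This ordering makes the charge coefficients admissible parameters of the Dirichlet
  -- law.
  have hanti : StrictAnti fun i => chargeCoeff s i m := fun i j hij => by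
    have h1 : insert j (Ioi j) ⊆ Ioi i := fun l hl => by
      rw [Finset.mem_insert, Finset.mem_Ioi] at hl
      rw [Finset.mem_Ioi]
      rcases hl with rfl | hl
      · exact hij
      · exact hij.trans hl
    have h2 := Finset.sum_le_sum_of_subset_of_nonneg (f := fun l => (m l : ℝ) + s) h1
      fun _ _ _ => by positivity
    rw [Finset.sum_insert (by simp)] at h2
    simp only [chargeCoeff]
    have : (0 : ℝ) ≤ m i := by positivity
    have : (0 : ℝ) ≤ m j := by positivity
    linarith
  have hle : ∀ i, chargeCoeff s i m < weight s m := fun i => by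
    have h1 : chargeCoeff s i m ≤ chargeCoeff s 0 m := hanti.antitone (Fin.zero_le i)
    have : (0 : ℝ) < m 0 + 2 * s := by positivity
    linarith
  obtain ⟨Ω, _, μ, _, X, hX, hX1, hmom⟩ := exists_moments (n + 1) (fun i => chargeCoeff s i m)
    (weight s m) ((hc0 0).trans (hle 0)) hc0 hle hanti
  refine ⟨Ω, inferInstance, μ, inferInstance, X, hX, hX1, fun p => ?_⟩
  have hmono : ∀ k : Config n, Integrable (fun ω => ∏ i, X i ω ^ k i) μ := fun k => by
    refine Integrable.of_bound (C := 1) (Measurable.aestronglyMeasurable (by fun_prop))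
      (ae_of_all _ fun ω => ?_)
    rw [Real.norm_of_nonneg (Finset.prod_nonneg fun i _ => pow_nonneg (hX1 i ω).1 _)]
    exact Finset.prod_le_one (fun i _ => pow_nonneg (hX1 i ω).1 _)
      fun i _ => pow_le_one₀ (hX1 i ω).1 (hX1 i ω).2
  have hser : ∀ ω k, risingSeries (fun i => Δ * X i ω) (fun i => (m i : ℝ) + 2 * s) k =
      Δ ^ size k * risingSeries 1 (fun i => (m i : ℝ) + 2 * s) k * ∏ i, X i ω ^ k i := by
    intro ω k
    rw [risingSeries, risingSeries, pow_size, ← Finset.prod_mul_distrib, ← Finset.prod_mul_distrib]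
    exact Finset.prod_congr rfl fun i _ => by
      rw [mul_pow, Pi.one_apply, one_pow]
      ring
  have hint : ∀ q, Integrable (fun ω => translate m
      (risingSeries (fun i => Δ * X i ω) fun i => m i + 2 * s) q) μ := fun q => by
    by_cases h : m ≤ q
    · obtain ⟨k, rfl⟩ := exists_eq_add_of_le h
      simp only [translate_add, hser]
      exact (hmono k).const_mul _
    · simp only [translate, if_neg h]
      exact integrable_zero _ _ _
  have hval : ∀ q, nonlocalEnd s Δ (ket m) q = ∫ ω, translate m
      (risingSeries (fun i => Δ * X i ω) fun i => m i + 2 * s) q ∂μ := fun q => by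
    rw [nonlocalEnd_ket hs]
    by_cases h : m ≤ q
    · obtain ⟨k, rfl⟩ := exists_eq_add_of_le h
      simp only [translate_add, hser]
      rw [integral_const_mul, hmom, size]
      ring
    · simp only [translate, if_neg h, integral_zero]
  have hR : Raises 1 (a • SplusTot (n := n) s) := (raises_SplusTot s).smul a
  -- A row of e^{aS₊} is finite, so it commutes with the integral; under the integral the exponents
  -- add to a + ΔX_i at site i.
  rw [gradedExp, gradedSum_apply_eq_sum hR.exp_coeff]
  simp only [hval, ← integral_mul_const]
  rw [← integral_finsetSum _ fun q _ => (hint q).mul_const _]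
  refine integral_congr_ae (ae_of_all _ fun ω => ?_)
  have hsum : a • SplusTot s + ∑ i, (Δ * X i ω) • Splus s i =
      ∑ i, (a + Δ * X i ω) • Splus (n := n) s i := by
    rw [SplusTot, Finset.smul_sum, ← Finset.sum_add_distrib]
    exact Finset.sum_congr rfl fun i _ => (add_smul _ _ _).symm
  have hcomm : Commute (a • SplusTot s) (∑ i, (Δ * X i ω) • Splus (n := n) s i) := by
    refine Commute.smul_left (Commute.sum_right _ _ _ fun j _ => Commute.smul_right ?_ _) _
    exact Commute.sum_left _ _ _ fun i _ => commute_Splus s i j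
  simp only [← gradedExp_sum_Splus_ket]
  rw [← hsum, ← gradedExp_add hR hcomm, Module.End.mul_apply]
  exact (gradedSum_apply_eq_sum hR.exp_coeff _ p).symm

/-! ## Negative binomial vectors -/

theorem rising_div_factorial (x : ℝ) (k : ℕ) :
    Ring.choose (x + k - 1) k = rising x k / k.factorial := by
  have h1 : Ring.choose (x + k - 1) k = Ring.multichoose x k := by
    rw [Ring.choose]
    congr 1
    ring
  have h2 := Ring.factorial_nsmul_multichoose_eq_ascPochhammer x k
  have h3 : ((ascPochhammer ℕ k).smeval x : ℝ) = rising x k := by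
    rw [Polynomial.ascPochhammer_smeval_eq_eval]
    clear h1 h2
    induction k with
    | zero => simp
    | succ k ih => rw [ascPochhammer_succ_eval, rising_succ, ih]
  rw [h1, eq_div_iff (by positivity), ← h3, ← h2, nsmul_eq_mul, mul_comm]

theorem hasSum_rising (x : ℝ) {β : ℝ} (h0 : 0 ≤ β) (h1 : β < 1) :
    HasSum (fun k : ℕ => β ^ k * (rising x k / k.factorial)) ((1 - β) ^ (-x)) := by
  have h := (Real.one_div_one_sub_rpow_hasFPowerSeriesOnBall_zero x).hasSum (y := β) (by
    rw [Metric.mem_eball, edist_dist, dist_zero_right, Real.norm_of_nonneg h0]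
    exact_mod_cast (ENNReal.ofReal_lt_one).2 h1)
  rw [zero_add, one_div, ← Real.rpow_neg (by linarith)] at h
  convert! h using 1
  funext k
  rw [FormalMultilinearSeries.ofScalars_apply_eq, rising_div_factorial, smul_eq_mul, mul_comm]

theorem hasSum_prod {N : ℕ} {f : Fin N → ℕ → ℝ} {S : Fin N → ℝ} (h0 : ∀ i k, 0 ≤ f i k)
    (h : ∀ i, HasSum (f i) (S i)) :
    HasSum (fun k : Fin N → ℕ => ∏ i, f i (k i)) (∏ i, S i) := by
  induction N with
  | zero => simp
  | succ N ih =>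
    have hg := ih (fun i k => h0 i.succ k) fun i => h i.succ
    have hnn : 0 ≤ fun k : Fin N → ℕ => ∏ i, f i.succ (k i) := fun k =>
      Finset.prod_nonneg fun i _ => h0 i.succ _
    have hn0 : 0 ≤ f 0 := fun k => h0 0 k
    have hsm := Summable.mul_of_nonneg (h 0).summable hg.summable hn0 hnn
    have h1 := HasSum.mul (h 0) hg hsm
    rw [Fin.prod_univ_succ, ← (Fin.consEquiv fun _ : Fin (N + 1) => ℕ).hasSum_iff]
    convert! h1 using 1
    funext x
    simp [Fin.prod_univ_succ]

theorem risingSeries_nonneg {N : ℕ} {θ a : Fin N → ℝ} (hθ : ∀ i, 0 ≤ θ i) (ha : ∀ i, 0 < a i)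
    (k : Fin N → ℕ) : 0 ≤ risingSeries θ a k :=
  Finset.prod_nonneg fun i _ => mul_nonneg (pow_nonneg (hθ i) _)
    (div_nonneg (rising_pos (ha i) _).le (Nat.cast_nonneg _))

/-- The series still converges with β replaced by βr for some r > 1, and each of its nonnegative
terms is bounded by the sum. -/
theorem risingSeries_mem_decaying {β : ℝ} (h0 : 0 ≤ β) (h1 : β < 1) {a : Fin (n + 1) → ℝ}
    (ha : ∀ i, 0 < a i) : risingSeries (fun _ => β) a ∈ decaying n := by
  obtain ⟨r, hr, hβr⟩ : ∃ r : ℝ, 1 < r ∧ β * r < 1 := by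
    -- This r exceeds 1 as β < 1, and βr < 1 as 2β < 1 + β.
    refine ⟨2 / (1 + β), by rw [lt_div_iff₀ (by linarith)]; linarith, ?_⟩
    rw [← mul_div_assoc, div_lt_one (by linarith)]
    linarith
  have hr0 : 0 < r := by linarith
  have h := hasSum_prod (N := n + 1) (f := fun i k => (β * r) ^ k * (rising (a i) k / k.factorial))
    (fun i k => mul_nonneg (by positivity) (div_nonneg (rising_pos (ha i) _).le (by positivity)))
    fun i => hasSum_rising (a i) (by positivity) hβr
  refine ⟨r, hr, ∏ i, (1 - β * r) ^ (-a i), fun m => ?_⟩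
  rw [abs_of_nonneg (risingSeries_nonneg (fun _ => h0) ha m)]
  refine le_of_eq_of_le ?_ (le_hasSum h m fun k _ => Finset.prod_nonneg fun i _ =>
    mul_nonneg (by positivity) (div_nonneg (rising_pos (ha i) _).le (by positivity)))
  rw [risingSeries, pow_size, ← Finset.prod_mul_distrib]
  exact Finset.prod_congr rfl fun i _ => by rw [mul_pow]; ring

/-- The product of negative binomial distributions with shapes `aᵢ` and odds `θᵢ`. -/
def negBin (θ a : Fin (n + 1) → ℝ) : Vec n := fun p =>
  ∏ i, (1 + θ i) ^ (-a i) * ((θ i / (1 + θ i)) ^ p i * (rising (a i) (p i) / (p i).factorial))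

theorem negBin_nonneg {θ a : Fin (n + 1) → ℝ} (hθ : ∀ i, 0 ≤ θ i) (ha : ∀ i, 0 < a i)
    (p : Config n) : 0 ≤ negBin θ a p := by
  refine Finset.prod_nonneg fun i _ => ?_
  have := hθ i
  have := (rising_pos (ha i) (p i)).le
  positivity

/-- A bound uniform in θ, which provides the dominating decaying vector for mixtures: the prefactor
is at most one and θ/(1 + θ) is increasing. -/
theorem negBin_le {T : ℝ} {θ a : Fin (n + 1) → ℝ} (hθ : ∀ i, 0 ≤ θ i) (hT : ∀ i, θ i ≤ T)
    (ha : ∀ i, 0 < a i) (p : Config n) :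
    negBin θ a p ≤ risingSeries (fun _ => T / (1 + T)) a p := by
  refine Finset.prod_le_prod (fun i _ => ?_) fun i _ => ?_
  · have := hθ i
    have := (rising_pos (ha i) (p i)).le
    positivity
  · have h1 := hθ i
    have h2 := hT i
    have h3 := (rising_pos (ha i) (p i)).le
    have h4 : (1 + θ i) ^ (-a i) ≤ 1 :=
      Real.rpow_le_one_of_one_le_of_nonpos (by linarith) (by linarith [ha i])
    have h5 : θ i / (1 + θ i) ≤ T / (1 + T) := by
      rw [div_le_div_iff₀ (by linarith) (by linarith)]
      nlinarith
    calc _ ≤ 1 * ((θ i / (1 + θ i)) ^ p i * (rising (a i) (p i) / (p i).factorial)) := by gcongr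
      _ ≤ _ := by
        rw [one_mul]
        gcongr

theorem mem_decaying_of_abs_le {v w : Vec n} (hw : w ∈ decaying n) (h : ∀ p, |v p| ≤ |w p|) :
    v ∈ decaying n := by
  obtain ⟨r, hr, C, hC⟩ := hw
  exact ⟨r, hr, C, fun m => (mul_le_mul_of_nonneg_right (h m) (by positivity)).trans (hC m)⟩

/-- Factorial moments of the negative binomial law. Splitting off the first j factors of the rising
factorial leaves the binomial series of exponent a + j, whose value (1 + θ)^(a + j) cancels all
powers of 1 + θ. -/
theorem hasSum_choose_mul_rising {θ a : ℝ} (hθ : 0 ≤ θ) (j : ℕ) :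
    HasSum (fun p : ℕ => (p.choose j : ℝ) *
      ((1 + θ) ^ (-a) * ((θ / (1 + θ)) ^ p * (rising a p / p.factorial))))
      (θ ^ j * (rising a j / j.factorial)) := by
  set β := θ / (1 + θ) with hβ
  have h0 : 0 ≤ β := by positivity
  have h1 : β < 1 := by rw [hβ, div_lt_one (by linarith)]; linarith
  have h2 : 1 - β = (1 + θ)⁻¹ := by rw [hβ]; field_simp; ring
  have h := (hasSum_rising (a + j) h0 h1).mul_left
    ((1 + θ) ^ (-a) * (β ^ j * (rising a j / j.factorial)))
  have hz : ∑ p ∈ range j, (p.choose j : ℝ) *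
      ((1 + θ) ^ (-a) * (β ^ p * (rising a p / p.factorial))) = 0 :=
    Finset.sum_eq_zero fun p hp => by
      rw [Nat.choose_eq_zero_of_lt (Finset.mem_range.1 hp), Nat.cast_zero, zero_mul]
  rw [← hasSum_nat_add_iff' j, hz, sub_zero]
  convert! h using 1
  · funext k
    have h3 : ((k + j).choose j : ℝ) = (k + j).factorial / (k.factorial * j.factorial) := by
      rw [Nat.add_choose, Nat.cast_div (Nat.factorial_mul_factorial_dvd_factorial_add _ _)
        (by positivity)]
      push_cast
      rfl
    rw [h3, add_comm k j, rising_add, pow_add]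
    field_simp
  · have h4 : (0 : ℝ) < 1 + θ := by linarith
    rw [h2, Real.inv_rpow h4.le, ← Real.rpow_neg h4.le, neg_neg, hβ, div_pow,
      show a + (j : ℝ) = -(-a) + j by ring, Real.rpow_add h4, Real.rpow_natCast,
      Real.rpow_neg h4.le (-a)]
    have := (Real.rpow_pos_of_pos h4 (-a)).ne'
    field_simp

theorem hasSum_binom_mul_negBin {θ a : Fin (n + 1) → ℝ} (hθ : ∀ i, 0 ≤ θ i) (ha : ∀ i, 0 < a i)
    (j : Config n) : HasSum (fun p => binom univ j p * negBin θ a p) (risingSeries θ a j) := by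
  have h := hasSum_prod (N := n + 1) (f := fun i p => (p.choose (j i) : ℝ) *
    ((1 + θ i) ^ (-a i) * ((θ i / (1 + θ i)) ^ p * (rising (a i) p / p.factorial))))
    (fun i p => by
      have := hθ i
      have := (rising_pos (ha i) p).le
      positivity)
    fun i => hasSum_choose_mul_rising (hθ i) (j i)
  convert! h using 1
  funext p
  rw [binom, negBin, ← Finset.prod_mul_distrib]
  exact Finset.prod_congr rfl fun i _ => by rw [if_pos (Finset.mem_univ i)]

theorem div_one_add_lt_one {T : ℝ} (hT : 0 ≤ T) : T / (1 + T) < 1 := by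
  rw [div_lt_one (by linarith)]
  linarith

theorem negBin_mem_decaying {T : ℝ} {θ a : Fin (n + 1) → ℝ} (hθ : ∀ i, 0 ≤ θ i)
    (hT : ∀ i, θ i ≤ T) (ha : ∀ i, 0 < a i) : negBin θ a ∈ decaying n := by
  have hT0 : 0 ≤ T := (hθ 0).trans (hT 0)
  refine mem_decaying_of_abs_le (risingSeries_mem_decaying (β := T / (1 + T)) (by positivity)
    (div_one_add_lt_one hT0) ha) fun p => ?_
  rw [abs_of_nonneg (negBin_nonneg hθ ha p), abs_of_nonneg
    (risingSeries_nonneg (fun _ => by positivity) ha p)]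
  exact negBin_le hθ hT ha p

/-! ## The range of the lowering exponential -/

/-- The range of `e^{S₋}` on the vectors of exponential decay. -/
def lowerRange (n : ℕ) : Submodule ℝ (Vec n) := LinearMap.range (expDec (lowering univ)).toFun

theorem mem_lowerRange {g : Vec n} :
    g ∈ lowerRange n ↔ ∃ u ∈ decaying n, lowered univ u = g := by
  constructor
  · rintro ⟨u, rfl⟩
    exact ⟨u, expDec_domain univ ▸ u.2, (expDec_apply univ u).symm⟩
  · rintro ⟨u, hu, rfl⟩
    exact ⟨⟨u, (expDec_domain univ).symm ▸ hu⟩, expDec_apply univ _⟩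

theorem shift_mem_decaying (i : Fin (n + 1)) {v : Vec n} (hv : v ∈ decaying n) :
    shift i v ∈ decaying n := by
  obtain ⟨r, hr, C, hC⟩ := hv
  have hr0 : 0 < r := by linarith
  refine ⟨r, hr, r * C, fun p => ?_⟩
  have hC0 : 0 ≤ C := (by positivity : (0 : ℝ) ≤ |v 0| * r ^ size (0 : Config n)).trans (hC 0)
  by_cases h : p i = 0
  · have : shift i v p = 0 := if_pos h
    rw [this, abs_zero, zero_mul]
    positivity
  · have h1 : shift i v p = v (Function.update p i (p i - 1)) := if_neg h
    have h2 := size_update p i (p i - 1)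
    rw [h1, show size p = size (Function.update p i (p i - 1)) + 1 by omega, pow_succ]
    nlinarith [hC (Function.update p i (p i - 1))]

theorem binom_update_add_one (i : Fin (n + 1)) (j m : Config n) :
    binom univ j (Function.update m i (m i + 1)) =
      binom univ j m + if j i = 0 then 0 else binom univ (Function.update j i (j i - 1)) m := by
  obtain ⟨c, h1, h2⟩ := exists_binom_update (Finset.mem_univ i) j m
  have h3 : binom univ j m = ((m i).choose (j i) : ℝ) * c := by
    rw [← h1, Function.update_eq_self]
  rw [h1, h2, h3]
  split_ifs with h
  · simp [h]
  · obtain ⟨t, ht⟩ := Nat.exists_eq_succ_of_ne_zero h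
    rw [ht, Nat.succ_eq_add_one, Nat.choose_succ_succ', Nat.add_sub_cancel]
    push_cast
    ring

/-- Pascal's rule: the binomial transform carries the shift E to 1 + E. -/
theorem lowered_shift (i : Fin (n + 1)) {v : Vec n} (hv : v ∈ decaying n) :
    lowered univ (shift i v) = lowered univ v + shift i (lowered univ v) := by
  funext j
  have hinj : Function.Injective fun m : Config n => Function.update m i (m i + 1) := by
    intro a b hab
    funext l
    have h1 := congrFun hab l
    by_cases hl : l = i
    · subst hl
      simp only [Function.update_self] at h1
      omega
    · simpa only [Function.update_of_ne hl] using h1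
  have hsum : ∀ j, HasSum (fun m => binom univ j m * v m) (lowered univ v j) :=
    fun j => ((subExp_binom univ j).summable hv).hasSum
  have h1 : HasSum (fun m => binom univ j (Function.update m i (m i + 1)) * v m)
      (lowered univ v j + shift i (lowered univ v) j) := by
    simp only [binom_update_add_one, add_mul]
    refine (hsum j).add ?_
    change HasSum _ (if j i = 0 then 0 else lowered univ v (Function.update j i (j i - 1)))
    split_ifs with h
    · simp
    · exact hsum _
  refine HasSum.tsum_eq (?_ : HasSum (fun p => binom univ j p * shift i v p) _)
  rw [← hinj.hasSum_iff]
  · convert! h1 using 1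
    funext m
    have : shift i v (Function.update m i (m i + 1)) = v m := by
      simp [shift]
    rw [Function.comp_apply, this]
  · intro p hp
    have : shift i v p = 0 := if_pos (by
      by_contra h
      refine hp ⟨Function.update p i (p i - 1), ?_⟩
      simp only [Function.update_self, Function.update_idem]
      rw [Nat.sub_add_cancel (by omega), Function.update_eq_self])
    rw [this, mul_zero]

theorem shift_mem_lowerRange (i : Fin (n + 1)) {g : Vec n} (hg : g ∈ lowerRange n) :
    shift i g ∈ lowerRange n := by
  obtain ⟨u, hu, rfl⟩ := mem_lowerRange.1 hg
  -- The transform carries E - 1 to E, so this is the preimage of the shifted vector.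
  refine mem_lowerRange.2 ⟨shift i u - u, sub_mem (shift_mem_decaying i hu) hu, ?_⟩
  rw [lowered_sub univ (shift_mem_decaying i hu) hu, lowered_shift i hu, add_sub_cancel_left]

theorem translate_update (i : Fin (n + 1)) (m : Config n) (G : Vec n) :
    translate (Function.update m i (m i + 1)) G = shift i (translate m G) := by
  funext p
  by_cases h0 : p i = 0
  · have h1 : shift i (translate m G) p = 0 := if_pos h0
    have h2 : ¬ Function.update m i (m i + 1) ≤ p := fun hle => by
      have := hle i
      rw [Function.update_self, h0] at this
      exact Nat.not_succ_le_zero _ this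
    rw [h1, translate, if_neg h2]
  · have h1 : shift i (translate m G) p = translate m G (Function.update p i (p i - 1)) :=
      if_neg h0
    have h2 : Function.update m i (m i + 1) ≤ p ↔ m ≤ Function.update p i (p i - 1) := by
      rw [update_le_iff, le_update_iff]
      exact and_congr_left fun _ => by omega
    rw [h1, translate, translate]
    by_cases h : m ≤ Function.update p i (p i - 1)
    · rw [if_pos h, if_pos (h2.2 h)]
      congr 1
      funext l
      by_cases hl : l = i
      · subst hl
        simp only [Function.update_self]
        omega
      · simp only [Function.update_of_ne hl]
    · rw [if_neg h, if_neg (h2.not.2 h)]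

theorem translate_shift (i : Fin (n + 1)) (m : Config n) (G : Vec n) :
    translate m (shift i G) = shift i (translate m G) := by
  rw [← translate_update]
  funext p
  by_cases h : m ≤ p
  · obtain ⟨k, rfl⟩ := exists_eq_add_of_le h
    rw [translate_add]
    by_cases hk : k i = 0
    · have h1 : shift i G k = 0 := if_pos hk
      have h2 : ¬ Function.update m i (m i + 1) ≤ fun i => m i + k i := fun hle => by
        have h3 : Function.update m i (m i + 1) i ≤ m i + k i := hle i
        rw [Function.update_self] at h3
        omega
      rw [h1, translate, if_neg h2]
    · have h1 : shift i G k = G (Function.update k i (k i - 1)) := if_neg hk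
      have h2 : (fun l => m l + k l) = fun l =>
          Function.update m i (m i + 1) l + Function.update k i (k i - 1) l := by
        funext l
        by_cases hl : l = i
        · subst hl
          simp only [Function.update_self]
          omega
        · simp only [Function.update_of_ne hl]
      rw [h1, h2, translate_add]
  · have h2 : ¬ Function.update m i (m i + 1) ≤ p := fun hle =>
      h ((le_update_self_iff.2 (Nat.le_succ _)).trans hle)
    rw [translate, translate, if_neg h, if_neg h2]

theorem translate_sub_smul (m : Config n) (G G' : Vec n) (c : ℝ) :
    translate m (G - c • G') = translate m G - c • translate m G' := by
  funext p
  by_cases h : m ≤ p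
  · simp [translate, h]
  · simp [translate, h]

theorem translate_zero (G : Vec n) : translate 0 G = G := by
  funext p
  have h : 0 ≤ p := fun i => Nat.zero_le _
  rw [translate, if_pos h]
  rfl

theorem translate_mem_lowerRange (m : Config n) {g : Vec n} (hg : g ∈ lowerRange n) :
    translate m g ∈ lowerRange n := by
  obtain ⟨k, hk⟩ : ∃ k, size m = k := ⟨_, rfl⟩
  induction k generalizing m with
  | zero =>
    have : m = 0 := funext fun i => Nat.le_zero.1 (hk ▸ le_size m i)
    rwa [this, translate_zero]
  | succ k ih =>
    obtain ⟨i, hi⟩ : ∃ i, m i ≠ 0 := by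
      by_contra! h
      have : size m = 0 := Finset.sum_eq_zero fun i _ => h i
      omega
    have hm : m = Function.update (Function.update m i (m i - 1)) i
        (Function.update m i (m i - 1) i + 1) := by
      rw [Function.update_self, Function.update_idem, Nat.sub_add_cancel (by omega),
        Function.update_eq_self]
    have := size_update m i (m i - 1)
    rw [hm, translate_update]
    exact shift_mem_lowerRange i (ih _ (by omega))

-- By the mixture representation the vector is an average of transforms of negative binomial
-- vectors, moved up by m. The average of the negative binomial vectors themselves decays and is the
-- preimage; moving by m preserves the range.
open MeasureTheory in
theorem exp_nonlocalEnd_ket_mem_lowerRange (hs : 0 < s) {ρL ρR : ℝ} (hL : 0 < ρL) (hR : 0 < ρR)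
    (m : Config n) :
    gradedExp (ρR • SplusTot s) (nonlocalEnd s (ρL - ρR) (ket m)) ∈ lowerRange n := by
  obtain ⟨Ω, _, μ, _, X, hX, hX1, hmix⟩ := exists_mixture hs m ρR (ρL - ρR)
  set θ : Ω → Fin (n + 1) → ℝ := fun ω i => ρR + (ρL - ρR) * X i ω with hθ
  set a : Fin (n + 1) → ℝ := fun i => m i + 2 * s with ha
  have ha0 : ∀ i, 0 < a i := fun i => by positivity
  have hθ0 : ∀ ω i, 0 ≤ θ ω i := fun ω i => by
    have h1 := (hX1 i ω).1
    have h2 := (hX1 i ω).2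
    -- The parameter is a convex combination of the two densities, hence nonnegative; their sum
    -- serves below as a crude common upper bound.
    have : θ ω i = ρR * (1 - X i ω) + ρL * X i ω := by simp only [hθ]; ring
    rw [this]
    have : 0 ≤ 1 - X i ω := by linarith
    positivity
  have hθT : ∀ ω i, θ ω i ≤ ρL + ρR := fun ω i => by
    have h1 := (hX1 i ω).1
    have h2 := (hX1 i ω).2
    simp only [hθ]
    nlinarith
  set B : Vec n := risingSeries (fun _ => (ρL + ρR) / (1 + (ρL + ρR))) a with hB
  have hBd : B ∈ decaying n := risingSeries_mem_decaying (by positivity)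
    (div_one_add_lt_one (by positivity)) ha0
  have hB0 : ∀ p, 0 ≤ B p := risingSeries_nonneg (fun _ => by positivity) ha0
  have hmeas : ∀ p, Measurable fun ω => negBin (θ ω) a p := fun p => by
    simp only [negBin, hθ]
    fun_prop
  have hint : ∀ p, Integrable (fun ω => negBin (θ ω) a p) μ := fun p =>
    Integrable.of_bound (hmeas p).aestronglyMeasurable (B p) (ae_of_all _ fun ω => by
      rw [Real.norm_of_nonneg (negBin_nonneg (hθ0 ω) ha0 p)]
      exact negBin_le (hθ0 ω) (hθT ω) ha0 p)
  set u : Vec n := fun p => ∫ ω, negBin (θ ω) a p ∂μ with hu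
  have huB : ∀ p, |u p| ≤ |B p| := fun p => by
    rw [abs_of_nonneg (integral_nonneg fun ω => negBin_nonneg (hθ0 ω) ha0 p),
      abs_of_nonneg (hB0 p)]
    calc u p ≤ ∫ _ω, B p ∂μ := integral_mono (hint p) (integrable_const _)
          fun ω => negBin_le (hθ0 ω) (hθT ω) ha0 p
      _ = B p := by simp
  have hud : u ∈ decaying n := mem_decaying_of_abs_le hBd huB
  -- Sum and integral are exchanged under the dominating vector B, which is summable against
  -- binomial coefficients.
  have hlow : ∀ j, lowered univ u j = ∫ ω, risingSeries (θ ω) a j ∂μ := fun j => by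
    have h1 : Summable fun p => ∫ ω, ‖binom univ j p * negBin (θ ω) a p‖ ∂μ := by
      refine Summable.of_nonneg_of_le (fun p => integral_nonneg fun ω => norm_nonneg _)
        (fun p => ?_) ((subExp_binom univ j).summable hBd)
      calc _ ≤ ∫ _ω, binom univ j p * B p ∂μ := by
            refine integral_mono ((hint p).const_mul _).norm (integrable_const _) fun ω => ?_
            have h2 := negBin_nonneg (hθ0 ω) ha0 p
            have h3 := binom_nonneg univ j p
            simp only [norm_mul, Real.norm_of_nonneg h2, Real.norm_of_nonneg h3]
            exact mul_le_mul_of_nonneg_left (negBin_le (hθ0 ω) (hθT ω) ha0 p) h3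
        _ = _ := by simp
    have h2 := hasSum_integral_of_summable_integral_norm
      (fun p => (hint p).const_mul (binom univ j p)) h1
    simp only [(hasSum_binom_mul_negBin (hθ0 _) ha0 j).tsum_eq, integral_const_mul] at h2
    exact h2.tsum_eq
  have hfin : gradedExp (ρR • SplusTot s) (nonlocalEnd s (ρL - ρR) (ket m)) =
      translate m (lowered univ u) := by
    funext p
    rw [hmix]
    by_cases h : m ≤ p
    · obtain ⟨k, rfl⟩ := exists_eq_add_of_le h
      simp only [translate_add]
      rw [hlow]
    · simp only [translate, if_neg h, integral_zero]
  rw [hfin]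
  exact translate_mem_lowerRange m (mem_lowerRange.2 ⟨u, hud, rfl⟩)

/-! ### Negative binomial vectors in the domain of P -/

theorem exp_ket_eq_translate (ρ : ℝ) (m : Config n) :
    gradedExp (ρ • SplusTot s) (ket m) =
      translate m (risingSeries (fun _ => ρ) fun i => m i + 2 * s) := by
  funext p
  rw [SplusTot, Finset.smul_sum]
  exact gradedExp_sum_Splus_ket (fun _ => ρ) m p

theorem mapForm_exp_ket (ρL ρR ρ : ℝ) (m : Config n) :
    mapForm n s ρL ρR ρ (gradedExp (ρ • SplusTot s) (ket m)) =
      gradedExp (ρR • SplusTot s) (nonlocalEnd s (ρL - ρR) (ket m)) := by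
  rw [mapForm, Module.End.mul_apply, Module.End.mul_apply, ← Module.End.mul_apply (gradedExp (-_)),
    gradedExp_neg_mul ((raises_SplusTot s).smul ρ), Module.End.one_apply]

/-- In terms of generating functions ∏ (1 - ρx_l)^{-(b_l + 2s)}, multiplication by 1 - ρx_i lowers
the exponent at site i by one. -/
theorem risingSeries_sub_shift (ρ : ℝ) (b : Config n) (i : Fin (n + 1)) :
    risingSeries (fun _ => ρ) (fun l => (Function.update b i (b i + 1) l : ℝ) + 2 * s) -
      ρ • shift i (risingSeries (fun _ => ρ)
        fun l => (Function.update b i (b i + 1) l : ℝ) + 2 * s) =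
      risingSeries (fun _ => ρ) fun l => (b l : ℝ) + 2 * s := by
  funext k
  have hsplit : ∀ (c k : Config n), risingSeries (fun _ => ρ) (fun l => (c l : ℝ) + 2 * s) k =
      ρ ^ k i * (rising (c i + 2 * s) (k i) / (k i).factorial) *
      ∏ l ∈ univ.erase i, ρ ^ k l * (rising (c l + 2 * s) (k l) / (k l).factorial) := fun c k =>
    (Finset.mul_prod_erase _ (fun l => ρ ^ k l * (rising (c l + 2 * s) (k l) / (k l).factorial))
      (Finset.mem_univ i)).symm
  have hc : ∀ k : Config n, ∏ l ∈ univ.erase i, ρ ^ k l *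
      (rising ((Function.update b i (b i + 1) l : ℕ) + 2 * s) (k l) / (k l).factorial) =
      ∏ l ∈ univ.erase i, ρ ^ k l * (rising (b l + 2 * s) (k l) / (k l).factorial) := fun k =>
    Finset.prod_congr rfl fun l hl => by rw [Function.update_of_ne (Finset.ne_of_mem_erase hl)]
  rw [Pi.sub_apply, Pi.smul_apply, smul_eq_mul, hsplit, hsplit, hc, Function.update_self]
  by_cases h : k i = 0
  · have : shift i (risingSeries (fun _ => ρ)
        fun l => (Function.update b i (b i + 1) l : ℝ) + 2 * s) k = 0 := if_pos h
    rw [this, h]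
    simp
  · obtain ⟨t, ht⟩ := Nat.exists_eq_succ_of_ne_zero h
    have h1 : shift i (risingSeries (fun _ => ρ)
        fun l => (Function.update b i (b i + 1) l : ℝ) + 2 * s) k =
        risingSeries (fun _ => ρ) (fun l => (Function.update b i (b i + 1) l : ℝ) + 2 * s)
          (Function.update k i (k i - 1)) := if_neg h
    have h2 : ∏ l ∈ univ.erase i, ρ ^ Function.update k i (k i - 1) l *
        (rising (b l + 2 * s) (Function.update k i (k i - 1) l) /
          (Function.update k i (k i - 1) l).factorial) =
        ∏ l ∈ univ.erase i, ρ ^ k l * (rising (b l + 2 * s) (k l) / (k l).factorial) :=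
      Finset.prod_congr rfl fun l hl => by rw [Function.update_of_ne (Finset.ne_of_mem_erase hl)]
    rw [h1, hsplit, hc, h2, Function.update_self, Function.update_self, ht, Nat.succ_eq_add_one,
      Nat.add_sub_cancel, rising_succ, rising_succ' (b i + 2 * s), Nat.factorial_succ,
      show ((b i + 1 : ℕ) : ℝ) + 2 * s = b i + 2 * s + 1 by push_cast; ring]
    have : ((t : ℝ) + 1) ≠ 0 := by positivity
    push_cast
    field_simp
    ring

/-- Induction on size b - size a. For a = b the vector is e^{ρS₊}|a⟩, and mapForm removes this
exponential. Otherwise `risingSeries_sub_shift` expresses it by b lowered at a site i with a_i <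
b_i, and by a shifted vector, that is a raised at i; both have a smaller gap. -/
theorem translate_mem_comap_mapForm (hs : 0 < s) {ρL ρR : ℝ} (hL : 0 < ρL) (hR : 0 < ρR) (ρ : ℝ)
    {a b : Config n} (hab : a ≤ b) :
    translate a (risingSeries (fun _ => ρ) fun i => (b i : ℝ) + 2 * s) ∈
      (lowerRange n).comap (mapForm n s ρL ρR ρ) := by
  have hsz : size a ≤ size b := Finset.sum_le_sum fun i _ => hab i
  obtain ⟨d, hd⟩ := Nat.exists_eq_add_of_le hsz
  induction d generalizing a b with
  | zero =>
    obtain ⟨k, rfl⟩ := exists_eq_add_of_le hab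
    rw [size_add] at hd
    have hk : (fun i => a i + k i) = a := funext fun i => by
      have := le_size k i
      omega
    rw [hk, ← exp_ket_eq_translate, Submodule.mem_comap, mapForm_exp_ket]
    exact exp_nonlocalEnd_ket_mem_lowerRange hs hL hR a
  | succ d ih =>
    obtain ⟨i, hi⟩ : ∃ i, a i < b i := by
      by_contra! h
      have : size b ≤ size a := Finset.sum_le_sum fun i _ => h i
      omega
    obtain ⟨b', rfl⟩ : ∃ b' : Config n, b = Function.update b' i (b' i + 1) :=
      ⟨Function.update b i (b i - 1), by
        rw [Function.update_self, Function.update_idem, Nat.sub_add_cancel (by omega),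
          Function.update_eq_self]⟩
    rw [Function.update_self] at hi
    have hsb := size_update b' i (b' i + 1)
    have hsa := size_update a i (a i + 1)
    have hab' : a ≤ b' := fun l => by
      by_cases hl : l = i
      · subst hl
        exact Nat.lt_succ_iff.1 hi
      · have := hab l
        rwa [Function.update_of_ne hl] at this
    have h1 := ih hab' (Finset.sum_le_sum fun i _ => hab' i) (by omega)
    have hab2 : Function.update a i (a i + 1) ≤ Function.update b' i (b' i + 1) := fun l => by
      by_cases hl : l = i
      · subst hl
        rw [Function.update_self, Function.update_self]
        exact hi
      · simp only [Function.update_of_ne hl]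
        exact hab' l
    have h2 := ih hab2 (Finset.sum_le_sum fun i _ => hab2 i) (by omega)
    rw [translate_update, ← translate_shift] at h2
    rw [← risingSeries_sub_shift ρ b' i, translate_sub_smul] at h1
    have h3 := add_mem h1 (Submodule.smul_mem _ ρ h2)
    rwa [sub_add_cancel] at h3

theorem negBin_mem_domain_mapP (hs : 0 < s) {ρL ρR ρ : ℝ} (hL : 0 < ρL) (hR : 0 < ρR)
    (hρ : 0 < ρ) (b : Config n) :
    negBin (fun _ => ρ) (fun i => (b i : ℝ) + 2 * s) ∈ (mapP n s ρL ρR ρ).domain := by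
  have hb : ∀ i, 0 < (b i : ℝ) + 2 * s := fun i => by positivity
  have hd : negBin (fun _ => ρ) (fun i => (b i : ℝ) + 2 * s) ∈ decaying n :=
    negBin_mem_decaying (fun _ => hρ.le) (fun _ => le_rfl) hb
  have hl : lowered univ (negBin (fun _ => ρ) fun i => (b i : ℝ) + 2 * s) =
      risingSeries (fun _ => ρ) fun i => (b i : ℝ) + 2 * s :=
    funext fun j => (hasSum_binom_mul_negBin (fun _ => hρ.le) hb j).tsum_eq
  have h := translate_mem_comap_mapForm hs hL hR ρ (a := 0) (b := b) fun i => Nat.zero_le _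
  rw [translate_zero, Submodule.mem_comap, ← hl] at h
  obtain ⟨u, hu, hu'⟩ := mem_lowerRange.1 h
  exact LinearPMap.mem_domain_of_mem_graph (mem_graph_mapP.2 ⟨hd, hu, hu'⟩)

/-! ## Totality of the negative binomial vectors -/

theorem SubExp.mul {f g : Config n → ℝ} (hf : SubExp f) (hg : SubExp g) :
    SubExp fun m => f m * g m := by
  intro r hr
  obtain ⟨t, ht1, ht⟩ := exists_one_lt_pow_lt hr 2
  obtain ⟨C, hC⟩ := hf t ht1
  obtain ⟨D, hD⟩ := hg t ht1
  have ht0 : 0 < t := by linarith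
  refine ⟨|C * D|, fun m => ?_⟩
  rw [abs_mul]
  calc |f m| * |g m| ≤ (C * t ^ size m) * (D * t ^ size m) :=
        mul_le_mul (hC m) (hD m) (abs_nonneg _) ((abs_nonneg _).trans (hC m))
    _ = C * D * (t ^ 2) ^ size m := by ring
    _ ≤ |C * D| * (t ^ 2) ^ size m := by
        gcongr
        exact le_abs_self _
    _ ≤ _ := by gcongr

theorem SubExp.prod {ι : Type*} (S : Finset ι) {f : ι → Config n → ℝ} (hf : ∀ i ∈ S, SubExp (f i)) :
    SubExp fun m => ∏ i ∈ S, f i m := by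
  classical
  induction S using Finset.induction_on with
  | empty =>
    intro r hr
    exact ⟨1, fun m => by simpa using one_le_pow₀ hr.le⟩
  | insert i S hi ih =>
    simp only [Finset.prod_insert hi]
    exact (hf i (Finset.mem_insert_self i S)).mul
      (ih fun j hj => hf j (Finset.mem_insert_of_mem hj))

theorem subExp_add_coord {c : ℝ} (hc : 0 ≤ c) (i : Fin (n + 1)) :
    SubExp fun m : Config n => c + m i := by
  intro r hr
  refine ⟨c + 1 / (r - 1), fun m => ?_⟩
  have h0 : 0 < r - 1 := by linarith
  have h1 : (1 : ℝ) + size m * (r - 1) ≤ r ^ size m := by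
    simpa using one_add_mul_le_pow (a := r - 1) (by linarith) (size m)
  have h2 : (1 : ℝ) ≤ r ^ size m := one_le_pow₀ hr.le
  have h3 : (m i : ℝ) ≤ size m := by exact_mod_cast le_size m i
  have h4 : (size m : ℝ) ≤ 1 / (r - 1) * r ^ size m := by
    rw [one_div_mul_eq_div, le_div_iff₀ h0]
    linarith
  rw [abs_of_nonneg (by positivity)]
  nlinarith

theorem subExp_prod_rising (hs : 0 < s) (b : Config n) :
    SubExp fun p : Config n => ∏ i, rising (2 * s + p i) (b i) := by
  refine SubExp.prod _ fun i _ => SubExp.prod _ fun t _ => ?_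
  have h : (fun p : Config n => 2 * s + (p i : ℝ) + t) = fun p => (2 * s + t) + p i := by
    funext p
    ring
  rw [h]
  exact subExp_add_coord (by positivity) i

/-- Up to constants, raising the shapes by b multiplies a fixed positive weight by a polynomial in p
of degree b_i at site i. -/
theorem negBin_add {ρ : ℝ} (hρ : 0 < ρ) (b p : Config n) :
    (∏ i, (1 + ρ) ^ (b i : ℝ) * rising (2 * s) (b i)) *
        negBin (fun _ => ρ) (fun i => (b i : ℝ) + 2 * s) p =
      negBin (fun _ => ρ) (fun _ => 2 * s) p * ∏ i, rising (2 * s + p i) (b i) := by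
  rw [negBin, negBin, ← Finset.prod_mul_distrib, ← Finset.prod_mul_distrib]
  refine Finset.prod_congr rfl fun i _ => ?_
  have h0 : 0 < 1 + ρ := by linarith
  have h1 : rising (2 * s) (b i) * rising ((b i : ℝ) + 2 * s) (p i) =
      rising (2 * s) (p i) * rising (2 * s + p i) (b i) := by
    rw [← rising_add, add_comm (b i : ℝ), ← rising_add, add_comm]
  have h2 : (1 + ρ) ^ (b i : ℝ) * (1 + ρ) ^ (-((b i : ℝ) + 2 * s)) = (1 + ρ) ^ (-(2 * s)) := by
    rw [← Real.rpow_add h0]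
    congr 1
    ring
  calc _ = ((1 + ρ) ^ (b i : ℝ) * (1 + ρ) ^ (-((b i : ℝ) + 2 * s))) * (ρ / (1 + ρ)) ^ p i *
        (rising (2 * s) (b i) * rising ((b i : ℝ) + 2 * s) (p i)) / (p i).factorial := by ring
    _ = _ := by
      rw [h1, h2]
      ring

theorem binom_mul_prod_rising_recursion (a b p : Config n) (i : Fin (n + 1)) :
    ((a i : ℝ) + 1) * (binom univ (Function.update a i (a i + 1)) p *
        ∏ l, rising (2 * s + p l) (b l)) =
      binom univ a p * ∏ l, rising (2 * s + p l) (Function.update b i (b i + 1) l) -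
        (2 * s + a i + b i) * (binom univ a p * ∏ l, rising (2 * s + p l) (b l)) := by
  have h1 : ∏ l, rising (2 * s + p l) (Function.update b i (b i + 1) l) =
      (2 * s + p i + b i) * ∏ l, rising (2 * s + p l) (b l) := by
    rw [← Finset.mul_prod_erase _ _ (Finset.mem_univ i),
      ← Finset.mul_prod_erase _ (fun l => rising (2 * s + p l) (b l)) (Finset.mem_univ i),
      Function.update_self, rising_succ,
      Finset.prod_congr rfl fun l hl => by rw [Function.update_of_ne (Finset.ne_of_mem_erase hl)]]
    ring
  rw [← mul_assoc, binom_update_succ (Finset.mem_univ i), h1]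
  ring

/-- Passes from moments in the basis of rising factorials to binomial moments, one degree at a time.
Keeping both factors, with b arbitrary, makes the induction on size a close. -/
theorem tsum_binom_mul_prod_rising_eq_zero (hs : 0 < s) {F : Vec n} (hF : F ∈ decaying n)
    (h : ∀ b : Config n, ∑' p, (∏ i, rising (2 * s + p i) (b i)) * F p = 0) (a b : Config n) :
    ∑' p, binom univ a p * (∏ i, rising (2 * s + p i) (b i)) * F p = 0 := by
  obtain ⟨k, hk⟩ : ∃ k, size a = k := ⟨_, rfl⟩
  induction k generalizing a b with
  | zero =>
    have ha : a = 0 := funext fun i => Nat.le_zero.1 (hk ▸ le_size a i)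
    have : ∀ p, binom univ a p = 1 := fun p => by simp [binom, ha]
    simp only [this, one_mul, h]
  | succ k ih =>
    obtain ⟨i, hi⟩ : ∃ i, a i ≠ 0 := by
      by_contra! h
      have : size a = 0 := Finset.sum_eq_zero fun i _ => h i
      omega
    obtain ⟨c, rfl⟩ : ∃ c : Config n, a = Function.update c i (c i + 1) :=
      ⟨Function.update a i (a i - 1), by
        rw [Function.update_self, Function.update_idem, Nat.sub_add_cancel (by omega),
          Function.update_eq_self]⟩
    have hc := size_update c i (c i + 1)
    have hsum : ∀ b : Config n, HasSum
        (fun p => binom univ c p * (∏ i, rising (2 * s + p i) (b i)) * F p) 0 := fun b => by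
      have h1 := (((subExp_binom univ c).mul (subExp_prod_rising hs b)).summable hF).hasSum
      rwa [ih c b (by omega)] at h1
    have h2 := (hsum (Function.update b i (b i + 1))).sub
      ((hsum b).mul_left (2 * s + c i + b i))
    have h3 : HasSum (fun p => ((c i : ℝ) + 1) * (binom univ (Function.update c i (c i + 1)) p *
        (∏ i, rising (2 * s + p i) (b i)) * F p)) 0 := by
      convert! h2 using 1
      · funext p
        linear_combination F p * binom_mul_prod_rising_recursion (s := s) c b p i
      · ring
    have h4 := h3.tsum_eq
    rw [tsum_mul_left] at h4
    exact (mul_eq_zero.1 h4).resolve_left (by positivity)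

/-- For bounded f the product of f with the weight decays and all its binomial moments vanish, so it
is zero by injectivity of the binomial transform; the weight is positive. -/
theorem eq_zero_of_tsum_negBin_mul (hs : 0 < s) {ρ : ℝ} (hρ : 0 < ρ) {f : Vec n} {C : ℝ}
    (hf : ∀ p, |f p| ≤ C)
    (h : ∀ b : Config n, ∑' p, negBin (fun _ => ρ) (fun i => (b i : ℝ) + 2 * s) p * f p = 0) :
    f = 0 := by
  set w : Vec n := negBin (fun _ => ρ) fun _ => 2 * s with hw
  have hs2 : ∀ _i : Fin (n + 1), 0 < 2 * s := fun _ => by linarith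
  have hw0 : ∀ p, 0 < w p := fun p => Finset.prod_pos fun i _ => by
    have := rising_pos (hs2 i) (p i)
    positivity
  have hF : (fun p => w p * f p) ∈ decaying n := by
    refine mem_decaying_of_abs_le (w := C • w)
      (Submodule.smul_mem _ C (negBin_mem_decaying (fun _ => hρ.le) (fun _ => le_rfl) hs2))
      fun p => ?_
    rw [Pi.smul_apply, smul_eq_mul, abs_mul, abs_mul, mul_comm]
    exact mul_le_mul_of_nonneg_right ((hf p).trans (le_abs_self C)) (abs_nonneg _)
  have h1 : ∀ b : Config n, ∑' p, (∏ i, rising (2 * s + p i) (b i)) * (w p * f p) = 0 := fun b => by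
    have h2 : ∀ p : Config n, (∏ i, rising (2 * s + p i) (b i)) * (w p * f p) =
        (∏ i, (1 + ρ) ^ (b i : ℝ) * rising (2 * s) (b i)) *
          (negBin (fun _ => ρ) (fun i => (b i : ℝ) + 2 * s) p * f p) := fun p => by
      rw [← mul_assoc, mul_comm _ (w p), ← negBin_add hρ b p]
      ring
    simp only [h2]
    rw [tsum_mul_left, h, mul_zero]
  have h3 := tsum_binom_mul_prod_rising_eq_zero hs hF h1
  -- At b = 0 the rising factors are one and the sums are the coordinates of the binomial transform.
  have h4 : (fun p => w p * f p) = 0 := lowered_eq_zero univ hF <| funext fun j => by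
    have := h3 j 0
    simpa [lowered] using this
  funext p
  exact (mul_eq_zero.1 (congrFun h4 p)).resolve_left (hw0 p).ne'

/-! ### Density in the Hilbert space -/

theorem decaying_memℓp {v : Vec n} (hv : v ∈ decaying n) :
    Memℓp (E := fun _ : Config n => ℝ) v 2 := by
  refine memℓp_gen ?_
  obtain ⟨r, hr, C, hC⟩ := hv
  have hr0 : 0 < r := by linarith
  have hq : (r ^ 2)⁻¹ < 1 := inv_lt_one_of_one_lt₀ (one_lt_pow₀ hr two_ne_zero)
  refine Summable.of_nonneg_of_le (fun m => by positivity) (fun m => ?_)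
    ((summable_pow_size (n := n) (by positivity) hq).mul_left (C ^ 2))
  have h1 : |v m| ≤ C / r ^ size m := by
    rw [le_div_iff₀ (by positivity)]
    exact hC m
  calc ‖v m‖ ^ (2 : ENNReal).toReal = |v m| ^ 2 := by simp
    _ ≤ (C / r ^ size m) ^ 2 := by gcongr
    _ = _ := by
      rw [div_pow, inv_pow, ← pow_mul, ← pow_mul, mul_comm 2]
      ring

/-- The domain of the transformation in `ℓ²`. -/
def domainInL2 (D : Submodule ℝ (Vec n)) : Submodule ℝ (lp (fun _ : Config n => ℝ) 2) where
  carrier := {f | (f : Config n → ℝ) ∈ D}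
  zero_mem' := D.zero_mem
  add_mem' := fun hf hg => D.add_mem hf hg
  smul_mem' := fun c _ hf => D.smul_mem c hf

/-- A square-summable vector is bounded by its norm, so one orthogonal to the domain, hence to all
negative binomial vectors, is zero. -/
theorem dense_domain_mapP (hs : 0 < s) {ρL ρR ρ : ℝ} (hL : 0 < ρL) (hR : 0 < ρR) (hρ : 0 < ρ) :
    Dense {f : lp (fun _ : Config n => ℝ) 2 |
      (f : Config n → ℝ) ∈ (mapP n s ρL ρR ρ).domain} := by
  change Dense (domainInL2 (mapP n s ρL ρR ρ).domain : Set (lp (fun _ : Config n => ℝ) 2))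
  rw [Submodule.dense_iff_topologicalClosure_eq_top, Submodule.topologicalClosure_eq_top_iff,
    Submodule.eq_bot_iff]
  intro f hf
  refine lp.ext (eq_zero_of_tsum_negBin_mul hs hρ (C := ‖f‖)
    (fun p => lp.norm_apply_le_norm two_ne_zero f p) fun b => ?_)
  have hd := negBin_mem_domain_mapP (n := n) hs hL hR hρ b
  have hdec : negBin (fun _ => ρ) (fun i => (b i : ℝ) + 2 * s) ∈ decaying n :=
    (mem_graph_mapP.1 (LinearPMap.mem_graph (mapP n s ρL ρR ρ) ⟨_, hd⟩)).1
  have h := (Submodule.mem_orthogonal _ f).1 hf ⟨_, decaying_memℓp hdec⟩ hd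
  rw [lp.inner_eq_tsum] at h
  simpa [mul_comm] using h

theorem div_one_sub_pos {β : ℝ} (hβ : β ∈ Set.Ioo (0 : ℝ) 1) : 0 < β / (1 - β) :=
  div_pos hβ.1 (sub_pos.2 hβ.2)

end

end OpenChain

theorem proposition4p4 (n : ℕ) (s βL βR ρ : ℝ) (hs : 0 < s)
    (hL : βL ∈ Set.Ioo (0 : ℝ) 1) (hR : βR ∈ Set.Ioo (0 : ℝ) 1) (hρ : 0 < ρ) :
    -- both Hamiltonians act on all vectors of exponential decay
    (hamiltonian n s βL βR).domain = decaying n ∧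
    (hamiltonianEq n s ρ).domain = decaying n ∧
    -- the exponentials of the lowering operators act injectively on these vectors
    (expDec (SminusTot (n := n))).domain = decaying n ∧
    LinearMap.ker (expDec (SminusTot (n := n))).toFun = ⊥ ∧
    (∀ i : Fin (n + 1), (expDec (Sminus i)).domain = decaying n ∧
      LinearMap.ker (expDec (Sminus i)).toFun = ⊥) ∧
    -- `P` is densely defined (in the Hilbert space `ℓ²`) and invertible onto its range
    Dense {f : lp (fun _ : Config n => ℝ) 2 |
      (f : Config n → ℝ) ∈ (mapP n s (βL / (1 - βL)) (βR / (1 - βR)) ρ).domain} ∧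
    LinearMap.ker (mapP n s (βL / (1 - βL)) (βR / (1 - βR)) ρ).toFun = ⊥ ∧
    -- `H^eq = P⁻¹ H P`
    (hamiltonianEq n s ρ).domRestrict (mapP n s (βL / (1 - βL)) (βR / (1 - βR)) ρ).domain =
      (mapP n s (βL / (1 - βL)) (βR / (1 - βR)) ρ).inverse ∘ₙ
        hamiltonian n s βL βR ∘ₙ mapP n s (βL / (1 - βL)) (βR / (1 - βR)) ρ := by
  refine ⟨hamiltonian_domain hs hL hR, ?_, expDec_domain univ, ker_expDec univ, fun i => ?_,
    dense_domain_mapP hs (div_one_sub_pos hL) (div_one_sub_pos hR) hρ, ker_mapP hs _ _ _,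
    domRestrict_hamiltonianEq hs hL hR hρ⟩
  · rw [hamiltonianEq_eq hs hρ]
    exact hamiltonian_domain hs (div_one_add_mem_Ioo hρ) (div_one_add_mem_Ioo hρ)
  · rw [← lowering_singleton]
    exact ⟨expDec_domain {i}, ker_expDec {i}⟩
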